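/- Consider $N$ sources sending update packets through a single-server queue, empty at time $0$, to a monitor. The packets of source $i$ are generated, and arrive at the queue, according to a Poisson process of rate $\lambda_i>0$; the processes of different sources are independent. The service times of the packets are i.i.d. exponential with rate $\mu>0$ and independent of the arrivals. Let $\rho_i=\lambda_i/\mu$ and $\rho=\sum_{i=1}^N\rho_i$. The age $\Delta_i(t)$ of source $i$ is the time elapsed at $t$ since the generation of the freshest packet of source $i$ delivered to the monitor (that is, whose service has been completed) by time $t$, and $\Delta_i(t)=\Delta_i(0)+t$ if there is none, where $\Delta_i(0)\ge 0$ is a given constant. We say that source $i$ has average age $\Delta_i$ if $$\lim_{T\to\infty}\frac1T\int_0^T\Delta_i(t)\,dt=\Delta_i\ \text{ with probability }1,\qquad\text{and}\qquad \lim_{t\to\infty}\mathbb E[\Delta_i(t)]=\Delta_i .$$ Then every source $i$ has an average age, in both of the following systems, given as follows. (a) (LCFS-S, preemption in service.) If each arriving packet, whatever its source, enters service at once, and the packet in service, if any, is discarded, then $$\Delta_i=\frac1\mu(1+\rho)\frac1{\rho_i}.$$ (b) (LCFS-W, preemption only in waiting.) If a packet in service is never interrupted, a packet that arrives while the server is busy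 waits and replaces (discards) the packet waiting, if any, whatever its source, and the waiting packet enters service when the current service ends, while a packet that finds the server idle enters service at once, then $$\Delta_i=\frac1\mu\left[\alpha_W(\rho)+\left(1+\frac{\rho^2}{1+\rho}\right)\frac1{\rho_i}\right],\qquad \alpha_W(\rho)=\frac{(1+\rho+\rho^2)^2+2\rho^3}{(1+\rho+\rho^2)(1+\rho)^2}.$$ -/

import Mathlib

open MeasureTheory ProbabilityTheory Filter Topology
open scoped NNReal

noncomputable section

namespace StatusAge

/-! ### The probabilistic model -/

/-- `X` is a Poisson process of rate `r`: it starts at `0` and has independent increments, the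
increment over `(s, t]` having the Poisson distribution with mean `r * (t - s)`. -/
structure IsPoissonProcess {Ω : Type*} [MeasurableSpace Ω] (P : Measure Ω) (r : ℝ)
    (X : ℝ≥0 → Ω → ℕ) : Prop where
  zero : ∀ᵐ ω ∂P, X 0 ω = 0
  indep : HasIndepIncrements X P
  law : ∀ s t : ℝ≥0, s ≤ t →
    HasLaw (fun ω => X t ω - X s ω) (poissonMeasure (r.toNNReal * (t - s))) P

/-- The number of packets of source `i` that arrive during `(0, t]`, where packet `n` is generated
by source `src n` and arrives at time `arr n`. -/
def arrivalCount {N : ℕ} (arr : ℕ → ℝ) (src : ℕ → Fin N) (i : Fin N) (t : ℝ≥0) : ℕ :=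
  {n | src n = i ∧ 0 < arr n ∧ arr n ≤ t}.ncard

/-- The random input of an `N`-source M/M/1 queue that is empty at time `0`. Packets (of all
sources together) are numbered `0, 1, 2, …` in the order of their arrival; packet `n` is generated
by source `src n`, arrives at the queue at time `arr n`, and needs service time `svc n`.
The arrivals of the sources are independent Poisson processes, source `i` having rate `lam i`;
the service times are i.i.d. exponential with rate `mu` and independent of the arrivals. -/
structure IsMM1Input {Ω : Type*} [MeasurableSpace Ω] (P : Measure Ω) {N : ℕ}
    (lam : Fin N → ℝ) (mu : ℝ)
    (arr : ℕ → Ω → ℝ) (src : ℕ → Ω → Fin N) (svc : ℕ → Ω → ℝ) : Prop where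
  measurable_arr : ∀ n, Measurable (arr n)
  measurable_src : ∀ n, Measurable (src n)
  measurable_svc : ∀ n, Measurable (svc n)
  arr_pos : ∀ᵐ ω ∂P, 0 < arr 0 ω
  arr_strictMono : ∀ᵐ ω ∂P, StrictMono fun n => arr n ω
  arr_tendsto : ∀ᵐ ω ∂P, Tendsto (fun n => arr n ω) atTop atTop
  poisson : ∀ i, IsPoissonProcess P (lam i)
    fun t ω => arrivalCount (fun n => arr n ω) (fun n => src n ω) i t
  indep_sources : iIndepFun
    (fun (i : Fin N) (ω : Ω) (t : ℝ≥0) =>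
      arrivalCount (fun n => arr n ω) (fun n => src n ω) i t) P
  svc_law : ∀ n, HasLaw (svc n) (expMeasure mu) P
  indep_svc : iIndepFun svc P
  indep_arr_svc : IndepFun (fun ω n => (arr n ω, src n ω)) (fun ω n => svc n ω) P

/-! ### The two queue disciplines, along one sample path

`arr n` and `svc n` are the arrival time and the service time of packet `n`. -/

/-- LCFS-S, preemption in service: packet `n` enters service as soon as it arrives, preempting (and
discarding) any packet in service, and is itself discarded if packet `n + 1` arrives before its
service is complete. So it is delivered, at time `d`, iff `d = arr n + svc n ≤ arr (n + 1)`. -/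
def DeliveredS (arr svc : ℕ → ℝ) (n : ℕ) (d : ℝ) : Prop :=
  d = arr n + svc n ∧ d ≤ arr (n + 1)

/-- LCFS-W, preemption only in waiting: `serviceW arr svc m = (n, s)` says that the `m`-th service
is that of packet `n` and starts at time `s`; it is never interrupted, so it ends at
`d = s + svc n`. If some packet has arrived in the meantime (equivalently, if packet `n + 1` has),
then the packet that waits at time `d` is the last one that arrived up to time `d`, since each
new arrival replaces the waiting packet; it enters service at time `d`. Otherwise the
server is idle from `d` until packet `n + 1` arrives and enters service at once. -/
def serviceW (arr svc : ℕ → ℝ) : ℕ → ℕ × ℝ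
  | 0 => (0, arr 0)
  | m + 1 =>
    let n := (serviceW arr svc m).1
    let d := (serviceW arr svc m).2 + svc n
    open Classical in
    if arr (n + 1) ≤ d then (sSup {k | arr k ≤ d}, d) else (n + 1, arr (n + 1))

/-- Under LCFS-W, packet `n` is delivered at time `d`: it gets served and its service ends
at `d`. -/
def DeliveredW (arr svc : ℕ → ℝ) (n : ℕ) (d : ℝ) : Prop :=
  ∃ m, (serviceW arr svc m).1 = n ∧ d = (serviceW arr svc m).2 + svc n

/-! ### Age -/

/-- The age of source `i` at the monitor at time `t`: the time elapsed since the generation of the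
freshest update of source `i` that has been delivered by time `t`. A source has age `a` at time `0`,
that is, the monitor starts with an update that was generated at time `-a`. -/
def age {N : ℕ} (Delivered : ℕ → ℝ → Prop) (arr : ℕ → ℝ) (src : ℕ → Fin N) (a : ℝ) (i : Fin N)
    (t : ℝ) : ℝ :=
  t - sSup (insert (-a) {g | ∃ n d, src n = i ∧ Delivered n d ∧ d ≤ t ∧ g = arr n})

/-- The age process `D` (`D t ω` is the age at time `t`) has average age `L`: with probability one
the time average over `(0, T)` tends to `L` as `T → ∞`, and the expected age at time `t` tends to
`L` as `t → ∞`; the integrals concerned exist. -/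
structure HasAverageAge {Ω : Type*} [MeasurableSpace Ω] (P : Measure Ω) (D : ℝ → Ω → ℝ)
    (L : ℝ) : Prop where
  intervalIntegrable : ∀ᵐ ω ∂P, ∀ T : ℝ, 0 ≤ T →
    IntervalIntegrable (fun t => D t ω) volume 0 T
  time_average : ∀ᵐ ω ∂P,
    Tendsto (fun T : ℝ => (1 / T) * ∫ t in (0 : ℝ)..T, D t ω) atTop (𝓝 L)
  integrable : ∀ t : ℝ, 0 ≤ t → Integrable (D t) P
  mean_limit : Tendsto (fun t : ℝ => ∫ ω, D t ω ∂P) atTop (𝓝 L)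

/-- The function `α_W`. -/
def alphaW (r : ℝ) : ℝ :=
  ((1 + r + r ^ 2) ^ 2 + 2 * r ^ 3) / ((1 + r + r ^ 2) * (1 + r) ^ 2)

end StatusAge

end

namespace StatusAge

set_option linter.unusedSectionVars false

open scoped ENNReal

/-! ### A strong law for orthogonal random variables -/

/-! Under either discipline packets enter service in the order of their arrival, and the starts of
service cut time into cycles. The mark of a cycle consists of the source of its packet, its length,
its service time, and the lag, which is the age of the next packet when that packet enters service.
Under LCFS-S a cycle is the gap between two arrivals and the lag is 0. Under LCFS-W the length is
the maximum of the service time and the time to the next arrival, and the lag is the time since the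
last arrival if any packet came during the service. Exponential gaps are memoryless, so the input
seen from the next start of service has the original law and is independent of the mark of the
current cycle (`map_cycleS_nextS`, `map_cycleW_nextW`); hence the marks are i.i.d.
(`isCycleInput_regenerative`).

Within a cycle the age of source i is the time since the start, plus the age of the packet in
service at that start, plus an excess D_m that vanishes once a packet of source i completes service
in the cycle (`IsServiceSequence.isAgePath`). The excess satisfies D_{m+1} = len_m - lag_m +
lag_{m-1} + D_m 1{miss}, with first lag 0, where a miss is a cycle that delivers nothing from source
i. So D_m is a function of the past and is independent of mark m, and its second moments stay
bounded.

Time average: sums of Z_m (f(W_m) - E f), with Z_m determined by the past, have orthogonal terms, so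
they are negligible after division by n (`ae_tendsto_average_of_orthogonal`). The recursion
telescopes, so the average of D_m 1{hit} tends to E len; by independence the average of D_m tends to
E len / P(hit). Inserting this in the integral of the age over one cycle and dividing by E len gives
`meanAge` (`ae_time_average`).

Expected age: it is a sum over cycles of kernels evaluated at t minus the start of the cycle. Sums
without the excess are convolutions with the renewal measure; the excess obeys a renewal equation
whose iteration contracts by the factor P(miss) (`tendsto_renewalSum_excess`). No general renewal
theorem is needed: at each time either no cycle has started or exactly one is running, and this
identity determines the renewal measure explicitly when cycles are exponential or maxima of two
exponentials. It has a bounded density tending to 1 / E len (`hasRenewalDensity_exp`,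
`exists_hasRenewalDensity_max`), and dominated convergence does the rest (`tendsto_mean`).

The input is given through counting processes, whereas the argument uses i.i.d. exponential gaps and
i.i.d. sources. The latter model has the same joint law of counts on every regular grid, and as the
mesh tends to 0 the counts determine gaps and sources, so the laws agree (`eq_of_map_cells`,
`IsMM1Input.map_arrivals`). What remains is the moments of one cycle (`meanAge_cycleS`,
`meanAge_cycleW`). -/

theorem ae_tendsto_zero_of_tsum_lintegral_ne_top {Ω : Type*} [MeasurableSpace Ω] {P : Measure Ω}
    {f : ℕ → Ω → ℝ≥0∞} (hf : ∀ n, AEMeasurable (f n) P) (h : ∑' n, ∫⁻ ω, f n ω ∂P ≠ ∞) :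
    ∀ᵐ ω ∂P, Tendsto (fun n => f n ω) atTop (𝓝 0) := by
  rw [← lintegral_tsum hf] at h
  filter_upwards [ae_lt_top' (AEMeasurable.tsum hf) h] with ω hω
  exact ENNReal.tendsto_atTop_zero_of_tsum_ne_top hω.ne

/-- The bounds are summable, so the sum of the squares has finite expectation and is almost surely
finite; its terms then tend to 0. -/
theorem ae_tendsto_zero_of_integral_sq_le {Ω : Type*} [MeasurableSpace Ω] {P : Measure Ω}
    {f : ℕ → Ω → ℝ} (hf : ∀ n, MemLp (f n) 2 P) {K : ℝ}
    (h : ∀ n, ∫ ω, f n ω ^ 2 ∂P ≤ K / ((n : ℝ) + 1) ^ 2) :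
    ∀ᵐ ω ∂P, Tendsto (fun n => f n ω) atTop (𝓝 0) := by
  have key : ∀ᵐ ω ∂P, Tendsto (fun n => ENNReal.ofReal (f n ω ^ 2)) atTop (𝓝 0) := by
    refine ae_tendsto_zero_of_tsum_lintegral_ne_top
      (fun n => ((hf n).aestronglyMeasurable.aemeasurable.pow_const 2).ennreal_ofReal) ?_
    have hs : Summable fun n : ℕ => K / ((n : ℝ) + 1) ^ 2 := by
      have := (summable_nat_add_iff 1).2 (Real.summable_one_div_nat_pow.2 (one_lt_two))
      simpa [div_eq_mul_inv] using this.mul_left K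
    refine ne_top_of_le_ne_top hs.tsum_ofReal_ne_top (ENNReal.tsum_le_tsum fun n => ?_)
    rw [← ofReal_integral_eq_lintegral_ofReal (hf n).integrable_sq
      (Eventually.of_forall fun ω => sq_nonneg _)]
    exact ENNReal.ofReal_le_ofReal (h n)
  filter_upwards [key] with ω hω
  have h1 : Tendsto (fun n => f n ω ^ 2) atTop (𝓝 0) := by
    have := (ENNReal.tendsto_toReal ENNReal.zero_ne_top).comp hω
    refine (this.congr fun n => ?_)
    simp [ENNReal.toReal_ofReal (sq_nonneg (f n ω))]
  have h2 := (Real.continuous_sqrt.tendsto 0).comp h1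
  rw [Real.sqrt_zero] at h2
  refine tendsto_zero_iff_abs_tendsto_zero _ |>.2 (h2.congr fun n => ?_)
  simp [Real.sqrt_sq_eq_abs]

theorem integral_sum_sq_of_orthogonal {Ω : Type*} [MeasurableSpace Ω] {P : Measure Ω}
    {X : ℕ → Ω → ℝ} (hX : ∀ n, MemLp (X n) 2 P)
    (horth : ∀ j k, j < k → ∫ ω, X j ω * X k ω ∂P = 0) (n : ℕ) :
    ∫ ω, (∑ k ∈ Finset.range n, X k ω) ^ 2 ∂P = ∑ k ∈ Finset.range n, ∫ ω, X k ω ^ 2 ∂P := by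
  induction n with
  | zero => simp
  | succ n ih =>
    have hS : MemLp (fun ω => ∑ k ∈ Finset.range n, X k ω) 2 P :=
      memLp_finsetSum _ fun k _ => hX k
    have hprod : ∀ k, Integrable (fun ω => X k ω * X n ω) P :=
      fun k => (hX k).integrable_mul (hX n)
    have h1 : ∫ ω, (∑ k ∈ Finset.range n, X k ω) * X n ω ∂P = 0 := by
      simp_rw [Finset.sum_mul]
      rw [integral_finsetSum _ fun k _ => hprod k]
      exact Finset.sum_eq_zero fun k hk => horth k n (Finset.mem_range.1 hk)
    have hSX : Integrable (fun ω => (∑ k ∈ Finset.range n, X k ω) * X n ω) P :=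
      hS.integrable_mul (hX n)
    calc ∫ ω, (∑ k ∈ Finset.range (n + 1), X k ω) ^ 2 ∂P
        = ∫ ω, ((∑ k ∈ Finset.range n, X k ω) ^ 2
            + 2 * ((∑ k ∈ Finset.range n, X k ω) * X n ω)) + X n ω ^ 2 ∂P := by
          congr 1; ext ω; rw [Finset.sum_range_succ]; ring
      _ = _ := by
          have h2 : Integrable (fun ω => (∑ k ∈ Finset.range n, X k ω) ^ 2
              + 2 * ((∑ k ∈ Finset.range n, X k ω) * X n ω)) P :=
            hS.integrable_sq.add (hSX.const_mul 2)
          rw [integral_add h2 (hX n).integrable_sq,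
            integral_add hS.integrable_sq (hSX.const_mul 2), integral_const_mul, h1, ih,
            Finset.sum_range_succ]
          ring

/-- Strong law of large numbers for orthogonal random variables with bounded second moments. -/
theorem ae_tendsto_average_of_orthogonal {Ω : Type*} [MeasurableSpace Ω] {P : Measure Ω}
    {X : ℕ → Ω → ℝ} (hX : ∀ n, MemLp (X n) 2 P)
    (horth : ∀ j k, j < k → ∫ ω, X j ω * X k ω ∂P = 0)
    {K : ℝ} (hK : ∀ n, ∫ ω, X n ω ^ 2 ∂P ≤ K) :
    ∀ᵐ ω ∂P, Tendsto (fun n : ℕ => (∑ k ∈ Finset.range n, X k ω) / n) atTop (𝓝 0) := by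
  have hK0 : 0 ≤ K := (integral_nonneg fun ω => sq_nonneg (X 0 ω)).trans (hK 0)
  -- the sums at the squares
  have hA := ae_tendsto_zero_of_integral_sq_le (P := P) (K := K)
    (f := fun n ω => (∑ k ∈ Finset.range ((n + 1) ^ 2), X k ω) / ((n : ℝ) + 1) ^ 2)
    (fun n => by
      simpa [div_eq_inv_mul] using
        (memLp_finsetSum (Finset.range ((n + 1) ^ 2)) fun k _ => hX k).const_mul
          ((((n : ℝ) + 1) ^ 2)⁻¹))
    (fun n => by
      simp_rw [div_pow]
      rw [integral_div, integral_sum_sq_of_orthogonal hX horth]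
      have h1 : ∑ k ∈ Finset.range ((n + 1) ^ 2), ∫ ω, X k ω ^ 2 ∂P ≤ ((n : ℝ) + 1) ^ 2 * K := by
        refine (Finset.sum_le_sum fun k _ => hK k).trans ?_
        simp
      rw [div_le_div_iff₀ (by positivity) (by positivity)]
      calc _ ≤ ((n : ℝ) + 1) ^ 2 * K * ((n : ℝ) + 1) ^ 2 := by gcongr
        _ = _ := by ring)
  -- the fluctuations between consecutive squares
  have hB := ae_tendsto_zero_of_integral_sq_le (P := P) (K := 9 * K)
    (f := fun n ω => (∑ k ∈ Finset.Ico ((n + 1) ^ 2) ((n + 2) ^ 2), |X k ω|) / ((n : ℝ) + 1) ^ 2)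
    (fun n => by
      simpa [div_eq_inv_mul] using
        (memLp_finsetSum (Finset.Ico ((n + 1) ^ 2) ((n + 2) ^ 2)) fun k _ => (hX k).abs).const_mul
          ((((n : ℝ) + 1) ^ 2)⁻¹))
    (fun n => by
      simp_rw [div_pow]
      rw [integral_div]
      have hcard : ((Finset.Ico ((n + 1) ^ 2) ((n + 2) ^ 2)).card : ℝ) = 2 * (n : ℝ) + 3 := by
        rw [Nat.card_Ico, Nat.cast_sub (by gcongr; omega)]
        push_cast; ring
      -- Cauchy–Schwarz over the 2n + 3 terms of the block; the bound 2n + 3 ≤ 3(n + 1) then yields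
      -- the constant 9 K.
      have h1 : ∫ ω, (∑ k ∈ Finset.Ico ((n + 1) ^ 2) ((n + 2) ^ 2), |X k ω|) ^ 2 ∂P
          ≤ (2 * (n : ℝ) + 3) ^ 2 * K := by
        calc _ ≤ ∫ ω, (2 * (n : ℝ) + 3) *
              ∑ k ∈ Finset.Ico ((n + 1) ^ 2) ((n + 2) ^ 2), X k ω ^ 2 ∂P := by
              refine integral_mono ?_ ?_ fun ω => ?_
              · exact (memLp_finsetSum _ fun k _ => (hX k).abs).integrable_sq
              · exact (integrable_finsetSum _ fun k _ => (hX k).integrable_sq).const_mul _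
              · have := sq_sum_le_card_mul_sum_sq
                  (s := Finset.Ico ((n + 1) ^ 2) ((n + 2) ^ 2)) (f := fun k => |X k ω|)
                rw [hcard] at this
                simpa only [sq_abs] using this
          _ ≤ (2 * (n : ℝ) + 3) * ((2 * (n : ℝ) + 3) * K) := by
              rw [integral_const_mul, integral_finsetSum _ fun k _ => (hX k).integrable_sq]
              gcongr
              refine (Finset.sum_le_sum fun k _ => hK k).trans ?_
              rw [Finset.sum_const, nsmul_eq_mul, hcard]
          _ = _ := by ring
      rw [div_le_div_iff₀ (by positivity) (by positivity)]
      calc _ ≤ (2 * (n : ℝ) + 3) ^ 2 * K * ((n : ℝ) + 1) ^ 2 := by gcongr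
        _ ≤ (3 * ((n : ℝ) + 1)) ^ 2 * K * ((n : ℝ) + 1) ^ 2 := by
            gcongr
            have : (0 : ℝ) ≤ n := Nat.cast_nonneg n
            linarith
        _ = _ := by ring)
  filter_upwards [hA, hB] with ω hAω hBω
  -- The n with (n + 1)² ≤ m < (n + 2)² is `Nat.sqrt m - 1`.
  have hsq : Tendsto (fun m : ℕ => Nat.sqrt m - 1) atTop atTop := by
    refine tendsto_atTop.2 fun b => ?_
    filter_upwards [eventually_ge_atTop ((b + 1) ^ 2)] with m hm
    have : b + 1 ≤ Nat.sqrt m := Nat.le_sqrt'.2 hm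
    omega
  have hlim := ((hAω.abs.add hBω).comp hsq)
  simp only [abs_zero, add_zero] at hlim
  refine squeeze_zero_norm' ?_ hlim
  filter_upwards [eventually_ge_atTop 1] with m hm
  obtain ⟨n, hn⟩ : ∃ n, Nat.sqrt m = n + 1 :=
    ⟨Nat.sqrt m - 1, by have : 1 ≤ Nat.sqrt m := Nat.le_sqrt'.2 (by simpa using hm); omega⟩
  have hle : (n + 1) ^ 2 ≤ m := by rw [← hn]; exact Nat.sqrt_le' m
  have hlt : m < (n + 2) ^ 2 := by
    have := Nat.lt_succ_sqrt' m
    rw [hn] at this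
    exact this
  have hmR : ((n : ℝ) + 1) ^ 2 ≤ m := by exact_mod_cast hle
  simp only [Function.comp, hn, Nat.add_sub_cancel]
  have hsplit : ∑ k ∈ Finset.range m, X k ω = ∑ k ∈ Finset.range ((n + 1) ^ 2), X k ω
      + ∑ k ∈ Finset.Ico ((n + 1) ^ 2) m, X k ω := by
    rw [Finset.sum_range_add_sum_Ico _ hle]
  have hblock : |∑ k ∈ Finset.Ico ((n + 1) ^ 2) m, X k ω|
      ≤ ∑ k ∈ Finset.Ico ((n + 1) ^ 2) ((n + 2) ^ 2), |X k ω| :=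
    (Finset.abs_sum_le_sum_abs _ _).trans (Finset.sum_le_sum_of_subset_of_nonneg
      (Finset.Ico_subset_Ico le_rfl hlt.le) fun _ _ _ => abs_nonneg _)
  rw [Real.norm_eq_abs, abs_div, abs_div,
    abs_of_nonneg (by positivity : (0 : ℝ) ≤ (m : ℝ)),
    abs_of_nonneg (by positivity : (0 : ℝ) ≤ ((n : ℝ) + 1) ^ 2), ← add_div]
  gcongr
  rw [hsplit]
  exact (abs_add_le _ _).trans (by gcongr)

/-! ### From sums over cycles to time averages -/

/-- The integral of a nonnegative function is monotone in its upper limit, so the average at T lies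
between averages formed with consecutive epochs, and the ratio of their indices tends to 1. The
epochs need not be monotone: `k T` is the first index with `T < s (k T)`, and that alone gives `s (k
T - 1) ≤ T`. -/
theorem tendsto_time_average {f : ℝ → ℝ} (hf0 : ∀ t, 0 ≤ t → 0 ≤ f t)
    (hfi : ∀ T, 0 ≤ T → IntervalIntegrable f volume 0 T) {s : ℕ → ℝ} (hs0 : ∀ n, 0 ≤ s n)
    {c l : ℝ} (hc : 0 < c) (hs : Tendsto (fun n : ℕ => s n / n) atTop (𝓝 c))
    (hF : Tendsto (fun n : ℕ => (∫ t in (0 : ℝ)..s n, f t) / n) atTop (𝓝 l)) :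
    Tendsto (fun T : ℝ => (1 / T) * ∫ t in (0 : ℝ)..T, f t) atTop (𝓝 (l / c)) := by
  classical
  have hsinf : Tendsto s atTop atTop := by
    have := hs.pos_mul_atTop hc tendsto_natCast_atTop_atTop
    refine this.congr' ?_
    filter_upwards [eventually_ne_atTop 0] with n hn
    field_simp
  have hex : ∀ T : ℝ, ∃ k, T < s k := fun T => (hsinf.eventually_gt_atTop T).exists
  set k : ℝ → ℕ := fun T => Nat.find (hex T) with hk
  have hk1 : ∀ T, T < s (k T) := fun T => Nat.find_spec (hex T)
  have hk2 : ∀ T, ∀ j < k T, s j ≤ T := fun T j hj => not_lt.1 (Nat.find_min (hex T) hj)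
  have hkinf : Tendsto k atTop atTop := by
    refine tendsto_atTop.2 fun b => ?_
    have : ∀ᶠ T : ℝ in atTop, ∀ j ∈ Finset.range b, s j ≤ T :=
      (Finset.eventually_all _).2 fun j _ => eventually_ge_atTop _
    filter_upwards [this] with T hT
    by_contra h
    exact absurd (hk1 T) (not_lt.2 (hT _ (Finset.mem_range.2 (not_le.1 h))))
  have hmono : ∀ x y, 0 ≤ x → x ≤ y → ∫ t in (0 : ℝ)..x, f t ≤ ∫ t in (0 : ℝ)..y, f t := by
    intro x y hx hxy
    refine intervalIntegral.integral_mono_interval le_rfl hx hxy ?_ (hfi y (hx.trans hxy))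
    filter_upwards [ae_restrict_mem measurableSet_Ioc] with t ht using hf0 t ht.1.le
  have hk1inf : Tendsto (fun T => k T - 1) atTop atTop :=
    (tendsto_sub_atTop_nat 1).comp hkinf
  have hr1 : Tendsto (fun n : ℕ => ((n + 1 : ℕ) : ℝ) / (n : ℝ)) atTop (𝓝 1) := by
    have := tendsto_const_nhds (x := (1 : ℝ)).add
      (tendsto_const_nhds (x := (1 : ℝ)).div_atTop (tendsto_natCast_atTop_atTop (R := ℝ)))
    rw [add_zero] at this
    refine this.congr' ?_
    filter_upwards [eventually_ne_atTop 0] with n hn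
    push_cast; field_simp
  have hr2 : Tendsto (fun n : ℕ => (n : ℝ) / ((n + 1 : ℕ) : ℝ)) atTop (𝓝 1) := by
    have := hr1.inv₀ one_ne_zero
    simpa using this
  have hlow : Tendsto (fun n : ℕ => (∫ t in (0 : ℝ)..s n, f t) / s (n + 1)) atTop (𝓝 (l / c)) := by
    have := (hF.mul hr2).div (hs.comp (tendsto_add_atTop_nat 1)) hc.ne'
    rw [mul_one] at this
    refine this.congr' ?_
    filter_upwards [eventually_ne_atTop 0] with n hn
    have : ((n + 1 : ℕ) : ℝ) ≠ 0 := by positivity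
    simp only [Function.comp, Pi.div_apply]
    field_simp
  have hup : Tendsto (fun n : ℕ => (∫ t in (0 : ℝ)..s (n + 1), f t) / s n) atTop (𝓝 (l / c)) := by
    have := ((hF.comp (tendsto_add_atTop_nat 1)).mul hr1).div hs hc.ne'
    rw [mul_one] at this
    refine this.congr' ?_
    filter_upwards [eventually_ne_atTop 0] with n hn
    have : ((n + 1 : ℕ) : ℝ) ≠ 0 := by positivity
    simp only [Function.comp, Pi.div_apply]
    field_simp
  refine tendsto_of_tendsto_of_tendsto_of_le_of_le' (hlow.comp hk1inf) (hup.comp hk1inf) ?_ ?_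
  · filter_upwards [hkinf.eventually_ge_atTop 1, eventually_gt_atTop 0] with T hT hT0
    simp only [Function.comp, Nat.sub_add_cancel hT]
    have h1 := hk2 T (k T - 1) (by omega)
    have h0 : 0 ≤ ∫ t in (0 : ℝ)..s (k T - 1), f t :=
      intervalIntegral.integral_nonneg (hs0 _) fun t ht => hf0 t ht.1
    rw [one_div, ← div_eq_inv_mul]
    calc _ ≤ (∫ t in (0 : ℝ)..s (k T - 1), f t) / T := by gcongr; exact (hk1 T).le
      _ ≤ _ := by gcongr; exact hmono _ _ (hs0 _) h1
  · filter_upwards [hkinf.eventually_ge_atTop 1, eventually_gt_atTop 0,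
      (hsinf.comp hk1inf).eventually_gt_atTop 0] with T hT hT0 hs1
    simp only [Function.comp] at hs1 ⊢
    rw [Nat.sub_add_cancel hT]
    have h1 := hk2 T (k T - 1) (by omega)
    have h0 : 0 ≤ ∫ t in (0 : ℝ)..s (k T), f t :=
      intervalIntegral.integral_nonneg (hs0 _) fun t ht => hf0 t ht.1
    rw [one_div, ← div_eq_inv_mul]
    calc _ ≤ (∫ t in (0 : ℝ)..s (k T), f t) / T := by
          gcongr; exact hmono _ _ hT0.le (hk1 T).le
      _ ≤ _ := by gcongr

/-! ### Cyclic age processes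

Time is divided into cycles. Each cycle starts with the service of a packet; a tagged packet whose
service ends within the cycle is delivered then. -/

/-- The description of a cycle by a random mark `w`: its length `len w`, the service time `srv w`
of its packet, whether its packet belongs to the source considered (`w ∈ tag`), and the age
`lag w` of the packet of the next cycle when that cycle starts. -/
structure CycleModel (𝒲 : Type*) [MeasurableSpace 𝒲] where
  len : 𝒲 → ℝ
  srv : 𝒲 → ℝ
  lag : 𝒲 → ℝ
  tag : Set 𝒲
  measurable_len : Measurable len
  measurable_srv : Measurable srv
  measurable_lag : Measurable lag
  measurableSet_tag : MeasurableSet tag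
  srv_nonneg : ∀ w, 0 ≤ srv w
  lag_nonneg : ∀ w, 0 ≤ lag w
  lag_le_len : ∀ w, lag w ≤ len w

namespace CycleModel

variable {𝒲 : Type*} [MeasurableSpace 𝒲] (c : CycleModel 𝒲)

/-- The cycles whose packet is tagged and delivered. -/
def hit : Set 𝒲 := {w | w ∈ c.tag ∧ c.srv w ≤ c.len w}

/-- The start of cycle `m`. -/
def start (s₀ : ℝ) (w : ℕ → 𝒲) : ℕ → ℝ
  | 0 => s₀
  | m + 1 => start s₀ w m + c.len (w m)

/-- The age of the packet of cycle `m` at the start of that cycle. -/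
def lagAt (w : ℕ → 𝒲) : ℕ → ℝ
  | 0 => 0
  | m + 1 => c.lag (w m)

/-- The amount by which the age at the start of cycle `m` exceeds the age of the packet then
entering service. -/
noncomputable def excess (a s₀ : ℝ) (w : ℕ → 𝒲) : ℕ → ℝ
  | 0 => a + s₀
  | m + 1 => c.len (w m) - c.lag (w m) + c.lagAt w m
      + c.hitᶜ.indicator (fun _ => excess a s₀ w m) (w m)

/-- The integral of the age over cycle `m`. -/
noncomputable def cycleIntegral (a s₀ : ℝ) (w : ℕ → 𝒲) (m : ℕ) : ℝ :=
  (c.excess a s₀ w m + c.lagAt w m) * c.len (w m) + c.len (w m) ^ 2 / 2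
    - c.excess a s₀ w m * c.tag.indicator (fun v => max (c.len v - c.srv v) 0) (w m)

/-- `f` is the age process with initial age `a`, first cycle starting at `s₀` and marks `w`. -/
def IsAgePath (a s₀ : ℝ) (w : ℕ → 𝒲) (f : ℝ → ℝ) : Prop :=
  (∀ t, 0 ≤ t → t < s₀ → f t = a + t) ∧
  ∀ m t, c.start s₀ w m ≤ t → t < c.start s₀ w (m + 1) →
    f t = (t - c.start s₀ w m) + c.lagAt w m
      + {v | v ∈ c.tag ∧ c.srv v ≤ t - c.start s₀ w m}ᶜ.indicator
          (fun _ => c.excess a s₀ w m) (w m)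

theorem len_nonneg (w : 𝒲) : 0 ≤ c.len w := (c.lag_nonneg w).trans (c.lag_le_len w)

theorem measurableSet_hit : MeasurableSet c.hit :=
  c.measurableSet_tag.inter (measurableSet_le c.measurable_srv c.measurable_len)

theorem start_mono (s₀ : ℝ) (w : ℕ → 𝒲) : Monotone (c.start s₀ w) :=
  monotone_nat_of_le_succ fun m => by
    rw [start]; linarith [c.len_nonneg (w m)]

theorem start_nonneg {s₀ : ℝ} (hs₀ : 0 ≤ s₀) (w : ℕ → 𝒲) (m : ℕ) : 0 ≤ c.start s₀ w m :=
  hs₀.trans (c.start_mono s₀ w (Nat.zero_le m))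

theorem lagAt_nonneg (w : ℕ → 𝒲) (m : ℕ) : 0 ≤ c.lagAt w m := by
  cases m
  · exact le_rfl
  · exact c.lag_nonneg _

theorem excess_nonneg {a s₀ : ℝ} (ha : 0 ≤ a) (hs₀ : 0 ≤ s₀) (w : ℕ → 𝒲) (m : ℕ) :
    0 ≤ c.excess a s₀ w m := by
  induction m with
  | zero => exact add_nonneg ha hs₀
  | succ m ih =>
    rw [excess]
    have h1 := c.lag_le_len (w m)
    have h2 := c.lagAt_nonneg w m
    have h3 : 0 ≤ c.hitᶜ.indicator (fun _ => c.excess a s₀ w m) (w m) :=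
      Set.indicator_nonneg (fun _ _ => ih) _
    linarith

/-- The age at the start of a cycle is at most the initial age plus the time elapsed. -/
theorem excess_add_lagAt_le {a s₀ : ℝ} (ha : 0 ≤ a) (hs₀ : 0 ≤ s₀) (w : ℕ → 𝒲) (m : ℕ) :
    c.excess a s₀ w m + c.lagAt w m ≤ a + c.start s₀ w m := by
  induction m with
  | zero => simp [excess, lagAt, start]
  | succ m ih =>
    rw [excess, start, show c.lagAt w (m + 1) = c.lag (w m) from rfl]
    have h3 : c.hitᶜ.indicator (fun _ => c.excess a s₀ w m) (w m) ≤ c.excess a s₀ w m :=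
      Set.indicator_le_self' (fun _ _ => c.excess_nonneg ha hs₀ w m) _
    linarith

theorem exists_cycle {s₀ : ℝ} {w : ℕ → 𝒲} (h : Tendsto (c.start s₀ w) atTop atTop) {t : ℝ}
    (ht : s₀ ≤ t) : ∃ m, c.start s₀ w m ≤ t ∧ t < c.start s₀ w (m + 1) := by
  classical
  have hex : ∃ k, t < c.start s₀ w k := (h.eventually_gt_atTop t).exists
  obtain ⟨m, hm⟩ : ∃ m, Nat.find hex = m + 1 := by
    refine Nat.exists_eq_succ_of_ne_zero fun h0 => ?_
    have := Nat.find_spec hex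
    rw [h0] at this
    exact absurd this (not_lt.2 ht)
  refine ⟨m, not_lt.1 (Nat.find_min hex (by omega)), ?_⟩
  rw [← hm]
  exact Nat.find_spec hex

theorem IsAgePath.nonneg {a s₀ : ℝ} {w : ℕ → 𝒲} {f : ℝ → ℝ} (hf : c.IsAgePath a s₀ w f)
    (ha : 0 ≤ a) (hs₀ : 0 ≤ s₀) (h : Tendsto (c.start s₀ w) atTop atTop) {t : ℝ} (ht : 0 ≤ t) :
    0 ≤ f t := by
  rcases lt_or_ge t s₀ with h1 | h1
  · rw [hf.1 t ht h1]; linarith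
  · obtain ⟨m, hm1, hm2⟩ := c.exists_cycle h h1
    rw [hf.2 m t hm1 hm2]
    have h2 := c.lagAt_nonneg w m
    have h3 : 0 ≤ {v | v ∈ c.tag ∧ c.srv v ≤ t - c.start s₀ w m}ᶜ.indicator
        (fun _ => c.excess a s₀ w m) (w m) :=
      Set.indicator_nonneg (fun _ _ => c.excess_nonneg ha hs₀ w m) _
    linarith

/-- The value at the right end is left free because the age may jump there; a single point is null.
-/
theorem integral_affine_piece {f : ℝ → ℝ} {u v k : ℝ} (huv : u ≤ v)
    (h : ∀ t, u ≤ t → t < v → f t = t + k) :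
    IntervalIntegrable f volume u v ∧
      ∫ t in u..v, f t = (v ^ 2 - u ^ 2) / 2 + k * (v - u) := by
  have hae : ∀ᵐ t ∂volume, t ∈ Set.uIoc u v → f t = t + k := by
    filter_upwards [(measure_eq_zero_iff_ae_notMem.1 (measure_singleton v))] with t ht htv
    rw [Set.uIoc_of_le huv] at htv
    exact h t htv.1.le (lt_of_le_of_ne htv.2 ht)
  have hi : IntervalIntegrable (fun t : ℝ => t + k) volume u v :=
    (continuous_id.add continuous_const).intervalIntegrable _ _
  constructor
  · refine hi.congr_ae ?_
    rw [Filter.EventuallyEq, ae_restrict_iff' measurableSet_uIoc]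
    filter_upwards [hae] with t ht htv using (ht htv).symm
  · rw [intervalIntegral.integral_congr_ae hae, intervalIntegral.integral_add
      intervalIntegral.intervalIntegrable_id (continuous_const.intervalIntegrable _ _)]
    simp; ring

/-- The age has slope one, except that in a hit cycle it drops by the excess after time `srv`; the
interval is split there. In a cycle that is not a hit the correction term vanishes, either because
the mark is not tagged or because the positive part is 0. -/
theorem IsAgePath.integral_cycle {a s₀ : ℝ} {w : ℕ → 𝒲} {f : ℝ → ℝ}
    (hf : c.IsAgePath a s₀ w f) (m : ℕ) :
    IntervalIntegrable f volume (c.start s₀ w m) (c.start s₀ w (m + 1)) ∧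
      ∫ t in c.start s₀ w m..c.start s₀ w (m + 1), f t = c.cycleIntegral a s₀ w m := by
  have hstart : c.start s₀ w (m + 1) = c.start s₀ w m + c.len (w m) := rfl
  have hl := c.len_nonneg (w m)
  have hsv := c.srv_nonneg (w m)
  set s := c.start s₀ w m
  by_cases hB : w m ∈ c.tag ∧ c.srv (w m) ≤ c.len (w m)
  · have h1 := integral_affine_piece (f := f) (u := s) (v := s + c.srv (w m))
      (k := - s + c.lagAt w m + c.excess a s₀ w m) (by linarith) (fun t h1 h2 => by
        rw [hf.2 m t h1 (by linarith [hB.2]), Set.indicator_of_mem]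
        · ring
        · simp only [Set.mem_compl_iff, Set.mem_ofPred_eq, not_and, not_le]
          intro _; linarith)
    have h2 := integral_affine_piece (f := f) (u := s + c.srv (w m)) (v := s + c.len (w m))
      (k := - s + c.lagAt w m) (by linarith [hB.2]) (fun t h1 h2 => by
        rw [hf.2 m t (by linarith) (by linarith), Set.indicator_of_notMem]
        · ring
        · simp only [Set.mem_compl_iff, Set.mem_ofPred_eq, not_not]
          exact ⟨hB.1, by linarith⟩)
    rw [hstart]
    refine ⟨h1.1.trans h2.1, ?_⟩
    rw [← intervalIntegral.integral_add_adjacent_intervals h1.1 h2.1, h1.2, h2.2, cycleIntegral,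
      Set.indicator_of_mem hB.1, max_eq_left (by linarith [hB.2])]
    ring
  · have h1 := integral_affine_piece (f := f) (u := s) (v := s + c.len (w m))
      (k := - s + c.lagAt w m + c.excess a s₀ w m) (by linarith) (fun t h1 h2 => by
        rw [hf.2 m t h1 (by linarith), Set.indicator_of_mem]
        · ring
        · simp only [Set.mem_compl_iff, Set.mem_ofPred_eq, not_and, not_le]
          intro hB'
          have := not_le.1 fun h => hB ⟨hB', h⟩
          linarith)
    rw [hstart]
    refine ⟨h1.1, ?_⟩
    have h0 : c.tag.indicator (fun v => max (c.len v - c.srv v) 0) (w m) = 0 := by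
      by_cases hB' : w m ∈ c.tag
      · have := not_le.1 fun h => hB ⟨hB', h⟩
        rw [Set.indicator_of_mem hB', max_eq_right (by linarith)]
      · exact Set.indicator_of_notMem hB' _
    rw [h1.2, cycleIntegral, h0]
    ring

theorem IsAgePath.integral_start {a s₀ : ℝ} {w : ℕ → 𝒲} {f : ℝ → ℝ}
    (hf : c.IsAgePath a s₀ w f) (hs₀ : 0 ≤ s₀) (n : ℕ) :
    IntervalIntegrable f volume 0 (c.start s₀ w n) ∧
      ∫ t in (0 : ℝ)..c.start s₀ w n, f t
        = s₀ ^ 2 / 2 + a * s₀ + ∑ m ∈ Finset.range n, c.cycleIntegral a s₀ w m := by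
  induction n with
  | zero =>
    have := integral_affine_piece (f := f) (u := 0) (v := s₀) (k := a) hs₀
      (fun t h1 h2 => by rw [hf.1 t h1 h2, add_comm])
    refine ⟨this.1, ?_⟩
    simp only [start]
    rw [this.2]
    simp
  | succ n ih =>
    have h2 := hf.integral_cycle c n
    refine ⟨ih.1.trans h2.1, ?_⟩
    rw [← intervalIntegral.integral_add_adjacent_intervals ih.1 h2.1, ih.2, h2.2,
      Finset.sum_range_succ]
    ring

end CycleModel

/-! ### Independent cycles -/

/-- The marks `W m` are independent of the past `ℱ m` and all have law `κ`. -/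
structure IsCycleInput {Ω 𝒲 : Type*} [mΩ : MeasurableSpace Ω] [m𝒲 : MeasurableSpace 𝒲]
    (P : Measure Ω) (κ : Measure 𝒲) (ℱ : ℕ → MeasurableSpace Ω) (s₀ : Ω → ℝ)
    (W : ℕ → Ω → 𝒲) : Prop where
  le : ∀ m, ℱ m ≤ mΩ
  mono : ∀ m, ℱ m ≤ ℱ (m + 1)
  measurable_s₀ : Measurable[ℱ 0] s₀
  measurable_W : ∀ m, Measurable[ℱ (m + 1)] (W m)
  indep : ∀ m, Indep (ℱ m) (m𝒲.comap (W m)) P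
  map_eq : ∀ m, P.map (W m) = κ

namespace IsCycleInput

variable {Ω 𝒲 : Type*} [mΩ : MeasurableSpace Ω] [m𝒲 : MeasurableSpace 𝒲]
    {P : Measure Ω} {κ : Measure 𝒲} {ℱ : ℕ → MeasurableSpace Ω} {s₀ : Ω → ℝ}
    {W : ℕ → Ω → 𝒲}

theorem measurable (h : IsCycleInput P κ ℱ s₀ W) (m : ℕ) : Measurable (W m) :=
  (h.measurable_W m).mono (h.le _) le_rfl

theorem measurePreserving (h : IsCycleInput P κ ℱ s₀ W) (m : ℕ) : MeasurePreserving (W m) P κ :=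
  ⟨h.measurable m, h.map_eq m⟩

theorem monotone (h : IsCycleInput P κ ℱ s₀ W) : Monotone ℱ := monotone_nat_of_le_succ h.mono

theorem indepFun (h : IsCycleInput P κ ℱ s₀ W) (m : ℕ) {β : Type*}
    [MeasurableSpace β] {Z : Ω → β} (hZ : Measurable[ℱ m] Z) :
    IndepFun Z (W m) P :=
  indep_of_indep_of_le_left (h.indep m) hZ.comap_le

theorem integral_sq_mul [IsProbabilityMeasure P] (h : IsCycleInput P κ ℱ s₀ W) (m : ℕ) {Z : Ω → ℝ}
    (hZ : Measurable[ℱ m] Z) (hZ2 : MemLp Z 2 P) {f : 𝒲 → ℝ} (hf : Measurable f)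
    (hf2 : MemLp f 2 κ) :
    MemLp (fun ω => Z ω * f (W m ω)) 2 P ∧
      ∫ ω, (Z ω * f (W m ω)) ^ 2 ∂P = (∫ ω, Z ω ^ 2 ∂P) * ∫ w, f w ^ 2 ∂κ := by
  have hfW : MemLp (fun ω => f (W m ω)) 2 P := hf2.comp_measurePreserving (h.measurePreserving m)
  have hind : IndepFun (fun ω => Z ω ^ 2) (fun ω => f (W m ω) ^ 2) P :=
    (h.indepFun m hZ).comp (φ := fun x => x ^ 2) (ψ := fun w => f w ^ 2)
      (by fun_prop) (by fun_prop)
  have hfint := hind.integrable_mul hZ2.integrable_sq hfW.integrable_sq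
  have heq : ∀ ω, (Z ω * f (W m ω)) ^ 2 = Z ω ^ 2 * f (W m ω) ^ 2 := fun ω => by ring
  constructor
  · refine (memLp_two_iff_integrable_sq
      (hZ2.aestronglyMeasurable.mul hfW.aestronglyMeasurable)).2 ?_
    exact hfint.congr (Eventually.of_forall fun ω => (heq ω).symm)
  · simp_rw [heq]
    rw [hind.integral_fun_mul_eq_mul_integral hZ2.integrable_sq.aestronglyMeasurable
      hfW.integrable_sq.aestronglyMeasurable]
    congr 1
    rw [← h.map_eq m, integral_map (h.measurable m).aemeasurable
      (hf.pow_const 2).aestronglyMeasurable]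

/-- A strong law for sums of `Z m * f (W m)` where `Z m` depends on the past of `W m`. -/
theorem ae_tendsto_average [IsProbabilityMeasure P] (h : IsCycleInput P κ ℱ s₀ W)
    [IsProbabilityMeasure κ]
    {Z : ℕ → Ω → ℝ} (hZ : ∀ m, Measurable[ℱ m] (Z m)) (hZ2 : ∀ m, MemLp (Z m) 2 P) {K : ℝ}
    (hK : ∀ m, ∫ ω, Z m ω ^ 2 ∂P ≤ K) {f : 𝒲 → ℝ} (hf : Measurable f) (hf2 : MemLp f 2 κ) :
    ∀ᵐ ω ∂P, Tendsto (fun n : ℕ => (∑ m ∈ Finset.range n,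
      Z m ω * (f (W m ω) - ∫ w, f w ∂κ)) / n) atTop (𝓝 0) := by
  set e := ∫ w, f w ∂κ with he
  set g : 𝒲 → ℝ := fun w => f w - e with hg
  have hgm : Measurable g := hf.sub_const e
  have hg2 : MemLp g 2 κ := hf2.sub (memLp_const e)
  have hX := fun m => h.integral_sq_mul m (hZ m) (hZ2 m) hgm hg2
  refine ae_tendsto_average_of_orthogonal (K := K * ∫ w, g w ^ 2 ∂κ)
    (X := fun m ω => Z m ω * g (W m ω)) (fun m => (hX m).1) ?_ ?_
  -- For j < k every factor other than `g (W k)` is measurable for `ℱ k`, and `g (W k)` is centred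
  -- and independent of `ℱ k`.
  · intro j k hjk
    have hpast : Measurable[ℱ k] (fun ω => Z j ω * g (W j ω) * Z k ω) := by
      have h1 : Measurable[ℱ k] (Z j) := (hZ j).mono (h.monotone hjk.le) le_rfl
      have h2 : Measurable[ℱ k] (fun ω => g (W j ω)) :=
        hgm.comp ((h.measurable_W j).mono (h.monotone hjk) le_rfl)
      exact (h1.mul h2).mul (hZ k)
    have hind : IndepFun (fun ω => Z j ω * g (W j ω) * Z k ω) (fun ω => g (W k ω)) P :=
      (h.indepFun k hpast).comp (φ := id) measurable_id hgm
    have h0 : ∫ ω, g (W k ω) ∂P = 0 := by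
      rw [← integral_map (h.measurable k).aemeasurable hgm.aestronglyMeasurable, h.map_eq k]
      simp only [hg]
      rw [integral_sub (hf2.integrable one_le_two) (integrable_const e)]
      simp [he]
    calc ∫ ω, Z j ω * g (W j ω) * (Z k ω * g (W k ω)) ∂P
        = ∫ ω, (Z j ω * g (W j ω) * Z k ω) * g (W k ω) ∂P := by
          congr 1; ext ω; ring
      _ = 0 := by
          rw [hind.integral_fun_mul_eq_mul_integral
            (hpast.mono (h.le k) le_rfl).aestronglyMeasurable
            (hgm.comp (h.measurable k)).aestronglyMeasurable, h0, mul_zero]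
  · intro m
    rw [(hX m).2]
    exact mul_le_mul_of_nonneg_right (hK m) (integral_nonneg fun w => sq_nonneg _)

end IsCycleInput

/-! ### Time averages of cyclic age processes -/

namespace CycleModel

variable {Ω 𝒲 : Type*} [mΩ : MeasurableSpace Ω] [m𝒲 : MeasurableSpace 𝒲] (c : CycleModel 𝒲)
    {P : Measure Ω} {κ : Measure 𝒲} {ℱ : ℕ → MeasurableSpace Ω} {s₀ : Ω → ℝ}
    {W : ℕ → Ω → 𝒲}

/-- The average age of a cyclic age process whose marks have law `κ`. -/
noncomputable def meanAge (κ : Measure 𝒲) : ℝ :=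
  ∫ w, c.lag w ∂κ + (∫ w, c.len w ∂κ) / κ.real c.hit
    + (∫ w, c.len w ^ 2 ∂κ) / (2 * ∫ w, c.len w ∂κ)
    - (∫ w, c.tag.indicator (fun v => max (c.len v - c.srv v) 0) w ∂κ) / κ.real c.hit

theorem measurable_start (h : IsCycleInput P κ ℱ s₀ W) (m : ℕ) :
    Measurable[ℱ m] (fun ω => c.start (s₀ ω) (fun n => W n ω) m) := by
  induction m with
  | zero => exact h.measurable_s₀
  | succ m ih =>
    exact (ih.mono (h.mono m) le_rfl).add (c.measurable_len.comp (h.measurable_W m))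

theorem measurable_lagAt (h : IsCycleInput P κ ℱ s₀ W) (m : ℕ) :
    Measurable[ℱ m] (fun ω => c.lagAt (fun n => W n ω) m) := by
  cases m with
  | zero => exact measurable_const
  | succ m => exact c.measurable_lag.comp (h.measurable_W m)

theorem measurable_excess (h : IsCycleInput P κ ℱ s₀ W) (a : ℝ) (m : ℕ) :
    Measurable[ℱ m] (fun ω => c.excess a (s₀ ω) (fun n => W n ω) m) := by
  induction m with
  | zero => exact h.measurable_s₀.const_add a
  | succ m ih =>
    have h1 := (c.measurable_len.comp (h.measurable_W m)).sub
      (c.measurable_lag.comp (h.measurable_W m))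
    have h2 := (c.measurable_lagAt h m).mono (h.mono m) le_rfl
    have h3 : Measurable[ℱ (m + 1)] (fun ω => c.hitᶜ.indicator
        (fun _ => c.excess a (s₀ ω) (fun n => W n ω) m) (W m ω)) := by
      have hset : MeasurableSet[ℱ (m + 1)] (W m ⁻¹' c.hitᶜ) :=
        h.measurable_W m c.measurableSet_hit.compl
      exact (ih.mono (h.mono m) le_rfl).indicator hset
    exact (h1.add h2).add h3

theorem memLp_len [IsProbabilityMeasure κ] (hlen : MemLp (fun w => c.len w ^ 2) 2 κ) : MemLp c.len 2 κ :=
  (memLp_two_iff_integrable_sq c.measurable_len.aestronglyMeasurable).2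
    (hlen.integrable one_le_two)

theorem memLp_lag (hlen : MemLp c.len 2 κ) : MemLp c.lag 2 κ :=
  hlen.mono c.measurable_lag.aestronglyMeasurable (Eventually.of_forall fun w => by
    rw [Real.norm_of_nonneg (c.lag_nonneg w), Real.norm_of_nonneg (c.len_nonneg w)]
    exact c.lag_le_len w)

variable [IsProbabilityMeasure P]

theorem memLp_lagAt (h : IsCycleInput P κ ℱ s₀ W) (hlen : MemLp c.len 2 κ) (m : ℕ) :
    MemLp (fun ω => c.lagAt (fun n => W n ω) m) 2 P ∧
      ∫ ω, c.lagAt (fun n => W n ω) m ^ 2 ∂P ≤ ∫ w, c.len w ^ 2 ∂κ := by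
  cases m with
  | zero =>
    simp only [lagAt]
    exact ⟨memLp_const 0, by simpa using integral_nonneg fun w => sq_nonneg _⟩
  | succ m =>
    refine ⟨(c.memLp_lag hlen).comp_measurePreserving (h.measurePreserving m), ?_⟩
    simp only [lagAt]
    rw [← integral_map (f := fun w => c.lag w ^ 2) (h.measurable m).aemeasurable
      (c.measurable_lag.pow_const 2).aestronglyMeasurable, h.map_eq m]
    refine integral_mono (c.memLp_lag hlen).integrable_sq hlen.integrable_sq fun w => ?_
    exact pow_le_pow_left₀ (c.lag_nonneg w) (c.lag_le_len w) 2

variable [IsProbabilityMeasure κ]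

/-- The second moments of the excess are bounded. -/
theorem exists_excess_sq_le (h : IsCycleInput P κ ℱ s₀ W) {a : ℝ} (ha : 0 ≤ a)
    (hs₀ : ∀ ω, 0 ≤ s₀ ω) (hs₀2 : MemLp s₀ 2 P) (hlen : MemLp c.len 2 κ)
    (hp : 0 < κ.real c.hit) :
    ∃ K, ∀ m, MemLp (fun ω => c.excess a (s₀ ω) (fun n => W n ω) m) 2 P ∧
      ∫ ω, c.excess a (s₀ ω) (fun n => W n ω) m ^ 2 ∂P ≤ K := by
  set p := κ.real c.hit with hpdef
  have hp1 : p ≤ 1 := measureReal_le_one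
  set M := (1 + 1 / p) * (4 * ∫ w, c.len w ^ 2 ∂κ) with hM
  have hM0 : 0 ≤ M := mul_nonneg (by positivity)
    (mul_nonneg (by norm_num) (integral_nonneg fun w => sq_nonneg _))
  -- With x the excess restricted to a miss and R = len + lag, the next excess is at most R + x, and
  -- (R + x)² ≤ (1 + p) x² + (1 + 1/p) R². A miss has probability 1 - p, so the second moment E
  -- satisfies E' ≤ (1 - p²) E + M. The proposed bound is preserved by this recursion and dominates
  -- the initial value.
  refine ⟨(∫ ω, (a + s₀ ω) ^ 2 ∂P) + M / p ^ 2, fun m => ?_⟩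
  induction m with
  | zero =>
    refine ⟨(memLp_const a).add hs₀2, ?_⟩
    simp only [excess]
    exact le_add_of_nonneg_right (by positivity)
  | succ m ih =>
    have hind : Measurable (c.hitᶜ.indicator (fun _ => (1 : ℝ))) :=
      measurable_const.indicator c.measurableSet_hit.compl
    have hind2 : MemLp (c.hitᶜ.indicator (fun _ => (1 : ℝ))) 2 κ :=
      memLp_indicator_const 2 c.measurableSet_hit.compl 1 (Or.inr (measure_ne_top _ _))
    have hq : ∫ w, c.hitᶜ.indicator (fun _ => (1 : ℝ)) w ^ 2 ∂κ = 1 - p := by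
      have : (fun w => c.hitᶜ.indicator (fun _ => (1 : ℝ)) w ^ 2)
          = c.hitᶜ.indicator (fun _ => (1 : ℝ)) := by
        ext w; by_cases hw : w ∈ c.hitᶜ <;> simp [hw]
      rw [this, integral_indicator_const _ c.measurableSet_hit.compl,
        measureReal_compl c.measurableSet_hit]
      simp [hpdef]
    set D := fun ω => c.excess a (s₀ ω) (fun n => W n ω) m with hD
    obtain ⟨hX, hX2⟩ := h.integral_sq_mul m (c.measurable_excess h a m) ih.1 hind hind2
    have hind_eq : ∀ ω, c.hitᶜ.indicator (fun _ => D ω) (W m ω)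
        = D ω * c.hitᶜ.indicator (fun _ => (1 : ℝ)) (W m ω) := by
      intro ω; by_cases hw : W m ω ∈ c.hitᶜ <;> simp [hw]
    have hlenW : MemLp (fun ω => c.len (W m ω)) 2 P :=
      hlen.comp_measurePreserving (h.measurePreserving m)
    have hlagW : MemLp (fun ω => c.lag (W m ω)) 2 P :=
      (c.memLp_lag hlen).comp_measurePreserving (h.measurePreserving m)
    obtain ⟨hl, hl2⟩ := c.memLp_lagAt h hlen m
    have hmem : MemLp (fun ω => c.excess a (s₀ ω) (fun n => W n ω) (m + 1)) 2 P := by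
      have := ((hlenW.sub hlagW).add hl).add hX
      refine this.ae_eq (Eventually.of_forall fun ω => ?_)
      simp only [Pi.add_apply, Pi.sub_apply, excess]
      rw [← hind_eq ω]
    refine ⟨hmem, ?_⟩
    set R := fun ω => c.len (W m ω) + c.lagAt (fun n => W n ω) m with hR
    have hR2 : MemLp R 2 P := hlenW.add hl
    have hRle : ∫ ω, R ω ^ 2 ∂P ≤ 4 * ∫ w, c.len w ^ 2 ∂κ := by
      calc ∫ ω, R ω ^ 2 ∂P
          ≤ ∫ ω, (2 * c.len (W m ω) ^ 2 + 2 * c.lagAt (fun n => W n ω) m ^ 2) ∂P := by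
            refine integral_mono hR2.integrable_sq
              ((hlenW.integrable_sq.const_mul 2).add (hl.integrable_sq.const_mul 2)) fun ω => ?_
            simp only [hR]
            nlinarith [sq_nonneg (c.len (W m ω) - c.lagAt (fun n => W n ω) m)]
        _ = 2 * (∫ w, c.len w ^ 2 ∂κ) + 2 * ∫ ω, c.lagAt (fun n => W n ω) m ^ 2 ∂P := by
            rw [integral_add (hlenW.integrable_sq.const_mul 2) (hl.integrable_sq.const_mul 2),
              integral_const_mul, integral_const_mul,
              ← integral_map (f := fun w => c.len w ^ 2) (h.measurable m).aemeasurable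
              (c.measurable_len.pow_const 2).aestronglyMeasurable, h.map_eq m]
        _ ≤ _ := by linarith
    have hstep : ∫ ω, c.excess a (s₀ ω) (fun n => W n ω) (m + 1) ^ 2 ∂P
        ≤ (1 + p) * ((∫ ω, D ω ^ 2 ∂P) * (1 - p)) + (1 + 1 / p) * ∫ ω, R ω ^ 2 ∂P := by
      rw [← hq, ← hX2, ← integral_const_mul, ← integral_const_mul,
        ← integral_add (hX.integrable_sq.const_mul _) (hR2.integrable_sq.const_mul _)]
      refine integral_mono hmem.integrable_sq
        ((hX.integrable_sq.const_mul _).add (hR2.integrable_sq.const_mul _)) fun ω => ?_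
      simp only
      set x := D ω * c.hitᶜ.indicator (fun _ => (1 : ℝ)) (W m ω) with hx
      have hle : c.excess a (s₀ ω) (fun n => W n ω) (m + 1) ≤ R ω + x := by
        have := c.lag_nonneg (W m ω)
        have h2 := hind_eq ω
        simp only [excess, hR]
        rw [← hx] at h2
        change c.len (W m ω) - c.lag (W m ω) + c.lagAt (fun n => W n ω) m
          + c.hitᶜ.indicator (fun _ => D ω) (W m ω) ≤ _
        linarith
      have h0 := c.excess_nonneg ha (hs₀ ω) (fun n => W n ω) (m + 1)
      have h1 : (R ω + x) ^ 2 ≤ (1 + p) * x ^ 2 + (1 + 1 / p) * R ω ^ 2 := by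
        have : (1 + p) * x ^ 2 + (1 + 1 / p) * R ω ^ 2 - (R ω + x) ^ 2
            = (p * x - R ω) ^ 2 / p := by field_simp; ring
        have h2 : 0 ≤ (p * x - R ω) ^ 2 / p := by positivity
        linarith
      exact (pow_le_pow_left₀ h0 hle 2).trans h1
    have hD2 := ih.2
    have h1p : 0 ≤ 1 - p := by linarith
    have e1 : (1 + p) * ((∫ ω, D ω ^ 2 ∂P) * (1 - p))
        ≤ (1 - p ^ 2) * ((∫ ω, (a + s₀ ω) ^ 2 ∂P) + M / p ^ 2) := by
      have : (1 + p) * ((∫ ω, D ω ^ 2 ∂P) * (1 - p)) = (1 - p ^ 2) * ∫ ω, D ω ^ 2 ∂P := by ring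
      rw [this]
      exact mul_le_mul_of_nonneg_left hD2 (by nlinarith)
    have e2 : (1 + 1 / p) * ∫ ω, R ω ^ 2 ∂P ≤ M := by
      rw [hM]; gcongr
    have e3 : (0 : ℝ) ≤ ∫ ω, (a + s₀ ω) ^ 2 ∂P := integral_nonneg fun ω => sq_nonneg _
    have e4 : (1 - p ^ 2) * ((∫ ω, (a + s₀ ω) ^ 2 ∂P) + M / p ^ 2)
        = (1 - p ^ 2) * (∫ ω, (a + s₀ ω) ^ 2 ∂P) + M / p ^ 2 - M := by field_simp; ring
    nlinarith [mul_nonneg (sq_nonneg p) e3]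

/-- Each product of a past variable (the lag or the excess) with a function of the current mark may
be averaged as if the function were its mean. Together with the telescoped recursion for the excess
this evaluates every average that enters the integral over a cycle. The conclusion is uniform over
all age paths `f` with these marks, so that one null set suffices. -/
theorem ae_time_average (h : IsCycleInput P κ ℱ s₀ W) {a : ℝ} (ha : 0 ≤ a)
    (hs₀ : ∀ ω, 0 ≤ s₀ ω) (hs₀2 : MemLp s₀ 2 P) (hlen : MemLp (fun w => c.len w ^ 2) 2 κ)
    (hlen0 : 0 < ∫ w, c.len w ∂κ) (hp : 0 < κ.real c.hit) :
    ∀ᵐ ω ∂P, Tendsto (c.start (s₀ ω) (fun n => W n ω)) atTop atTop ∧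
      ∀ f, c.IsAgePath a (s₀ ω) (fun n => W n ω) f →
        (∀ T, 0 ≤ T → IntervalIntegrable f volume 0 T) ∧
        Tendsto (fun T : ℝ => (1 / T) * ∫ t in (0 : ℝ)..T, f t) atTop (𝓝 (c.meanAge κ)) := by
  have hlen2 := c.memLp_len hlen
  obtain ⟨K, hK⟩ := c.exists_excess_sq_le h ha hs₀ hs₀2 hlen2 hp
  set p := κ.real c.hit with hpdef
  set c₁ := ∫ w, c.len w ∂κ with hc₁
  have hone : ∀ m : ℕ, Measurable[ℱ m] (fun _ : Ω => (1 : ℝ)) := fun m => measurable_const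
  have honeK : ∀ m : ℕ, ∫ _ : Ω, (1 : ℝ) ^ 2 ∂P ≤ 1 := fun m => by simp
  have hgap : Measurable (c.tag.indicator (fun v => max (c.len v - c.srv v) 0)) :=
    ((c.measurable_len.sub c.measurable_srv).max measurable_const).indicator c.measurableSet_tag
  have hgap2 : MemLp (c.tag.indicator (fun v => max (c.len v - c.srv v) 0)) 2 κ := by
    refine hlen2.mono hgap.aestronglyMeasurable (Eventually.of_forall fun w => ?_)
    rw [Real.norm_of_nonneg (c.len_nonneg w)]
    by_cases hw : w ∈ c.tag
    · rw [Set.indicator_of_mem hw, Real.norm_of_nonneg (le_max_right _ _)]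
      exact max_le (by linarith [c.srv_nonneg w]) (c.len_nonneg w)
    · rw [Set.indicator_of_notMem hw, norm_zero]
      exact c.len_nonneg w
  have hhit : Measurable (c.hit.indicator (fun _ => (1 : ℝ))) :=
    measurable_const.indicator c.measurableSet_hit
  have hhit2 : MemLp (c.hit.indicator (fun _ => (1 : ℝ))) 2 κ :=
    memLp_indicator_const 2 c.measurableSet_hit 1 (Or.inr (measure_ne_top _ _))
  have hhitp : ∫ w, c.hit.indicator (fun _ => (1 : ℝ)) w ∂κ = p := by
    rw [integral_indicator_const _ c.measurableSet_hit]; simp [hpdef]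
  have hDm := fun m => c.measurable_excess h a m
  have hD2 := fun m => (hK m).1
  have hDK := fun m => (hK m).2
  -- The excess itself does not converge, but its bounded second moment makes it negligible compared
  -- with n. This removes the boundary term of the telescoping sum.
  have hDzero := ae_tendsto_zero_of_integral_sq_le (P := P) (K := K)
    (f := fun n ω => c.excess a (s₀ ω) (fun n => W n ω) n / ((n : ℝ) + 1))
    (fun n => by simpa [div_eq_inv_mul] using (hD2 n).const_mul (((n : ℝ) + 1)⁻¹))
    (fun n => by
      simp_rw [div_pow]
      rw [integral_div]
      gcongr
      exact hDK n)
  filter_upwards [h.ae_tendsto_average hone (fun _ => memLp_const 1) honeK c.measurable_len hlen2,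
    h.ae_tendsto_average hone (fun _ => memLp_const 1) honeK (c.measurable_len.pow_const 2) hlen,
    h.ae_tendsto_average hone (fun _ => memLp_const 1) honeK c.measurable_lag (c.memLp_lag hlen2),
    h.ae_tendsto_average (fun m => c.measurable_lagAt h m) (fun m => (c.memLp_lagAt h hlen2 m).1)
      (fun m => (c.memLp_lagAt h hlen2 m).2) c.measurable_len hlen2,
    h.ae_tendsto_average hDm hD2 hDK hhit hhit2,
    h.ae_tendsto_average hDm hD2 hDK c.measurable_len hlen2,
    h.ae_tendsto_average hDm hD2 hDK hgap hgap2, hDzero]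
    with ω h1 h2 h3 h4 h5 h6 h7 h8
  rw [hhitp] at h5
  set w : ℕ → 𝒲 := fun n => W n ω with hw
  set D := c.excess a (s₀ ω) w with hD
  set y := c.lagAt w with hy
  set e := ∫ w, c.lag w ∂κ with he
  set c₂ := ∫ w, c.len w ^ 2 ∂κ with hc₂
  set g := c.tag.indicator (fun v => max (c.len v - c.srv v) 0) with hg
  set e₂ := ∫ w, g w ∂κ with he₂
  -- centered averages
  have hcent : ∀ {x : ℕ → ℝ} {l : ℝ},
      Tendsto (fun n : ℕ => (∑ m ∈ Finset.range n, 1 * (x m - l)) / (n : ℝ)) atTop (𝓝 0) →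
      Tendsto (fun n : ℕ => (∑ m ∈ Finset.range n, x m) / (n : ℝ)) atTop (𝓝 l) := by
    intro x l hx
    have := hx.add_const l
    rw [zero_add] at this
    refine this.congr' ?_
    filter_upwards [eventually_ne_atTop 0] with n hn
    simp only [one_mul, Finset.sum_sub_distrib, Finset.sum_const, Finset.card_range, nsmul_eq_mul]
    field_simp; ring
  have g1 := hcent h1
  have g2 := hcent h2
  have g3 := hcent h3
  have hn1 : Tendsto (fun n : ℕ => 1 / (n : ℝ)) atTop (𝓝 0) := tendsto_one_div_atTop_nhds_zero_nat
  have hDn : Tendsto (fun n : ℕ => D n / (n : ℝ)) atTop (𝓝 0) := by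
    have hr : Tendsto (fun n : ℕ => 1 + 1 / (n : ℝ)) atTop (𝓝 1) := by
      simpa using hn1.const_add 1
    have := h8.mul hr
    rw [zero_mul] at this
    refine this.congr' ?_
    filter_upwards [eventually_ne_atTop 0] with n hn
    have : (n : ℝ) + 1 ≠ 0 := by positivity
    field_simp
  -- A single term is the difference of consecutive partial sums, whose normalised limits agree.
  have hyn : Tendsto (fun n : ℕ => c.lag (w n) / (n : ℝ)) atTop (𝓝 0) := by
    have hsucc := (g3.comp (tendsto_add_atTop_nat 1)).mul
      (((tendsto_const_nhds (x := (1 : ℝ))).add hn1))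
    have := hsucc.sub g3
    rw [add_zero, mul_one, sub_self] at this
    refine this.congr' ?_
    filter_upwards [eventually_ne_atTop 0] with n hn
    simp only [Function.comp, Finset.sum_range_succ]
    have : ((n : ℝ) + 1) ≠ 0 := by positivity
    push_cast
    field_simp
    ring
  have hysum : ∀ n, ∑ m ∈ Finset.range (n + 1), y m = ∑ m ∈ Finset.range n, c.lag (w m) := by
    intro n
    rw [Finset.sum_range_succ']
    simp [hy, lagAt]
  have gy : Tendsto (fun n : ℕ => (∑ m ∈ Finset.range n, y m) / (n : ℝ)) atTop (𝓝 e) := by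
    have hyD : Tendsto (fun n : ℕ => y n / (n : ℝ)) atTop (𝓝 0) := by
      rw [← tendsto_add_atTop_iff_nat 1]
      have hle : ∀ n : ℕ, y (n + 1) / ((n + 1 : ℕ) : ℝ) ≤ c.lag (w n) / (n : ℝ) ∨ n = 0 := by
        intro n
        rcases Nat.eq_zero_or_pos n with h0 | h0
        · exact Or.inr h0
        · left
          have : (0 : ℝ) < n := by exact_mod_cast h0
          change c.lag (w n) / _ ≤ _
          push_cast
          gcongr
          · exact c.lag_nonneg _
          · linarith
      refine squeeze_zero' (Eventually.of_forall fun n => ?_) ?_ hyn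
      · exact div_nonneg (c.lagAt_nonneg w _) (Nat.cast_nonneg _)
      · filter_upwards [eventually_ne_atTop 0] with n hn
        exact (hle n).resolve_right hn
    have := g3.sub hyD
    rw [sub_zero] at this
    refine this.congr fun n => ?_
    rw [← hysum n, Finset.sum_range_succ]
    ring
  -- The excess removed by the hits up to n is what was added in total, less what is left. Since the
  -- lag terms cancel in the average, the mean excess removed per cycle is the mean length.
  have htel : ∀ n, ∑ m ∈ Finset.range n, D m * c.hit.indicator (fun _ => (1 : ℝ)) (w m)
      = ∑ m ∈ Finset.range n, c.len (w m) - ∑ m ∈ Finset.range n, c.lag (w m)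
        + ∑ m ∈ Finset.range n, y m - D n + D 0 := by
    intro n
    induction n with
    | zero => simp
    | succ n ih =>
      simp only [Finset.sum_range_succ, ih]
      have hDs : D (n + 1) = c.len (w n) - c.lag (w n) + y n
        + c.hitᶜ.indicator (fun _ => D n) (w n) := rfl
      rw [hDs]
      by_cases hh : w n ∈ c.hit
      · simp [hh]; ring
      · simp [hh]; ring
  have gG : Tendsto (fun n : ℕ => (∑ m ∈ Finset.range n,
      D m * c.hit.indicator (fun _ => (1 : ℝ)) (w m)) / (n : ℝ)) atTop (𝓝 c₁) := by
    have := (((g1.sub g3).add gy).sub hDn).add (hn1.const_mul (D 0))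
    have heq : c₁ - e + e - 0 + D 0 * 0 = c₁ := by ring
    rw [heq] at this
    refine this.congr fun n => ?_
    rw [htel n]; ring
  -- `h5` replaces the hit indicator by its mean p, so the average of D is that of the removed
  -- excess divided by p.
  have gD : Tendsto (fun n : ℕ => (∑ m ∈ Finset.range n, D m) / (n : ℝ)) atTop (𝓝 (c₁ / p)) := by
    have := (gG.sub h5).div_const p
    rw [sub_zero] at this
    refine this.congr fun n => ?_
    rw [← sub_div, ← Finset.sum_sub_distrib, div_right_comm]
    congr 1
    rw [Finset.sum_div]
    refine Finset.sum_congr rfl fun m _ => ?_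
    field_simp; ring
  have gI : Tendsto (fun n : ℕ => (∑ m ∈ Finset.range n, c.cycleIntegral a (s₀ ω) w m) / (n : ℝ))
      atTop (𝓝 (c₁ / p * c₁ + e * c₁ + c₂ / 2 - c₁ / p * e₂)) := by
    have := ((((h6.add (gD.mul_const c₁)).add (h4.add (gy.mul_const c₁))).add
      (g2.div_const 2)).sub (h7.add (gD.mul_const e₂)))
    simp only [zero_add] at this
    refine this.congr fun n => ?_
    rw [div_mul_eq_mul_div, div_mul_eq_mul_div, div_mul_eq_mul_div, div_right_comm,
      ← add_div, ← add_div, ← add_div, ← add_div, ← add_div, ← sub_div]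
    congr 1
    rw [Finset.sum_div, Finset.sum_mul, Finset.sum_mul, Finset.sum_mul]
    simp only [← Finset.sum_add_distrib, ← Finset.sum_sub_distrib]
    refine Finset.sum_congr rfl fun m _ => ?_
    simp only [cycleIntegral]
    ring
  have hsn : ∀ n, c.start (s₀ ω) w n = s₀ ω + ∑ m ∈ Finset.range n, c.len (w m) := by
    intro n
    induction n with
    | zero => simp [start]
    | succ n ih => rw [start, ih, Finset.sum_range_succ]; ring
  have gs : Tendsto (fun n : ℕ => c.start (s₀ ω) w n / (n : ℝ)) atTop (𝓝 c₁) := by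
    have := (hn1.const_mul (s₀ ω)).add g1
    rw [mul_zero, zero_add] at this
    refine this.congr fun n => ?_
    rw [hsn n]; ring
  have hsinf : Tendsto (c.start (s₀ ω) w) atTop atTop := by
    have := gs.pos_mul_atTop hlen0 tendsto_natCast_atTop_atTop
    refine this.congr' ?_
    filter_upwards [eventually_ne_atTop 0] with n hn
    field_simp
  refine ⟨hsinf, fun f hf => ?_⟩
  have hfint : ∀ T, 0 ≤ T → IntervalIntegrable f volume 0 T := by
    intro T hT
    obtain ⟨n, hn⟩ := (hsinf.eventually_ge_atTop T).exists
    refine (hf.integral_start c (hs₀ ω) n).1.mono_set ?_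
    rw [Set.uIcc_of_le hT, Set.uIcc_of_le (hT.trans hn)]
    exact Set.Icc_subset_Icc_right hn
  refine ⟨hfint, ?_⟩
  have gF : Tendsto (fun n : ℕ => (∫ t in (0 : ℝ)..c.start (s₀ ω) w n, f t) / (n : ℝ)) atTop
      (𝓝 (c₁ / p * c₁ + e * c₁ + c₂ / 2 - c₁ / p * e₂)) := by
    have := (hn1.const_mul (s₀ ω ^ 2 / 2 + a * s₀ ω)).add gI
    rw [mul_zero, zero_add] at this
    refine this.congr fun n => ?_
    rw [(hf.integral_start c (hs₀ ω) n).2]; ring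
  have := tendsto_time_average (fun t ht => hf.nonneg c ha (hs₀ ω) hsinf ht) hfint
    (fun n => c.start_nonneg (hs₀ ω) w n) hlen0 gs gF
  convert this using 2
  rw [meanAge, ← hg, ← he₂, ← hc₁, ← he, ← hc₂, ← hpdef]
  field_simp
  ring

end CycleModel

/-! ### Mean values of cyclic age processes -/

/-- Convolution of an integrable kernel with a bounded function that has a limit. -/
theorem lintegral_conv_le {φ : ℝ → ℝ} {M : ℝ} (hM : ∀ s, 0 < s → φ s ≤ M) (k : ℝ → ℝ≥0∞)
    (hk : Measurable k) (t : ℝ) :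
    ∫⁻ s in Set.Ioi 0, k (t - s) * ENNReal.ofReal (φ s) ≤ ENNReal.ofReal M * ∫⁻ v, k v := by
  calc _ ≤ ∫⁻ s in Set.Ioi 0, ENNReal.ofReal M * k (t - s) := by
        refine setLIntegral_mono' measurableSet_Ioi fun s hs => ?_
        rw [mul_comm]
        gcongr
        exact hM s hs
    _ ≤ ∫⁻ s, ENNReal.ofReal M * k (t - s) := setLIntegral_le_lintegral _ _
    _ = _ := by
        rw [lintegral_const_mul _ (by fun_prop), lintegral_sub_left_eq_self k t]

/-- The substitution v = t - s moves t into the bounded factor, and M k dominates. Because φ itself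
has a limit, k only needs to be integrable; no direct Riemann integrability enters. -/
theorem tendsto_lintegral_conv {φ : ℝ → ℝ} (hφ : Measurable φ) {M l : ℝ}
    (hM : ∀ s, 0 < s → φ s ≤ M) (hl : Tendsto φ atTop (𝓝 l)) {k : ℝ → ℝ≥0∞}
    (hk : Measurable k) (hki : ∫⁻ v, k v ≠ ∞) :
    Tendsto (fun t => ∫⁻ s in Set.Ioi 0, k (t - s) * ENNReal.ofReal (φ s)) atTop
      (𝓝 (ENNReal.ofReal l * ∫⁻ v, k v)) := by
  have heq : ∀ t, ∫⁻ s in Set.Ioi 0, k (t - s) * ENNReal.ofReal (φ s)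
      = ∫⁻ v, k v * (Set.Ioi 0).indicator (fun s => ENNReal.ofReal (φ s)) (t - v) := by
    intro t
    rw [← lintegral_indicator measurableSet_Ioi,
      ← lintegral_sub_left_eq_self (fun v => k v *
        (Set.Ioi 0).indicator (fun s => ENNReal.ofReal (φ s)) (t - v)) t]
    refine lintegral_congr fun s => ?_
    by_cases hs : s ∈ Set.Ioi (0 : ℝ)
    · simp [hs]
    · simp [hs]
  simp_rw [heq]
  have hmeas : Measurable ((Set.Ioi (0 : ℝ)).indicator (fun s => ENNReal.ofReal (φ s))) :=
    (hφ.ennreal_ofReal).indicator measurableSet_Ioi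
  rw [← lintegral_const_mul _ hk]
  refine tendsto_lintegral_filter_of_dominated_convergence (fun v => k v * ENNReal.ofReal M)
    (Eventually.of_forall fun t => hk.mul (hmeas.comp (measurable_const.sub measurable_id)))
    (Eventually.of_forall fun t => Eventually.of_forall fun v => ?_) ?_
    ?_
  · gcongr
    by_cases hs : t - v ∈ Set.Ioi (0 : ℝ)
    · rw [Set.indicator_of_mem hs]
      exact ENNReal.ofReal_le_ofReal (hM _ hs)
    · rw [Set.indicator_of_notMem hs]; exact zero_le
  · rw [lintegral_mul_const _ hk]
    exact ENNReal.mul_ne_top hki ENNReal.ofReal_ne_top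
  · filter_upwards [ae_lt_top hk hki] with v hv
    rw [mul_comm]
    refine ENNReal.Tendsto.const_mul ?_ (Or.inr hv.ne)
    have h1 : Tendsto (fun t : ℝ => t - v) atTop atTop := tendsto_atTop_add_const_right _ _ tendsto_id
    refine ((ENNReal.tendsto_ofReal hl).comp h1).congr' ?_
    filter_upwards [h1.eventually_gt_atTop 0] with t ht
    simp [Set.indicator_of_mem (Set.mem_Ioi.2 ht)]

theorem IsCycleInput.lintegral_past {Ω 𝒲 β : Type*} [mΩ : MeasurableSpace Ω]
    [m𝒲 : MeasurableSpace 𝒲] [MeasurableSpace β]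
    {P : Measure Ω} [IsProbabilityMeasure P] {κ : Measure 𝒲} [IsProbabilityMeasure κ]
    {ℱ : ℕ → MeasurableSpace Ω} {s₀ : Ω → ℝ} {W : ℕ → Ω → 𝒲} (h : IsCycleInput P κ ℱ s₀ W)
    (m : ℕ) {Z : Ω → β} (hZ : Measurable[ℱ m] Z) {H : β → 𝒲 → ℝ≥0∞}
    (hH : Measurable (Function.uncurry H)) :
    ∫⁻ ω, H (Z ω) (W m ω) ∂P = ∫⁻ ω, ∫⁻ w, H (Z ω) w ∂κ ∂P := by
  have hZ' : Measurable Z := hZ.mono (h.le m) le_rfl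
  have hprod := (h.indepFun m hZ).map_prod_eq_prod_map_map hZ'.aemeasurable
    (h.measurable m).aemeasurable
  calc ∫⁻ ω, H (Z ω) (W m ω) ∂P
      = ∫⁻ x, Function.uncurry H x ∂(P.map fun ω => (Z ω, W m ω)) := by
        rw [lintegral_map hH (hZ'.prodMk (h.measurable m))]; rfl
    _ = ∫⁻ z, ∫⁻ w, H z w ∂κ ∂(P.map Z) := by
        have : IsProbabilityMeasure (P.map Z) := Measure.isProbabilityMeasure_map hZ'.aemeasurable
        rw [hprod, h.map_eq m, lintegral_prod _ hH.aemeasurable]; rfl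
    _ = _ := lintegral_map hH.lintegral_prod_right' hZ'

namespace CycleModel

variable {Ω 𝒲 : Type*} [mΩ : MeasurableSpace Ω] [m𝒲 : MeasurableSpace 𝒲] (c : CycleModel 𝒲)

/-- The kernel `k` delayed by one cycle and weighted with `g`. -/
noncomputable def delay (κ : Measure 𝒲) (g : 𝒲 → ℝ≥0∞) (k : ℝ → ℝ≥0∞) (v : ℝ) : ℝ≥0∞ :=
  ∫⁻ w, g w * k (v - c.len w) ∂κ

section delay

variable {κ : Measure 𝒲} [IsProbabilityMeasure κ] {g : 𝒲 → ℝ≥0∞} {k : ℝ → ℝ≥0∞}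

theorem measurable_delay_integrand (hg : Measurable g) (hk : Measurable k) :
    Measurable (Function.uncurry fun (v : ℝ) (w : 𝒲) => g w * k (v - c.len w)) :=
  (hg.comp measurable_snd).mul
    (hk.comp (measurable_fst.sub (c.measurable_len.comp measurable_snd)))

theorem measurable_delay (hg : Measurable g) (hk : Measurable k) :
    Measurable (c.delay κ g k) :=
  (c.measurable_delay_integrand hg hk).lintegral_prod_right'

theorem delay_of_neg (hk : ∀ v < 0, k v = 0) {v : ℝ} (hv : v < 0) : c.delay κ g k v = 0 := by
  rw [delay]
  simp [fun w => hk (v - c.len w) (by linarith [c.len_nonneg w])]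

/-- By Tonelli and translation invariance a delay multiplies the mass of the kernel by the integral
of g. With g the indicator of a miss, iterated delays therefore decay geometrically. -/
theorem lintegral_delay (hg : Measurable g) (hk : Measurable k) :
    ∫⁻ v, c.delay κ g k v = (∫⁻ w, g w ∂κ) * ∫⁻ v, k v := by
  simp only [delay]
  rw [lintegral_lintegral_swap (c.measurable_delay_integrand hg hk).aemeasurable,
    ← lintegral_mul_const _ hg]
  refine lintegral_congr fun w => ?_
  rw [lintegral_const_mul _ (by fun_prop), lintegral_sub_right_eq_self]

end delay

variable {P : Measure Ω} [IsProbabilityMeasure P] {κ : Measure 𝒲} [IsProbabilityMeasure κ]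
    {ℱ : ℕ → MeasurableSpace Ω} {s₀ : Ω → ℝ} {W : ℕ → Ω → 𝒲}

/-- The expected sum of `Z m * k (t - start m)` over all cycles `m`. -/
noncomputable def renewalSum (P : Measure Ω) (s₀ : Ω → ℝ) (W : ℕ → Ω → 𝒲) (Z : ℕ → Ω → ℝ)
    (k : ℝ → ℝ≥0∞) (t : ℝ) : ℝ≥0∞ :=
  ∑' m, ∫⁻ ω, ENNReal.ofReal (Z m ω) * k (t - c.start (s₀ ω) (fun n => W n ω) m) ∂P

/-- `Z` and the start of cycle m are determined by the past, so the independent mark of cycle m can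
be integrated out with both held fixed. -/
theorem lintegral_past_kernel (h : IsCycleInput P κ ℱ s₀ W) (m : ℕ) {Z : Ω → ℝ}
    (hZ : Measurable[ℱ m] Z) {H : ℝ → 𝒲 → ℝ≥0∞} (hH : Measurable (Function.uncurry H)) (t : ℝ) :
    ∫⁻ ω, ENNReal.ofReal (Z ω) * H (t - c.start (s₀ ω) (fun n => W n ω) m) (W m ω) ∂P
      = ∫⁻ ω, ENNReal.ofReal (Z ω)
          * (∫⁻ w, H (t - c.start (s₀ ω) (fun n => W n ω) m) w ∂κ) ∂P := by
  have hZs : Measurable[ℱ m] (fun ω => (Z ω, c.start (s₀ ω) (fun n => W n ω) m)) :=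
    hZ.prodMk (c.measurable_start h m)
  have hm : Measurable (Function.uncurry fun (x : ℝ × ℝ) (w : 𝒲) =>
      ENNReal.ofReal x.1 * H (t - x.2) w) := by
    have h1 : Measurable fun y : (ℝ × ℝ) × 𝒲 => ENNReal.ofReal y.1.1 := by fun_prop
    have h2 : Measurable fun y : (ℝ × ℝ) × 𝒲 => ((t - y.1.2, y.2) : ℝ × 𝒲) := by fun_prop
    exact h1.mul (hH.comp h2)
  rw [h.lintegral_past m hZs (H := fun x w => ENNReal.ofReal x.1 * H (t - x.2) w) hm]
  refine lintegral_congr fun ω => ?_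
  have h2 : Measurable fun w : 𝒲 => H (t - c.start (s₀ ω) (fun n => W n ω) m) w :=
    hH.comp measurable_prodMk_left
  rw [lintegral_const_mul _ h2]

theorem lintegral_delay_past (h : IsCycleInput P κ ℱ s₀ W) (m : ℕ) {Z : Ω → ℝ}
    (hZ : Measurable[ℱ m] Z) {g : 𝒲 → ℝ≥0∞} (hg : Measurable g) {k : ℝ → ℝ≥0∞}
    (hk : Measurable k) (t : ℝ) :
    ∫⁻ ω, ENNReal.ofReal (Z ω) * (g (W m ω) * k (t - c.start (s₀ ω) (fun n => W n ω) (m + 1))) ∂P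
      = ∫⁻ ω, ENNReal.ofReal (Z ω)
          * c.delay κ g k (t - c.start (s₀ ω) (fun n => W n ω) m) ∂P := by
  have := c.lintegral_past_kernel h m hZ (c.measurable_delay_integrand hg hk) t
  simp only [start, ← sub_sub]
  exact this

/-- The lag at cycle m + 1 is a function of mark m, so shifting the index by one turns it into a
weight in a delayed kernel. The term for cycle 0 has lag 0 and drops out. -/
theorem renewalSum_lagAt (h : IsCycleInput P κ ℱ s₀ W) {k : ℝ → ℝ≥0∞}
    (hk : Measurable k) (t : ℝ) :
    c.renewalSum P s₀ W (fun m ω => c.lagAt (fun n => W n ω) m) k t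
      = c.renewalSum P s₀ W (fun _ _ => 1) (c.delay κ (fun w => ENNReal.ofReal (c.lag w)) k) t := by
  rw [renewalSum, tsum_eq_zero_add' ENNReal.summable]
  simp only [lagAt, ENNReal.ofReal_zero, zero_mul, lintegral_zero, zero_add]
  refine tsum_congr fun m => ?_
  rw [← c.lintegral_delay_past h m measurable_const c.measurable_lag.ennreal_ofReal hk t]
  simp

/-- The contribution to `renewalSum` of the excess from the initial age and from the growth of the
age over one cycle. -/
noncomputable def excessSource (P : Measure Ω) (κ : Measure 𝒲) (s₀ : Ω → ℝ) (W : ℕ → Ω → 𝒲)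
    (a : ℝ) (k : ℝ → ℝ≥0∞) (t : ℝ) : ℝ≥0∞ :=
  ∫⁻ ω, ENNReal.ofReal (a + s₀ ω) * k (t - s₀ ω) ∂P
    + c.renewalSum P s₀ W (fun _ _ => 1)
        (c.delay κ (fun w => ENNReal.ofReal (c.len w - c.lag w)) k) t
    + c.renewalSum P s₀ W (fun _ _ => 1)
        (c.delay κ (fun w => ENNReal.ofReal (c.lag w)) (c.delay κ (fun _ => 1) k)) t

/-- This is the renewal equation for the excess: the recursion for D_{m+1} is inserted term by term.
Its increments involve no excess and form the source; the part surviving a miss returns as the same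
sum with a delayed kernel. -/
theorem renewalSum_excess (h : IsCycleInput P κ ℱ s₀ W) {a : ℝ} (ha : 0 ≤ a)
    (hs₀ : ∀ ω, 0 ≤ s₀ ω) {k : ℝ → ℝ≥0∞} (hk : Measurable k) (t : ℝ) :
    c.renewalSum P s₀ W (fun m ω => c.excess a (s₀ ω) (fun n => W n ω) m) k t
      = c.excessSource P κ s₀ W a k t
        + c.renewalSum P s₀ W (fun m ω => c.excess a (s₀ ω) (fun n => W n ω) m)
            (c.delay κ (c.hitᶜ.indicator fun _ => 1) k) t := by
  have hind : Measurable (c.hitᶜ.indicator fun _ => (1 : ℝ≥0∞)) :=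
    measurable_const.indicator c.measurableSet_hit.compl
  rw [excessSource, ← c.renewalSum_lagAt h (c.measurable_delay measurable_const hk)]
  rw [renewalSum, tsum_eq_zero_add' ENNReal.summable]
  simp only [excess, start]
  rw [add_assoc, add_assoc]
  congr 1
  simp only [renewalSum]
  rw [← ENNReal.tsum_add, ← ENNReal.tsum_add]
  refine tsum_congr fun m => ?_
  have hlm : Measurable fun w => ENNReal.ofReal (c.len w - c.lag w) :=
    (c.measurable_len.sub c.measurable_lag).ennreal_ofReal
  rw [← c.lintegral_delay_past h m measurable_const hlm hk t,
    ← c.lintegral_delay_past h m (c.measurable_lagAt h m) measurable_const hk t,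
    ← c.lintegral_delay_past h m (c.measurable_excess h a m) hind hk t]
  have hW := h.measurable m
  have hsm : Measurable fun ω => c.start (s₀ ω) (fun n => W n ω) (m + 1) :=
    (c.measurable_start h (m + 1)).mono (h.le _) le_rfl
  have hlag : Measurable fun ω => c.lagAt (fun n => W n ω) m :=
    (c.measurable_lagAt h m).mono (h.le _) le_rfl
  have hks : Measurable fun ω => k (t - c.start (s₀ ω) (fun n => W n ω) (m + 1)) :=
    hk.comp (measurable_const.sub hsm)
  rw [← lintegral_add_left (by
      exact hlag.ennreal_ofReal.mul ((measurable_const).mul hks)),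
    ← lintegral_add_left (by
      exact measurable_const.mul ((hlm.comp hW).mul hks))]
  refine lintegral_congr fun ω => ?_
  have h1 : 0 ≤ c.len (W m ω) - c.lag (W m ω) := sub_nonneg.2 (c.lag_le_len _)
  have h2 := c.lagAt_nonneg (fun n => W n ω) m
  have h3 := c.excess_nonneg ha (hs₀ ω) (fun n => W n ω) m
  have h4 : 0 ≤ c.hitᶜ.indicator (fun _ => c.excess a (s₀ ω) (fun n => W n ω) m) (W m ω) :=
    Set.indicator_nonneg (fun _ _ => h3) _
  change ENNReal.ofReal (c.len (W m ω) - c.lag (W m ω) + c.lagAt (fun n => W n ω) m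
    + c.hitᶜ.indicator (fun _ => c.excess a (s₀ ω) (fun n => W n ω) m) (W m ω))
    * k (t - c.start (s₀ ω) (fun n => W n ω) (m + 1)) = _
  rw [ENNReal.ofReal_add (add_nonneg h1 h2) h4, ENNReal.ofReal_add h1 h2]
  have h5 : ENNReal.ofReal (c.hitᶜ.indicator
      (fun _ => c.excess a (s₀ ω) (fun n => W n ω) m) (W m ω))
      = ENNReal.ofReal (c.excess a (s₀ ω) (fun n => W n ω) m)
        * c.hitᶜ.indicator (fun _ => 1) (W m ω) := by
    by_cases hw : W m ω ∈ c.hitᶜ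
    · simp only [Set.indicator_of_mem hw, mul_one]
    · simp only [Set.indicator_of_notMem hw, ENNReal.ofReal_zero, mul_zero]
  rw [h5]
  simp only [ENNReal.ofReal_one, one_mul]
  ring

end CycleModel

theorem lintegral_expMeasure {r : ℝ} {H : ℝ → ℝ≥0∞} (hH : Measurable H) :
    ∫⁻ x, H x ∂(expMeasure r)
      = ∫⁻ x in Set.Ioi 0, H x * ENNReal.ofReal (r * Real.exp (-(r * x))) := by
  have h1 : expMeasure r = volume.withDensity (exponentialPDF r) := rfl
  have hm : Measurable (exponentialPDF r) := (measurable_exponentialPDFReal r).ennreal_ofReal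
  rw [h1, lintegral_withDensity_eq_lintegral_mul _ hm hH, ← setLIntegral_congr Ioi_ae_eq_Ici.symm,
    ← lintegral_indicator measurableSet_Ici]
  refine lintegral_congr fun x => ?_
  by_cases hx : x ∈ Set.Ici (0 : ℝ)
  · rw [Set.indicator_of_mem hx, Pi.mul_apply, exponentialPDF_of_nonneg hx, mul_comm]
  · rw [Set.indicator_of_notMem hx, Pi.mul_apply, exponentialPDF_of_neg (not_le.1 hx), zero_mul]

/-- The expected number of cycle starts in a set has density `u`, which is bounded by `M` and tends
to the reciprocal of the mean cycle length; the first cycle starts at an exponential time. -/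
structure HasRenewalDensity {Ω 𝒲 : Type*} [MeasurableSpace Ω] [MeasurableSpace 𝒲]
    (c : CycleModel 𝒲) (P : Measure Ω) (κ : Measure 𝒲) (s₀ : Ω → ℝ) (W : ℕ → Ω → 𝒲)
    (r : ℝ) (u : ℝ → ℝ) (M : ℝ) : Prop where
  rate_pos : 0 < r
  map_s₀ : P.map s₀ = expMeasure r
  measurable : Measurable u
  le : ∀ s, 0 < s → u s ≤ M
  tendsto : Tendsto u atTop (𝓝 (1 / ∫ w, c.len w ∂κ))
  renewalSum_eq : ∀ k : ℝ → ℝ≥0∞, Measurable k → ∀ t,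
    c.renewalSum P s₀ W (fun _ _ => 1) k t = ∫⁻ s in Set.Ioi 0, k (t - s) * ENNReal.ofReal (u s)

namespace CycleModel

variable {Ω 𝒲 : Type*} [mΩ : MeasurableSpace Ω] [m𝒲 : MeasurableSpace 𝒲] (c : CycleModel 𝒲)
    {P : Measure Ω} [IsProbabilityMeasure P] {κ : Measure 𝒲} [IsProbabilityMeasure κ]
    {ℱ : ℕ → MeasurableSpace Ω} {s₀ : Ω → ℝ} {W : ℕ → Ω → 𝒲} {r M : ℝ} {u : ℝ → ℝ}

theorem lintegral_initial_age (h : IsCycleInput P κ ℱ s₀ W)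
    (hu : HasRenewalDensity c P κ s₀ W r u M) {a : ℝ} (ha : 0 ≤ a) {k : ℝ → ℝ≥0∞}
    (hk : Measurable k) (t : ℝ) :
    ∫⁻ ω, ENNReal.ofReal (a + s₀ ω) * k (t - s₀ ω) ∂P
      = ∫⁻ s in Set.Ioi 0, k (t - s) * ENNReal.ofReal ((a + s) * (r * Real.exp (-(r * s)))) := by
  have hm : Measurable s₀ := h.measurable_s₀.mono (h.le 0) le_rfl
  have hH : Measurable fun s => ENNReal.ofReal (a + s) * k (t - s) := by fun_prop
  rw [← lintegral_map (f := fun s => ENNReal.ofReal (a + s) * k (t - s)) hH hm, hu.map_s₀,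
    lintegral_expMeasure hH]
  refine setLIntegral_congr_fun measurableSet_Ioi fun s hs => ?_
  have hs' : (0 : ℝ) < s := hs
  rw [ENNReal.ofReal_mul (p := a + s) (by linarith)]
  ring

theorem initial_age_density_le (hr : 0 < r) {a : ℝ} (ha : 0 ≤ a) (s : ℝ) (hs : 0 < s) :
    (a + s) * (r * Real.exp (-(r * s))) ≤ a * r + 1 := by
  have h1 : Real.exp (-(r * s)) ≤ 1 := Real.exp_le_one_iff.2 (by nlinarith)
  have h2 : r * s * Real.exp (-(r * s)) ≤ 1 := by
    have h3 := Real.add_one_le_exp (r * s)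
    rw [Real.exp_neg, ← div_eq_mul_inv, div_le_one (Real.exp_pos _)]
    linarith
  have h3 : a * r * Real.exp (-(r * s)) ≤ a * r * 1 := by gcongr
  nlinarith

theorem tendsto_initial_age_density (hr : 0 < r) (a : ℝ) :
    Tendsto (fun s => (a + s) * (r * Real.exp (-(r * s)))) atTop (𝓝 0) := by
  have h1 : Tendsto (fun s : ℝ => r * s) atTop atTop := tendsto_id.const_mul_atTop hr
  have h2 : Tendsto (fun s : ℝ => Real.exp (-(r * s))) atTop (𝓝 0) :=
    Real.tendsto_exp_neg_atTop_nhds_zero.comp h1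
  have h3 : Tendsto (fun s : ℝ => (r * s) ^ 1 * Real.exp (-(r * s))) atTop (𝓝 0) :=
    (Real.tendsto_pow_mul_exp_neg_atTop_nhds_zero 1).comp h1
  have := (h2.const_mul (a * r)).add h3
  simp only [mul_zero, add_zero] at this
  exact this.congr fun s => by ring

theorem renewalSum_one_le (hu : HasRenewalDensity c P κ s₀ W r u M) {k : ℝ → ℝ≥0∞}
    (hk : Measurable k) (t : ℝ) :
    c.renewalSum P s₀ W (fun _ _ => 1) k t ≤ ENNReal.ofReal M * ∫⁻ v, k v := by
  rw [hu.renewalSum_eq k hk t]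
  exact lintegral_conv_le hu.le k hk t

theorem tendsto_renewalSum_one (hu : HasRenewalDensity c P κ s₀ W r u M) {k : ℝ → ℝ≥0∞}
    (hk : Measurable k) (hki : ∫⁻ v, k v ≠ ∞) :
    Tendsto (c.renewalSum P s₀ W (fun _ _ => 1) k) atTop
      (𝓝 (ENNReal.ofReal (1 / ∫ w, c.len w ∂κ) * ∫⁻ v, k v)) := by
  have := tendsto_lintegral_conv hu.measurable hu.le hu.tendsto hk hki
  exact this.congr fun t => (hu.renewalSum_eq k hk t).symm

theorem lintegral_ofReal_len (hlen : Integrable c.len κ) :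
    ∫⁻ w, ENNReal.ofReal (c.len w) ∂κ = ENNReal.ofReal (∫ w, c.len w ∂κ) :=
  (ofReal_integral_eq_lintegral_ofReal hlen (Eventually.of_forall c.len_nonneg)).symm

theorem lintegral_len_sub_lag_add (hlen : Integrable c.len κ) :
    ∫⁻ w, ENNReal.ofReal (c.len w - c.lag w) ∂κ + ∫⁻ w, ENNReal.ofReal (c.lag w) ∂κ
      = ENNReal.ofReal (∫ w, c.len w ∂κ) := by
  rw [← lintegral_add_right _ c.measurable_lag.ennreal_ofReal, ← c.lintegral_ofReal_len hlen]
  refine lintegral_congr fun w => ?_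
  rw [← ENNReal.ofReal_add (sub_nonneg.2 (c.lag_le_len w)) (c.lag_nonneg w), sub_add_cancel]

/-- The bound is uniform in t and proportional to the mass of k, which provides the dominating
geometric series when the renewal equation is iterated. -/
theorem excessSource_le (h : IsCycleInput P κ ℱ s₀ W)
    (hu : HasRenewalDensity c P κ s₀ W r u M) {a : ℝ} (ha : 0 ≤ a) (hlen : Integrable c.len κ)
    {k : ℝ → ℝ≥0∞} (hk : Measurable k) (t : ℝ) :
    c.excessSource P κ s₀ W a k t
      ≤ (ENNReal.ofReal (a * r + 1) + ENNReal.ofReal M * ENNReal.ofReal (∫ w, c.len w ∂κ))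
        * ∫⁻ v, k v := by
  have hg1 : Measurable fun w => ENNReal.ofReal (c.len w - c.lag w) :=
    (c.measurable_len.sub c.measurable_lag).ennreal_ofReal
  have hg2 : Measurable fun w => ENNReal.ofReal (c.lag w) := c.measurable_lag.ennreal_ofReal
  have hd := c.measurable_delay (κ := κ) (g := fun _ => 1) measurable_const hk
  have e1 := lintegral_conv_le (initial_age_density_le hu.rate_pos ha) k hk t
  rw [← c.lintegral_initial_age h hu ha hk t] at e1
  have e2 := c.renewalSum_one_le hu (c.measurable_delay (κ := κ) hg1 hk) t
  have e3 := c.renewalSum_one_le hu (c.measurable_delay (κ := κ) hg2 hd) t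
  rw [c.lintegral_delay hg1 hk] at e2
  rw [c.lintegral_delay hg2 hd, c.lintegral_delay measurable_const hk] at e3
  simp only [lintegral_const, measure_univ, mul_one, one_mul] at e3
  rw [excessSource]
  refine (add_le_add (add_le_add e1 e2) e3).trans (le_of_eq ?_)
  rw [← c.lintegral_len_sub_lag_add hlen]
  ring

/-- The contribution of the initial age dies out with the exponential density of the first start.
The other two have combined weight E(len - lag) + E lag = E len, which cancels the limiting renewal
density 1 / E len. -/
theorem tendsto_excessSource (h : IsCycleInput P κ ℱ s₀ W)
    (hu : HasRenewalDensity c P κ s₀ W r u M) {a : ℝ} (ha : 0 ≤ a) (hlen : Integrable c.len κ)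
    (hlen0 : 0 < ∫ w, c.len w ∂κ)
    {k : ℝ → ℝ≥0∞} (hk : Measurable k) (hki : ∫⁻ v, k v ≠ ∞) :
    Tendsto (c.excessSource P κ s₀ W a k) atTop (𝓝 (∫⁻ v, k v)) := by
  have hg1 : Measurable fun w => ENNReal.ofReal (c.len w - c.lag w) :=
    (c.measurable_len.sub c.measurable_lag).ennreal_ofReal
  have hg2 : Measurable fun w => ENNReal.ofReal (c.lag w) := c.measurable_lag.ennreal_ofReal
  have hd := c.measurable_delay (κ := κ) (g := fun _ => 1) measurable_const hk
  have hsum := c.lintegral_len_sub_lag_add hlen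
  have hf1 : ∫⁻ w, ENNReal.ofReal (c.len w - c.lag w) ∂κ ≠ ∞ :=
    ne_top_of_le_ne_top ENNReal.ofReal_ne_top (hsum ▸ le_self_add)
  have hf2 : ∫⁻ w, ENNReal.ofReal (c.lag w) ∂κ ≠ ∞ :=
    ne_top_of_le_ne_top ENNReal.ofReal_ne_top (hsum ▸ le_add_self)
  have i2 : ∫⁻ v, c.delay κ (fun w => ENNReal.ofReal (c.len w - c.lag w)) k v
      = (∫⁻ w, ENNReal.ofReal (c.len w - c.lag w) ∂κ) * ∫⁻ v, k v := c.lintegral_delay hg1 hk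
  have i3 : ∫⁻ v, c.delay κ (fun w => ENNReal.ofReal (c.lag w)) (c.delay κ (fun _ => 1) k) v
      = (∫⁻ w, ENNReal.ofReal (c.lag w) ∂κ) * ∫⁻ v, k v := by
    rw [c.lintegral_delay hg2 hd, c.lintegral_delay measurable_const hk]
    simp
  have e1 := tendsto_lintegral_conv (k := k) (φ := fun s => (a + s) * (r * Real.exp (-(r * s))))
    (by fun_prop) (initial_age_density_le hu.rate_pos ha)
    (tendsto_initial_age_density hu.rate_pos a) hk hki
  have e1' := e1.congr fun t => (c.lintegral_initial_age h hu ha hk t).symm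
  have e2 := c.tendsto_renewalSum_one hu (c.measurable_delay (κ := κ) hg1 hk)
    (by rw [i2]; exact ENNReal.mul_ne_top hf1 hki)
  have e3 := c.tendsto_renewalSum_one hu (c.measurable_delay (κ := κ) hg2 hd)
    (by rw [i3]; exact ENNReal.mul_ne_top hf2 hki)
  have := (e1'.add e2).add e3
  rw [i2, i3] at this
  suffices hval : ∫⁻ v, k v = ENNReal.ofReal 0 * (∫⁻ v, k v)
      + ENNReal.ofReal (1 / ∫ w, c.len w ∂κ)
        * ((∫⁻ w, ENNReal.ofReal (c.len w - c.lag w) ∂κ) * ∫⁻ v, k v)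
      + ENNReal.ofReal (1 / ∫ w, c.len w ∂κ)
        * ((∫⁻ w, ENNReal.ofReal (c.lag w) ∂κ) * ∫⁻ v, k v) by
    have h0 := this
    rw [← hval] at h0
    exact h0
  rw [ENNReal.ofReal_zero, zero_mul, zero_add, ← mul_assoc, ← mul_assoc, ← add_mul, ← mul_add,
    hsum, ← ENNReal.ofReal_mul (by positivity), one_div, inv_mul_cancel₀ hlen0.ne',
    ENNReal.ofReal_one, one_mul]

/-- The kernel vanishes at negative times, so only cycles started by t matter, and their excess is
at most a + t. The growth in t is harmless: the bound is used for fixed t, with kernels whose mass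
tends to 0. -/
theorem renewalSum_excess_le (hu : HasRenewalDensity c P κ s₀ W r u M) {a : ℝ} (ha : 0 ≤ a)
    (hs₀ : ∀ ω, 0 ≤ s₀ ω) {k : ℝ → ℝ≥0∞} (hk : Measurable k) (hk0 : ∀ v < 0, k v = 0) (t : ℝ) :
    c.renewalSum P s₀ W (fun m ω => c.excess a (s₀ ω) (fun n => W n ω) m) k t
      ≤ ENNReal.ofReal (a + t) * (ENNReal.ofReal M * ∫⁻ v, k v) := by
  calc _ ≤ ∑' m, ∫⁻ ω, ENNReal.ofReal (a + t) *
          (ENNReal.ofReal 1 * k (t - c.start (s₀ ω) (fun n => W n ω) m)) ∂P := by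
        refine ENNReal.tsum_le_tsum fun m => lintegral_mono fun ω => ?_
        rcases lt_or_ge t (c.start (s₀ ω) (fun n => W n ω) m) with hlt | hge
        · simp [hk0 _ (sub_neg.2 hlt)]
        · rw [ENNReal.ofReal_one, one_mul]
          gcongr
          have h1 := c.excess_add_lagAt_le ha (hs₀ ω) (fun n => W n ω) m
          have h2 := c.lagAt_nonneg (fun n => W n ω) m
          linarith
    _ = ENNReal.ofReal (a + t) * c.renewalSum P s₀ W (fun _ _ => 1) k t := by
        rw [renewalSum, ← ENNReal.tsum_mul_left]
        refine tsum_congr fun m => ?_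
        rw [lintegral_const_mul' _ _ ENNReal.ofReal_ne_top]
    _ ≤ _ := by gcongr; exact c.renewalSum_one_le hu hk t

/-- Unrolling the renewal equation gives a series of sources with kernels `T^[j] k` of mass q^j ∫ k,
where q = P(miss) < 1. Each source tends to the mass of its kernel, and the geometric series sums to
1 / P(hit). -/
theorem tendsto_renewalSum_excess (h : IsCycleInput P κ ℱ s₀ W)
    (hu : HasRenewalDensity c P κ s₀ W r u M) {a : ℝ} (ha : 0 ≤ a) (hs₀ : ∀ ω, 0 ≤ s₀ ω)
    (hlen : Integrable c.len κ) (hlen0 : 0 < ∫ w, c.len w ∂κ) (hp : κ c.hit ≠ 0)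
    {k : ℝ → ℝ≥0∞} (hk : Measurable k) (hk0 : ∀ v < 0, k v = 0) (hki : ∫⁻ v, k v ≠ ∞) :
    Tendsto (c.renewalSum P s₀ W (fun m ω => c.excess a (s₀ ω) (fun n => W n ω) m) k) atTop
      (𝓝 ((κ c.hit)⁻¹ * ∫⁻ v, k v)) := by
  set g : 𝒲 → ℝ≥0∞ := c.hitᶜ.indicator fun _ => 1 with hg
  have hgm : Measurable g := measurable_const.indicator c.measurableSet_hit.compl
  set q := κ c.hitᶜ with hq
  have hgq : ∫⁻ w, g w ∂κ = q := by
    rw [hg, lintegral_indicator_const c.measurableSet_hit.compl, one_mul]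
  have hq1 : q < 1 := by
    rw [hq, prob_compl_eq_one_sub c.measurableSet_hit]
    exact ENNReal.sub_lt_self ENNReal.one_ne_top one_ne_zero hp
  set T : (ℝ → ℝ≥0∞) → ℝ → ℝ≥0∞ := c.delay κ g with hT
  have hTm : ∀ n, Measurable (T^[n] k) := fun n => by
    induction n with
    | zero => exact hk
    | succ n ih => rw [Function.iterate_succ_apply']; exact c.measurable_delay hgm ih
  have hT0 : ∀ n, ∀ v < 0, T^[n] k v = 0 := fun n => by
    induction n with
    | zero => exact hk0
    | succ n ih =>
      intro v hv
      rw [Function.iterate_succ_apply']; exact c.delay_of_neg ih hv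
  have hTi : ∀ n, ∫⁻ v, T^[n] k v = q ^ n * ∫⁻ v, k v := fun n => by
    induction n with
    | zero => simp
    | succ n ih =>
      rw [Function.iterate_succ_apply', hT, c.lintegral_delay hgm (hTm n), hgq, ih, pow_succ]
      ring
  have hfin : ∀ n, ∫⁻ v, T^[n] k v ≠ ∞ := fun n => by
    rw [hTi n]
    exact ENNReal.mul_ne_top (ENNReal.pow_ne_top (hq1.trans ENNReal.one_lt_top).ne) hki
  set A := c.renewalSum P s₀ W (fun m ω => c.excess a (s₀ ω) (fun n => W n ω) m) with hA
  set z := c.excessSource P κ s₀ W a with hz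
  have hiter : ∀ t n, A k t = ∑ j ∈ Finset.range n, z (T^[j] k) t + A (T^[n] k) t := by
    intro t n
    induction n with
    | zero => simp
    | succ n ih =>
      rw [ih, Finset.sum_range_succ, add_assoc, Function.iterate_succ_apply']
      congr 1
      exact c.renewalSum_excess h ha hs₀ (hTm n) t
  have hqn : Tendsto (fun n : ℕ => q ^ n) atTop (𝓝 0) :=
    ENNReal.tendsto_pow_atTop_nhds_zero_of_lt_one hq1
  have hrem : ∀ t, Tendsto (fun n => A (T^[n] k) t) atTop (𝓝 0) := by
    intro t
    have hC : ENNReal.ofReal (a + t) * (ENNReal.ofReal M * ∫⁻ v, k v) ≠ ∞ :=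
      ENNReal.mul_ne_top ENNReal.ofReal_ne_top (ENNReal.mul_ne_top ENNReal.ofReal_ne_top hki)
    have h1 := ENNReal.Tendsto.mul_const hqn (Or.inr hC)
    rw [zero_mul] at h1
    refine tendsto_of_tendsto_of_tendsto_of_le_of_le tendsto_const_nhds h1 (fun n => zero_le) ?_
    intro n
    refine (c.renewalSum_excess_le hu ha hs₀ (hTm n) (hT0 n) t).trans (le_of_eq ?_)
    rw [hTi n]; ring
  have hser : ∀ t, A k t = ∑' j, z (T^[j] k) t := by
    intro t
    have h1 : Tendsto (fun n => ∑ j ∈ Finset.range n, z (T^[j] k) t + A (T^[n] k) t) atTop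
        (𝓝 (∑' j, z (T^[j] k) t + 0)) := (ENNReal.tendsto_nat_tsum _).add (hrem t)
    rw [add_zero] at h1
    exact tendsto_nhds_unique (tendsto_const_nhds.congr fun n => hiter t n) h1
  set B := ENNReal.ofReal (a * r + 1) + ENNReal.ofReal M * ENNReal.ofReal (∫ w, c.len w ∂κ)
    with hB
  have hgeom : ∑' j : ℕ, q ^ j = (κ c.hit)⁻¹ := by
    rw [ENNReal.tsum_geometric]
    congr 1
    rw [hq, prob_compl_eq_one_sub c.measurableSet_hit,
      ENNReal.sub_sub_cancel ENNReal.one_ne_top prob_le_one]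
  -- Limit and series are exchanged by dominated convergence for the counting measure.
  have hlim : Tendsto (fun t => ∑' j, z (T^[j] k) t) atTop (𝓝 (∑' j, q ^ j * ∫⁻ v, k v)) := by
    simp_rw [← lintegral_count]
    refine tendsto_lintegral_filter_of_dominated_convergence (fun j => B * (q ^ j * ∫⁻ v, k v))
      (Eventually.of_forall fun t => measurable_of_countable _)
      (Eventually.of_forall fun t => Eventually.of_forall fun j => ?_) ?_
      (Eventually.of_forall fun j => ?_)
    · rw [← hTi j]
      exact c.excessSource_le h hu ha hlen (hTm j) t
    · rw [lintegral_count, ENNReal.tsum_mul_left, ENNReal.tsum_mul_right, hgeom]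
      refine ENNReal.mul_ne_top ?_ (ENNReal.mul_ne_top (ENNReal.inv_ne_top.2 hp) hki)
      exact ENNReal.add_ne_top.2 ⟨ENNReal.ofReal_ne_top,
        ENNReal.mul_ne_top ENNReal.ofReal_ne_top ENNReal.ofReal_ne_top⟩
    · rw [← hTi j]
      exact c.tendsto_excessSource h hu ha hlen hlen0 (hTm j) (hfin j)
  rw [ENNReal.tsum_mul_right, hgeom] at hlim
  exact hlim.congr fun t => (hser t).symm

end CycleModel

/-! ### The expected age as a sum of contributions of the cycles. -/

namespace CycleModel

variable {Ω 𝒲 : Type*} [mΩ : MeasurableSpace Ω] [m𝒲 : MeasurableSpace 𝒲] (c : CycleModel 𝒲)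

/-- The pairs of a time `v` since the start of a cycle and a mark of a cycle longer than `v`. -/
def running : Set (ℝ × 𝒲) := {x | 0 ≤ x.1 ∧ x.1 < c.len x.2}

/-- The pairs of a time `v` since the start of a cycle and a mark of a cycle in which a tagged packet
is delivered by time `v`. -/
def delivered : Set (ℝ × 𝒲) := {x | x.2 ∈ c.tag ∧ c.srv x.2 ≤ x.1}

theorem measurableSet_running : MeasurableSet c.running :=
  (measurableSet_le measurable_const measurable_fst).inter
    (measurableSet_lt measurable_fst (c.measurable_len.comp measurable_snd))

theorem measurableSet_delivered : MeasurableSet c.delivered :=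
  (measurable_snd c.measurableSet_tag).inter
    (measurableSet_le (c.measurable_srv.comp measurable_snd) measurable_fst)

/-- The contribution of cycle `m` to the age at time `t`. -/
noncomputable def ageTerm (a s₀ : ℝ) (w : ℕ → 𝒲) (t : ℝ) (m : ℕ) : ℝ≥0∞ :=
  ENNReal.ofReal 1 * c.running.indicator (fun x => ENNReal.ofReal x.1)
      (t - c.start s₀ w m, w m)
    + ENNReal.ofReal (c.lagAt w m) * c.running.indicator (fun _ => 1) (t - c.start s₀ w m, w m)
    + ENNReal.ofReal (c.excess a s₀ w m)
      * (c.running \ c.delivered).indicator (fun _ => 1) (t - c.start s₀ w m, w m)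

/-- After the first start exactly one cycle is running at time t, so the series has one nonzero
term; before it all terms vanish and the indicator of `Set.Ioi t` supplies the age. All terms are
nonnegative, which permits exchanging sum and expectation freely. -/
theorem IsAgePath.ofReal_eq {a s₀ : ℝ} {w : ℕ → 𝒲} {f : ℝ → ℝ} (hf : c.IsAgePath a s₀ w f)
    (ha : 0 ≤ a) (hs₀ : 0 ≤ s₀) (h : Tendsto (c.start s₀ w) atTop atTop) {t : ℝ} (ht : 0 ≤ t) :
    ENNReal.ofReal (f t) = (Set.Ioi t).indicator (fun _ => ENNReal.ofReal (a + t)) s₀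
      + ∑' m, c.ageTerm a s₀ w t m := by
  have hout : ∀ m, (t - c.start s₀ w m, w m) ∉ c.running → c.ageTerm a s₀ w t m = 0 := by
    intro m hm
    have hm' : (t - c.start s₀ w m, w m) ∉ c.running \ c.delivered := fun h => hm h.1
    simp [ageTerm, hm, hm']
  rcases lt_or_ge t s₀ with h1 | h1
  · rw [hf.1 t ht h1, Set.indicator_of_mem (Set.mem_Ioi.2 h1)]
    have : ∀ m, c.ageTerm a s₀ w t m = 0 := by
      intro m
      refine hout m fun hm => ?_
      have h2 := c.start_mono s₀ w (Nat.zero_le m)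
      have h3 : 0 ≤ t - c.start s₀ w m := hm.1
      simp only [start] at h2
      linarith
    simp [this]
  · rw [Set.indicator_of_notMem (by simpa using h1), zero_add]
    obtain ⟨m, hm1, hm2⟩ := c.exists_cycle h h1
    rw [tsum_eq_single m]
    · have hrun : (t - c.start s₀ w m, w m) ∈ c.running := by
        rw [start] at hm2
        exact ⟨sub_nonneg.2 hm1, by simp only; linarith⟩
      have h2 := c.lagAt_nonneg w m
      have h3 := c.excess_nonneg ha hs₀ w m
      rw [hf.2 m t hm1 hm2, ageTerm, Set.indicator_of_mem hrun, Set.indicator_of_mem hrun]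
      have h4 : 0 ≤ {v | v ∈ c.tag ∧ c.srv v ≤ t - c.start s₀ w m}ᶜ.indicator
          (fun _ => c.excess a s₀ w m) (w m) := Set.indicator_nonneg (fun _ _ => h3) _
      rw [ENNReal.ofReal_add (add_nonneg (sub_nonneg.2 hm1) h2) h4,
        ENNReal.ofReal_add (sub_nonneg.2 hm1) h2]
      by_cases hd : (t - c.start s₀ w m, w m) ∈ c.delivered
      · have hd' : w m ∉ {v | v ∈ c.tag ∧ c.srv v ≤ t - c.start s₀ w m}ᶜ := fun h => h hd
        rw [Set.indicator_of_notMem hd', Set.indicator_of_notMem (fun h => h.2 hd)]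
        simp
      · have hd' : w m ∈ {v | v ∈ c.tag ∧ c.srv v ≤ t - c.start s₀ w m}ᶜ := hd
        rw [Set.indicator_of_mem hd', Set.indicator_of_mem (Set.mem_sdiff_of_mem hrun hd)]
        simp
    · intro m' hm'
      refine hout m' fun hr => ?_
      have e1 : 0 ≤ t - c.start s₀ w m' := hr.1
      have e2 : t - c.start s₀ w m' < c.len (w m') := hr.2
      have e3 : t < c.start s₀ w (m' + 1) := by rw [start]; linarith
      rcases lt_or_gt_of_ne hm' with hlt | hlt
      · have := c.start_mono s₀ w (show m' + 1 ≤ m by omega)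
        linarith
      · have := c.start_mono s₀ w (show m + 1 ≤ m' by omega)
        linarith

variable {P : Measure Ω} [IsProbabilityMeasure P] {κ : Measure 𝒲} [IsProbabilityMeasure κ]
    {ℱ : ℕ → MeasurableSpace Ω} {s₀ : Ω → ℝ} {W : ℕ → Ω → 𝒲} {r M : ℝ} {u : ℝ → ℝ}

/-- Integration of a function of the time since the start of a cycle and of the mark. -/
noncomputable def averaged (κ : Measure 𝒲) (H : ℝ × 𝒲 → ℝ≥0∞) (v : ℝ) : ℝ≥0∞ :=
  ∫⁻ w, H (v, w) ∂κ

theorem measurable_averaged {H : ℝ × 𝒲 → ℝ≥0∞} (hH : Measurable H) :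
    Measurable (averaged κ H) := hH.lintegral_prod_right'

theorem lintegral_averaged {H : ℝ × 𝒲 → ℝ≥0∞} (hH : Measurable H) :
    ∫⁻ v, averaged κ H v = ∫⁻ w, (∫⁻ v, H (v, w)) ∂κ :=
  lintegral_lintegral_swap (f := fun v w => H (v, w)) hH.aemeasurable

theorem renewalSum_averaged (h : IsCycleInput P κ ℱ s₀ W) {Z : ℕ → Ω → ℝ}
    (hZ : ∀ m, Measurable[ℱ m] (Z m)) {H : ℝ × 𝒲 → ℝ≥0∞} (hH : Measurable H) (t : ℝ) :
    ∑' m, ∫⁻ ω, ENNReal.ofReal (Z m ω) * H (t - c.start (s₀ ω) (fun n => W n ω) m, W m ω) ∂P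
      = c.renewalSum P s₀ W Z (averaged κ H) t :=
  tsum_congr fun m => c.lintegral_past_kernel h m (hZ m) (H := fun v w => H (v, w)) hH t

theorem averaged_indicator_of_neg {A : Set (ℝ × 𝒲)} (hA : A ⊆ c.running) (g : ℝ × 𝒲 → ℝ≥0∞) :
    ∀ v < 0, averaged κ (A.indicator g) v = 0 := by
  intro v hv
  rw [averaged]
  have : ∀ w, A.indicator g (v, w) = 0 := fun w =>
    Set.indicator_of_notMem (fun h => absurd (hA h).1 (not_le.2 hv)) _
  simp [this]

theorem lintegral_running_one (w : 𝒲) :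
    ∫⁻ v, c.running.indicator (fun _ => (1 : ℝ≥0∞)) (v, w) = ENNReal.ofReal (c.len w) := by
  have : (fun v => c.running.indicator (fun _ => (1 : ℝ≥0∞)) (v, w))
      = (Set.Ico 0 (c.len w)).indicator fun _ => 1 := by
    ext v; rfl
  rw [this, lintegral_indicator_const measurableSet_Ico, one_mul, Real.volume_Ico, sub_zero]

theorem lintegral_running_self (w : 𝒲) :
    ∫⁻ v, c.running.indicator (fun x => ENNReal.ofReal x.1) (v, w)
      = ENNReal.ofReal (c.len w ^ 2 / 2) := by
  have h1 : (fun v => c.running.indicator (fun x => ENNReal.ofReal x.1) (v, w))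
      = (Set.Ico 0 (c.len w)).indicator fun v => ENNReal.ofReal v := by
    ext v; rfl
  rw [h1, lintegral_indicator measurableSet_Ico, setLIntegral_congr Ico_ae_eq_Ioc,
    ← ofReal_integral_eq_lintegral_ofReal, ← intervalIntegral.integral_of_le (c.len_nonneg w)]
  · simp
  · exact (intervalIntegrable_iff_integrableOn_Ioc_of_le (c.len_nonneg w)).1
      intervalIntegral.intervalIntegrable_id
  · filter_upwards [ae_restrict_mem measurableSet_Ioc] with v hv using hv.1.le

/-- In a tagged cycle the excess persists for time min(len, srv) = len - (len - srv)⁺, in any other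
cycle for its whole length. -/
theorem lintegral_undelivered (w : 𝒲) :
    ∫⁻ v, (c.running \ c.delivered).indicator (fun _ => (1 : ℝ≥0∞)) (v, w)
      = ENNReal.ofReal (c.len w - c.tag.indicator (fun v => max (c.len v - c.srv v) 0) w) := by
  by_cases hw : w ∈ c.tag
  · have : (fun v => (c.running \ c.delivered).indicator (fun _ => (1 : ℝ≥0∞)) (v, w))
        = (Set.Ico 0 (min (c.len w) (c.srv w))).indicator fun _ => 1 := by
      ext v
      have hiff : (v, w) ∈ c.running \ c.delivered ↔ v ∈ Set.Ico 0 (min (c.len w) (c.srv w)) := by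
        constructor
        · rintro ⟨⟨h1, h2⟩, h3⟩
          refine ⟨h1, lt_min h2 (not_le.1 fun h => h3 ⟨hw, h⟩)⟩
        · rintro ⟨h1, h2⟩
          exact ⟨⟨h1, h2.trans_le (min_le_left _ _)⟩,
            fun h => absurd h.2 (not_le.2 (h2.trans_le (min_le_right _ _)))⟩
      by_cases hv : v ∈ Set.Ico 0 (min (c.len w) (c.srv w))
      · rw [Set.indicator_of_mem hv, Set.indicator_of_mem (hiff.2 hv)]
      · rw [Set.indicator_of_notMem hv, Set.indicator_of_notMem (fun h => hv (hiff.1 h))]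
    rw [this, lintegral_indicator_const measurableSet_Ico, one_mul, Real.volume_Ico, sub_zero,
      Set.indicator_of_mem hw]
    congr 1
    rcases le_total (c.len w) (c.srv w) with h | h
    · rw [min_eq_left h, max_eq_right (by linarith), sub_zero]
    · rw [min_eq_right h, max_eq_left (by linarith)]; ring
  · have : (fun v => (c.running \ c.delivered).indicator (fun _ => (1 : ℝ≥0∞)) (v, w))
        = fun v => c.running.indicator (fun _ => (1 : ℝ≥0∞)) (v, w) := by
      ext v
      have hiff : (v, w) ∈ c.running \ c.delivered ↔ (v, w) ∈ c.running :=
        ⟨fun h => h.1, fun h => ⟨h, fun hd => hw hd.1⟩⟩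
      by_cases hv : (v, w) ∈ c.running
      · rw [Set.indicator_of_mem hv, Set.indicator_of_mem (hiff.2 hv)]
      · rw [Set.indicator_of_notMem hv, Set.indicator_of_notMem (fun h => hv (hiff.1 h))]
    rw [this, lintegral_running_one, Set.indicator_of_notMem hw, sub_zero]

theorem measurable_ageTerm (h : IsCycleInput P κ ℱ s₀ W) (a t : ℝ) (m : ℕ) :
    Measurable fun ω => c.ageTerm a (s₀ ω) (fun n => W n ω) t m := by
  have hs : Measurable fun ω => c.start (s₀ ω) (fun n => W n ω) m :=
    (c.measurable_start h m).mono (h.le m) le_rfl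
  have hl : Measurable fun ω => c.lagAt (fun n => W n ω) m :=
    (c.measurable_lagAt h m).mono (h.le m) le_rfl
  have he : Measurable fun ω => c.excess a (s₀ ω) (fun n => W n ω) m :=
    (c.measurable_excess h a m).mono (h.le m) le_rfl
  have hp : Measurable fun ω => (t - c.start (s₀ ω) (fun n => W n ω) m, W m ω) :=
    (measurable_const.sub hs).prodMk (h.measurable m)
  have hr := c.measurableSet_running
  have hd := hr.diff c.measurableSet_delivered
  have m1 : Measurable (c.running.indicator fun x : ℝ × 𝒲 => ENNReal.ofReal x.1) :=
    measurable_fst.ennreal_ofReal.indicator hr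
  have m2 : Measurable (c.running.indicator fun _ : ℝ × 𝒲 => (1 : ℝ≥0∞)) :=
    measurable_const.indicator hr
  have m3 : Measurable ((c.running \ c.delivered).indicator fun _ : ℝ × 𝒲 => (1 : ℝ≥0∞)) :=
    measurable_const.indicator hd
  exact ((measurable_const.mul (m1.comp hp)).add (hl.ennreal_ofReal.mul (m2.comp hp))).add
    (he.ennreal_ofReal.mul (m3.comp hp))

/-- Existence and limit of the expected age of a cyclic age process. -/
theorem tendsto_mean (h : IsCycleInput P κ ℱ s₀ W)
    (hu : HasRenewalDensity c P κ s₀ W r u M) {a : ℝ} (ha : 0 ≤ a) (hs₀ : ∀ ω, 0 ≤ s₀ ω)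
    (hs₀1 : Integrable s₀ P)
    (hlen2 : MemLp c.len 2 κ) (hlen0 : 0 < ∫ w, c.len w ∂κ) (hp : 0 < κ.real c.hit)
    {D : ℝ → Ω → ℝ}
    (hD : ∀ᵐ ω ∂P, Tendsto (c.start (s₀ ω) (fun n => W n ω)) atTop atTop ∧
      c.IsAgePath a (s₀ ω) (fun n => W n ω) fun t => D t ω) :
    (∀ t : ℝ, 0 ≤ t → Integrable (D t) P) ∧
      Tendsto (fun t : ℝ => ∫ ω, D t ω ∂P) atTop (𝓝 (c.meanAge κ)) := by
  have hlen : Integrable c.len κ := hlen2.integrable one_le_two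
  have hlag : Integrable c.lag κ := (c.memLp_lag hlen2).integrable one_le_two
  have hs₀m : Measurable s₀ := h.measurable_s₀.mono (h.le 0) le_rfl
  set F : ℝ → Ω → ℝ≥0∞ := fun t ω => (Set.Ioi t).indicator (fun _ => ENNReal.ofReal (a + t)) (s₀ ω)
    + ∑' m, c.ageTerm a (s₀ ω) (fun n => W n ω) t m with hF
  have hm0 : ∀ t, Measurable fun ω =>
      (Set.Ioi t).indicator (fun _ : ℝ => ENNReal.ofReal (a + t)) (s₀ ω) := fun t =>
    (measurable_const.indicator measurableSet_Ioi).comp hs₀m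
  have hFm : ∀ t, Measurable (F t) := fun t =>
    (hm0 t).add (Measurable.tsum fun m => c.measurable_ageTerm h a t m)
  have hDF : ∀ t, 0 ≤ t → ∀ᵐ ω ∂P, 0 ≤ D t ω ∧ ENNReal.ofReal (D t ω) = F t ω := by
    intro t ht
    filter_upwards [hD] with ω hω
    exact ⟨hω.2.nonneg c ha (hs₀ ω) hω.1 ht, hω.2.ofReal_eq c ha (hs₀ ω) hω.1 ht⟩
  have hDm : ∀ t, 0 ≤ t → AEStronglyMeasurable (D t) P := by
    intro t ht
    refine AEMeasurable.aestronglyMeasurable ⟨fun ω => (F t ω).toReal, (hFm t).ennreal_toReal, ?_⟩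
    filter_upwards [hDF t ht] with ω hω
    rw [← hω.2, ENNReal.toReal_ofReal hω.1]
  -- the three kernels
  have hr := c.measurableSet_running
  have hd := hr.diff c.measurableSet_delivered
  have m1 : Measurable (c.running.indicator fun x : ℝ × 𝒲 => ENNReal.ofReal x.1) :=
    measurable_fst.ennreal_ofReal.indicator hr
  have m2 : Measurable (c.running.indicator fun _ : ℝ × 𝒲 => (1 : ℝ≥0∞)) :=
    measurable_const.indicator hr
  have m3 : Measurable ((c.running \ c.delivered).indicator fun _ : ℝ × 𝒲 => (1 : ℝ≥0∞)) :=
    measurable_const.indicator hd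
  set k₁ := averaged κ (c.running.indicator fun x : ℝ × 𝒲 => ENNReal.ofReal x.1) with hk₁
  set k₂ := averaged κ (c.running.indicator fun _ : ℝ × 𝒲 => (1 : ℝ≥0∞)) with hk₂
  set k₃ := averaged κ ((c.running \ c.delivered).indicator fun _ : ℝ × 𝒲 => (1 : ℝ≥0∞)) with hk₃
  have mk₁ : Measurable k₁ := measurable_averaged m1
  have mk₂ : Measurable k₂ := measurable_averaged m2
  have mk₃ : Measurable k₃ := measurable_averaged m3
  set c₁ := ∫ w, c.len w ∂κ with hc₁
  set c₂ := ∫ w, c.len w ^ 2 ∂κ with hc₂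
  set e := ∫ w, c.lag w ∂κ with he
  set g := c.tag.indicator (fun v => max (c.len v - c.srv v) 0) with hg
  set e₂ := ∫ w, g w ∂κ with he₂
  have hgm : Measurable g :=
    ((c.measurable_len.sub c.measurable_srv).max measurable_const).indicator c.measurableSet_tag
  have hgle : ∀ w, 0 ≤ g w ∧ g w ≤ c.len w := by
    intro w
    by_cases hw : w ∈ c.tag
    · simp only [hg, Set.indicator_of_mem hw]
      exact ⟨le_max_right _ _, max_le (by linarith [c.srv_nonneg w]) (c.len_nonneg w)⟩
    · simp only [hg, Set.indicator_of_notMem hw]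
      exact ⟨le_rfl, c.len_nonneg w⟩
  have hgi : Integrable g κ := hlen.mono' hgm.aestronglyMeasurable
    (Eventually.of_forall fun w => by rw [Real.norm_of_nonneg (hgle w).1]; exact (hgle w).2)
  have i₁ : ∫⁻ v, k₁ v = ENNReal.ofReal (c₂ / 2) := by
    rw [hk₁, lintegral_averaged m1]
    simp_rw [c.lintegral_running_self]
    rw [← ofReal_integral_eq_lintegral_ofReal (hlen2.integrable_sq.div_const 2)
      (Eventually.of_forall fun w => by positivity), integral_div]
  have i₂ : ∫⁻ v, k₂ v = ENNReal.ofReal c₁ := by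
    rw [hk₂, lintegral_averaged m2]
    simp_rw [c.lintegral_running_one]
    exact c.lintegral_ofReal_len hlen
  have i₃ : ∫⁻ v, k₃ v = ENNReal.ofReal (c₁ - e₂) := by
    rw [hk₃, lintegral_averaged m3]
    simp_rw [c.lintegral_undelivered]
    have hsub : Integrable (fun w => c.len w - g w) κ := hlen.sub hgi
    change ∫⁻ w, ENNReal.ofReal (c.len w - g w) ∂κ = _
    rw [← ofReal_integral_eq_lintegral_ofReal hsub
      (Eventually.of_forall fun w => sub_nonneg.2 (hgle w).2), integral_sub hlen hgi]
  have hone : ∀ m, Measurable[ℱ m] (fun _ : Ω => (1 : ℝ)) := fun m => measurable_const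
  -- The expected age splits into the part before the first start and three renewal sums: time since
  -- the start of the cycle, lag of its packet, and excess not yet removed.
  have hFint : ∀ t, ∫⁻ ω, F t ω ∂P
      = ∫⁻ ω, (Set.Ioi t).indicator (fun _ => ENNReal.ofReal (a + t)) (s₀ ω) ∂P
        + (c.renewalSum P s₀ W (fun _ _ => 1) k₁ t
          + c.renewalSum P s₀ W (fun m ω => c.lagAt (fun n => W n ω) m) k₂ t
          + c.renewalSum P s₀ W (fun m ω => c.excess a (s₀ ω) (fun n => W n ω) m) k₃ t) := by
    intro t
    rw [hF, lintegral_add_left (hm0 t),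
      lintegral_tsum fun m => (c.measurable_ageTerm h a t m).aemeasurable]
    congr 1
    rw [hk₁, hk₂, hk₃, ← c.renewalSum_averaged h hone m1,
      ← c.renewalSum_averaged h (fun m => c.measurable_lagAt h m) m2,
      ← c.renewalSum_averaged h (fun m => c.measurable_excess h a m) m3,
      ← ENNReal.tsum_add, ← ENNReal.tsum_add]
    refine tsum_congr fun m => ?_
    have hsm : Measurable fun ω => c.start (s₀ ω) (fun n => W n ω) m :=
      (c.measurable_start h m).mono (h.le m) le_rfl
    have hlm : Measurable fun ω => c.lagAt (fun n => W n ω) m :=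
      (c.measurable_lagAt h m).mono (h.le m) le_rfl
    have hpm : Measurable fun ω => (t - c.start (s₀ ω) (fun n => W n ω) m, W m ω) :=
      (measurable_const.sub hsm).prodMk (h.measurable m)
    simp only [ageTerm]
    rw [lintegral_add_left, lintegral_add_left]
    · exact measurable_const.mul (m1.comp hpm)
    · exact (measurable_const.mul (m1.comp hpm)).add (hlm.ennreal_ofReal.mul (m2.comp hpm))
  -- the limits
  have hp' : κ c.hit ≠ 0 := fun h0 => by simp [Measure.real, h0] at hp
  have l0 : Tendsto (fun t : ℝ =>
      ∫⁻ ω, (Set.Ioi t).indicator (fun _ => ENNReal.ofReal (a + t)) (s₀ ω) ∂P) atTop (𝓝 0) := by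
    have hz : ∫⁻ _ : Ω, (0 : ℝ≥0∞) ∂P = 0 := lintegral_zero
    rw [← hz]
    refine tendsto_lintegral_filter_of_dominated_convergence
      (fun ω => ENNReal.ofReal (a + s₀ ω)) (Eventually.of_forall fun t => hm0 t)
      (Eventually.of_forall fun t => Eventually.of_forall fun ω => ?_) ?_
      (Eventually.of_forall fun ω => ?_)
    · by_cases hω : s₀ ω ∈ Set.Ioi t
      · rw [Set.indicator_of_mem hω]
        exact ENNReal.ofReal_le_ofReal (by linarith [Set.mem_Ioi.1 hω])
      · rw [Set.indicator_of_notMem hω]; exact zero_le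
    · have : Integrable (fun ω => a + s₀ ω) P := (integrable_const a).add hs₀1
      exact this.lintegral_lt_top.ne
    · refine tendsto_const_nhds.congr' ?_
      filter_upwards [eventually_ge_atTop (s₀ ω)] with t ht
      rw [Set.indicator_of_notMem (by simpa using ht)]
  have l1 := c.tendsto_renewalSum_one hu mk₁ (by rw [i₁]; exact ENNReal.ofReal_ne_top)
  have hmlag : Measurable fun w => ENNReal.ofReal (c.lag w) := c.measurable_lag.ennreal_ofReal
  have ilag : ∫⁻ w, ENNReal.ofReal (c.lag w) ∂κ = ENNReal.ofReal e :=
    (ofReal_integral_eq_lintegral_ofReal hlag (Eventually.of_forall c.lag_nonneg)).symm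
  have i₂' : ∫⁻ v, c.delay κ (fun w => ENNReal.ofReal (c.lag w)) k₂ v
      = ENNReal.ofReal e * ENNReal.ofReal c₁ := by
    rw [c.lintegral_delay hmlag mk₂, ilag, i₂]
  have l2 := c.tendsto_renewalSum_one hu (c.measurable_delay (κ := κ) hmlag mk₂)
    (by rw [i₂']; exact ENNReal.mul_ne_top ENNReal.ofReal_ne_top ENNReal.ofReal_ne_top)
  have l2' := l2.congr fun t => (c.renewalSum_lagAt h mk₂ t).symm
  have l3 := c.tendsto_renewalSum_excess h hu ha hs₀ hlen hlen0 hp' mk₃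
    (c.averaged_indicator_of_neg Set.sdiff_subset _) (by rw [i₃]; exact ENNReal.ofReal_ne_top)
  rw [i₁] at l1
  rw [i₂'] at l2'
  rw [i₃] at l3
  have lsum := l0.add ((l1.add l2').add l3)
  have lF := lsum.congr fun t => (hFint t).symm
  have hc₂0 : 0 ≤ c₂ := integral_nonneg fun w => sq_nonneg _
  have he0 : 0 ≤ e := integral_nonneg c.lag_nonneg
  have hce : 0 ≤ c₁ - e₂ := by
    rw [sub_nonneg]
    exact integral_mono hgi hlen fun w => (hgle w).2
  have hhit : (κ c.hit)⁻¹ = ENNReal.ofReal ((κ.real c.hit)⁻¹) := by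
    rw [ENNReal.ofReal_inv_of_pos hp, ofReal_measureReal]
  have hval : 0 + (ENNReal.ofReal (1 / c₁) * ENNReal.ofReal (c₂ / 2)
      + ENNReal.ofReal (1 / c₁) * (ENNReal.ofReal e * ENNReal.ofReal c₁)
      + (κ c.hit)⁻¹ * ENNReal.ofReal (c₁ - e₂)) = ENNReal.ofReal (c.meanAge κ) := by
    rw [zero_add, hhit, ← ENNReal.ofReal_mul he0, ← ENNReal.ofReal_mul (by positivity),
      ← ENNReal.ofReal_mul (by positivity), ← ENNReal.ofReal_mul (by positivity),
      ← ENNReal.ofReal_add (by positivity) (by positivity),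
      ← ENNReal.ofReal_add (by positivity) (by positivity)]
    congr 1
    rw [meanAge, ← hg, ← he₂, ← hc₁, ← hc₂, ← he]
    field_simp
    ring
  rw [hval] at lF
  have hmean0 : 0 ≤ c.meanAge κ := by
    have : c.meanAge κ = 1 / c₁ * (c₂ / 2) + 1 / c₁ * (e * c₁) + (κ.real c.hit)⁻¹ * (c₁ - e₂) := by
      rw [meanAge, ← hg, ← he₂, ← hc₁, ← hc₂, ← he]
      field_simp
      ring
    rw [this]
    positivity
  -- The age never exceeds the initial age plus the elapsed time, so integrability at fixed t is
  -- immediate.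
  have hbound : ∀ t, 0 ≤ t → ∀ᵐ ω ∂P, ‖D t ω‖ ≤ a + t := by
    intro t ht
    filter_upwards [hD] with ω hω
    rw [Real.norm_of_nonneg (hω.2.nonneg c ha (hs₀ ω) hω.1 ht)]
    rcases lt_or_ge t (s₀ ω) with h1 | h1
    · exact (hω.2.1 t ht h1).le
    · obtain ⟨m, hm1, hm2⟩ := c.exists_cycle hω.1 h1
      have e0 := hω.2.2 m t hm1 hm2
      have e1 := c.excess_add_lagAt_le ha (hs₀ ω) (fun n => W n ω) m
      have e3 : {v | v ∈ c.tag ∧ c.srv v ≤ t - c.start (s₀ ω) (fun n => W n ω) m}ᶜ.indicator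
          (fun _ => c.excess a (s₀ ω) (fun n => W n ω) m) (W m ω)
          ≤ c.excess a (s₀ ω) (fun n => W n ω) m :=
        Set.indicator_le_self' (fun _ _ => c.excess_nonneg ha (hs₀ ω) _ m) _
      simp only at e0
      linarith
  refine ⟨fun t ht => Integrable.of_bound (hDm t ht) (a + t) (hbound t ht), ?_⟩
  have lR := (ENNReal.tendsto_toReal ENNReal.ofReal_ne_top).comp lF
  rw [ENNReal.toReal_ofReal hmean0] at lR
  refine lR.congr' ?_
  filter_upwards [eventually_ge_atTop 0] with t ht
  rw [integral_eq_lintegral_of_nonneg_ae ((hDF t ht).mono fun ω hω => hω.1) (hDm t ht)]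
  simp only [Function.comp]
  congr 1
  exact lintegral_congr_ae ((hDF t ht).mono fun ω hω => hω.2.symm)

/-- The average age of a cyclic age process. -/
theorem hasAverageAge (h : IsCycleInput P κ ℱ s₀ W)
    (hu : HasRenewalDensity c P κ s₀ W r u M) {a : ℝ} (ha : 0 ≤ a) (hs₀ : ∀ ω, 0 ≤ s₀ ω)
    (hs₀2 : MemLp s₀ 2 P) (hlen : MemLp (fun w => c.len w ^ 2) 2 κ)
    (hlen0 : 0 < ∫ w, c.len w ∂κ) (hp : 0 < κ.real c.hit) {D : ℝ → Ω → ℝ}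
    (hD : ∀ᵐ ω ∂P, c.IsAgePath a (s₀ ω) (fun n => W n ω) fun t => D t ω) :
    HasAverageAge P D (c.meanAge κ) := by
  have hta := c.ae_time_average h ha hs₀ hs₀2 hlen hlen0 hp
  have hmean := c.tendsto_mean h hu ha hs₀ (hs₀2.integrable one_le_two) (c.memLp_len hlen) hlen0 hp
    (D := D) (by filter_upwards [hta, hD] with ω h1 h2 using ⟨h1.1, h2⟩)
  exact {
    intervalIntegrable := by
      filter_upwards [hta, hD] with ω h1 h2 using (h1.2 _ h2).1
    time_average := by
      filter_upwards [hta, hD] with ω h1 h2 using (h1.2 _ h2).2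
    integrable := hmean.1
    mean_limit := hmean.2 }

end CycleModel

/-! ### Renewal densities -/

/-- The solution of `y' = - r y` decays exponentially. -/
theorem eq_mul_exp_of_eq_sub_integral {y : ℝ → ℝ} {r : ℝ}
    (hi : ∀ t, 0 ≤ t → IntervalIntegrable y volume 0 t)
    (h : ∀ t, 0 ≤ t → y t = y 0 - r * ∫ τ in (0 : ℝ)..t, y τ) {t : ℝ} (ht : 0 ≤ t) :
    y t = y 0 * Real.exp (-(r * t)) := by
  have hcont : ContinuousOn y (Set.Icc 0 t) := by
    have h1 : ContinuousOn (fun x => ∫ τ in (0 : ℝ)..x, y τ) (Set.Icc 0 t) := by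
      have := intervalIntegral.continuousOn_primitive_interval' (hi t ht) (a := 0)
        (by rw [Set.uIcc_of_le ht]; exact ⟨le_rfl, ht⟩)
      rwa [Set.uIcc_of_le ht] at this
    refine (continuousOn_const.sub (continuousOn_const.mul h1)).congr fun x hx => h x hx.1
  -- The integrating factor has zero derivative. Only right derivatives are used, since the integral
  -- equation is known on the half-line alone; continuity of y comes from that equation.
  have hconst : ∀ x ∈ Set.Icc 0 t, Real.exp (r * x) * y x = Real.exp (r * 0) * y 0 := by
    refine constant_of_has_deriv_right_zero
      ((Real.continuous_exp.comp (continuous_const.mul continuous_id)).continuousOn.mul hcont) ?_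
    intro x hx
    have hwithin : ContinuousWithinAt y (Set.Ici x) x := by
      have := hcont x ⟨hx.1, hx.2.le⟩
      refine (this.mono (s := Set.Icc x t) (Set.Icc_subset_Icc_left hx.1)).mono_of_mem_nhdsWithin ?_
      exact Icc_mem_nhdsGE hx.2
    have hmeas : StronglyMeasurableAtFilter y (𝓝[Set.Ioi x] x) volume := by
      refine ⟨Set.Ioc x t, Ioc_mem_nhdsGT hx.2, ?_⟩
      exact ((hi t ht).1.mono_set (Set.Ioc_subset_Ioc_left hx.1)).aestronglyMeasurable
    have hd : HasDerivWithinAt (fun u => ∫ τ in (0 : ℝ)..u, y τ) (y x) (Set.Ici x) x :=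
      intervalIntegral.integral_hasDerivWithinAt_right (hi x hx.1) hmeas
        (hwithin.mono Set.Ioi_subset_Ici_self)
    have hdy : HasDerivWithinAt y (-(r * y x)) (Set.Ici x) x := by
      have := (hd.const_mul r).const_sub (y 0)
      refine this.congr (fun u hu => h u (hx.1.trans hu)) (h x hx.1)
    have hde : HasDerivWithinAt (fun u => Real.exp (r * u)) (Real.exp (r * x) * r) (Set.Ici x) x := by
      have := ((hasDerivAt_id x).const_mul r).exp.hasDerivWithinAt (s := Set.Ici x)
      simpa using this
    exact (hde.mul hdy).congr_deriv (by ring)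
  have h1 := hconst t ⟨ht, le_rfl⟩
  rw [mul_zero, Real.exp_zero, one_mul] at h1
  rw [← h1, Real.exp_neg]
  field_simp

theorem tendsto_zero_of_eq_sub_integral {y : ℝ → ℝ} {r : ℝ} (hr : 0 < r)
    (hi : ∀ t, 0 ≤ t → IntervalIntegrable y volume 0 t)
    (h : ∀ t, 0 ≤ t → y t = y 0 - r * ∫ τ in (0 : ℝ)..t, y τ) : Tendsto y atTop (𝓝 0) := by
  have h1 : Tendsto (fun t : ℝ => r * t) atTop atTop := tendsto_id.const_mul_atTop hr
  have h2 : Tendsto (fun t : ℝ => y 0 * Real.exp (-(r * t))) atTop (𝓝 (y 0 * 0)) :=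
    (Real.tendsto_exp_neg_atTop_nhds_zero.comp h1).const_mul _
  rw [mul_zero] at h2
  refine h2.congr' ?_
  filter_upwards [eventually_ge_atTop 0] with t ht
  exact (eq_mul_exp_of_eq_sub_integral hi h ht).symm

/-! ### Convolutions of a measure with exponential functions. -/

section expConv

variable {U : Measure ℝ}

/-- The convolution of `U` with an exponential function. -/
noncomputable def expConvL (U : Measure ℝ) (r t : ℝ) : ℝ≥0∞ :=
  ∫⁻ s in Set.Iic t, ENNReal.ofReal (Real.exp (-(r * (t - s)))) ∂U

noncomputable def expConv (U : Measure ℝ) (r t : ℝ) : ℝ := (expConvL U r t).toReal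

theorem expConvL_eq (r t : ℝ) :
    expConvL U r t = ∫⁻ s, {x : ℝ × ℝ | x.2 ≤ x.1}.indicator
      (fun x => ENNReal.ofReal (Real.exp (-(r * (x.1 - x.2))))) (t, s) ∂U := by
  rw [expConvL, ← lintegral_indicator measurableSet_Iic]
  rfl

theorem measurable_expConv_integrand (r : ℝ) :
    Measurable ({x : ℝ × ℝ | x.2 ≤ x.1}.indicator
      (fun x => ENNReal.ofReal (Real.exp (-(r * (x.1 - x.2)))))) := by
  refine Measurable.indicator ?_ (measurableSet_le measurable_snd measurable_fst)
  fun_prop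

theorem measurable_expConvL [SFinite U] (r : ℝ) : Measurable (expConvL U r) := by
  rw [show expConvL U r = _ from funext (expConvL_eq (U := U) r)]
  exact (measurable_expConv_integrand r).lintegral_prod_right'

/-- The convolution y satisfies dy = dU - r y dt, here in integrated form. By Tonelli, a point at s
contributes to r ∫ y the amount 1 - exp(-r (t - s)), which complements its contribution to y t. The
distribution function of U can thus be read off from a single exponential convolution. -/
theorem expConvL_add_integral [SFinite U] (hU0 : U (Set.Iic 0) = 0) {r : ℝ} (hr : 0 < r) (t : ℝ) :
    expConvL U r t + ENNReal.ofReal r * ∫⁻ τ in Set.Ioc 0 t, expConvL U r τ = U (Set.Iic t) := by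
  have hswap : ENNReal.ofReal r * ∫⁻ τ in Set.Ioc 0 t, expConvL U r τ
      = ∫⁻ s in Set.Iic t, ENNReal.ofReal (1 - Real.exp (-(r * (t - s)))) ∂U := by
    rw [← lintegral_const_mul _ (measurable_expConvL r)]
    simp_rw [expConvL_eq]
    have hm : ∀ τ, Measurable fun s => {x : ℝ × ℝ | x.2 ≤ x.1}.indicator
      (fun x => ENNReal.ofReal (Real.exp (-(r * (x.1 - x.2))))) (τ, s) := fun τ =>
      (measurable_expConv_integrand r).comp measurable_prodMk_left
    simp_rw [← fun τ => lintegral_const_mul (ENNReal.ofReal r) (hm τ) (μ := U)]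
    rw [lintegral_lintegral_swap
      (((measurable_expConv_integrand r).const_mul (ENNReal.ofReal r)).aemeasurable),
      ← lintegral_indicator measurableSet_Iic]
    refine lintegral_congr_ae ?_
    filter_upwards [measure_eq_zero_iff_ae_notMem.1 hU0] with s hs
    have hs0 : 0 < s := not_le.1 hs
    by_cases hst : s ≤ t
    · rw [Set.indicator_of_mem (Set.mem_Iic.2 hst)]
      have h1 : ∀ τ, ENNReal.ofReal r * {x : ℝ × ℝ | x.2 ≤ x.1}.indicator
          (fun x => ENNReal.ofReal (Real.exp (-(r * (x.1 - x.2))))) (τ, s)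
          = (Set.Ici s).indicator
            (fun τ => ENNReal.ofReal (r * Real.exp (-(r * (τ - s))))) τ := by
        intro τ
        by_cases hτ : s ≤ τ
        · rw [Set.indicator_of_mem (by exact hτ), Set.indicator_of_mem (Set.mem_Ici.2 hτ),
            ENNReal.ofReal_mul hr.le]
        · rw [Set.indicator_of_notMem (by exact hτ),
            Set.indicator_of_notMem (by simpa using hτ), mul_zero]
      simp_rw [h1]
      rw [lintegral_indicator measurableSet_Ici, Measure.restrict_restrict measurableSet_Ici]
      have hset : Set.Ici s ∩ Set.Ioc 0 t = Set.Icc s t := by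
        ext τ
        simp only [Set.mem_inter_iff, Set.mem_Ici, Set.mem_Ioc, Set.mem_Icc]
        constructor
        · rintro ⟨h1, _, h2⟩; exact ⟨h1, h2⟩
        · rintro ⟨h1, h2⟩; exact ⟨h1, by linarith, h2⟩
      rw [hset, setLIntegral_congr Ioc_ae_eq_Icc.symm, ← ofReal_integral_eq_lintegral_ofReal,
        ← intervalIntegral.integral_of_le hst]
      · congr 1
        have hderiv : ∀ x ∈ Set.uIcc s t, HasDerivAt (fun τ => -Real.exp (-(r * (τ - s))))
            (r * Real.exp (-(r * (x - s)))) x := by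
          intro x _
          have := ((((hasDerivAt_id x).sub_const s).const_mul r).neg.exp).neg
          simp only [id] at this
          exact this.congr_deriv (by simp; ring)
        rw [intervalIntegral.integral_eq_sub_of_hasDerivAt hderiv
          (Continuous.intervalIntegrable (by fun_prop) _ _)]
        simp; ring
      · exact (Continuous.integrableOn_Ioc (by fun_prop))
      · exact Eventually.of_forall fun τ => by positivity
    · rw [Set.indicator_of_notMem (by simpa using hst)]
      refine setLIntegral_eq_zero measurableSet_Ioc fun τ hτ => ?_
      have : ¬ s ≤ τ := fun h => hst (h.trans hτ.2)
      simp only [Pi.zero_apply]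
      rw [Set.indicator_of_notMem (by exact this), mul_zero]
  rw [hswap, expConvL, ← lintegral_add_left (by fun_prop), ← setLIntegral_one]
  refine setLIntegral_congr_fun measurableSet_Iic fun s hs => ?_
  have hs' : s ≤ t := hs
  have h1 : Real.exp (-(r * (t - s))) ≤ 1 := Real.exp_le_one_iff.2 (by nlinarith)
  rw [← ENNReal.ofReal_add (Real.exp_pos _).le (by linarith), add_sub_cancel, ENNReal.ofReal_one]

theorem expConvL_le (r : ℝ) (hr : 0 ≤ r) (t : ℝ) : expConvL U r t ≤ U (Set.Iic t) := by
  rw [expConvL, ← setLIntegral_one]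
  refine setLIntegral_mono' measurableSet_Iic fun s hs => ?_
  have hs' : s ≤ t := hs
  rw [← ENNReal.ofReal_one]
  exact ENNReal.ofReal_le_ofReal (Real.exp_le_one_iff.2 (by nlinarith))

theorem expConv_nonneg (r t : ℝ) : 0 ≤ expConv U r t := ENNReal.toReal_nonneg

theorem expConv_anti (hU : ∀ t, U (Set.Iic t) ≠ ∞) {r r' : ℝ} (hr : 0 ≤ r) (h : r ≤ r') (t : ℝ) :
    expConv U r' t ≤ expConv U r t := by
  refine ENNReal.toReal_mono (ne_top_of_le_ne_top (hU t) (expConvL_le r hr t)) ?_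
  refine setLIntegral_mono' measurableSet_Iic fun s hs => ?_
  have hs' : s ≤ t := hs
  refine ENNReal.ofReal_le_ofReal (Real.exp_le_exp.2 ?_)
  nlinarith

theorem expConv_zero (hU0 : U (Set.Iic 0) = 0) (r : ℝ) : expConv U r 0 = 0 := by
  rw [expConv, expConvL, setLIntegral_measure_zero _ _ hU0, ENNReal.toReal_zero]

theorem intervalIntegrable_expConv [SFinite U] (hU : ∀ t, U (Set.Iic t) ≠ ∞) {r : ℝ} (hr : 0 ≤ r)
    {t : ℝ} (ht : 0 ≤ t) : IntervalIntegrable (expConv U r) volume 0 t := by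
  rw [intervalIntegrable_iff_integrableOn_Ioc_of_le ht]
  refine Measure.integrableOn_of_bounded (M := (U (Set.Iic t)).toReal) (by simp)
    (measurable_expConvL r).ennreal_toReal.aestronglyMeasurable ?_
  filter_upwards [ae_restrict_mem measurableSet_Ioc] with τ hτ
  rw [Real.norm_of_nonneg (expConv_nonneg r τ)]
  exact ENNReal.toReal_mono (hU t) ((expConvL_le r hr τ).trans
    (measure_mono (Set.Iic_subset_Iic.2 hτ.2)))

theorem expConv_add_integral [SFinite U] (hU0 : U (Set.Iic 0) = 0) (hU : ∀ t, U (Set.Iic t) ≠ ∞)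
    {r : ℝ} (hr : 0 < r) {t : ℝ} (ht : 0 ≤ t) :
    expConv U r t + r * ∫ τ in (0 : ℝ)..t, expConv U r τ = U.real (Set.Iic t) := by
  have hfin : ∀ τ, expConvL U r τ ≠ ∞ := fun τ => ne_top_of_le_ne_top (hU τ) (expConvL_le r hr.le τ)
  have h1 := expConvL_add_integral hU0 hr t
  have hfint : ∫ τ in (0 : ℝ)..t, expConv U r τ = (∫⁻ τ in Set.Ioc 0 t, expConvL U r τ).toReal := by
    rw [intervalIntegral.integral_of_le ht]
    exact integral_toReal (measurable_expConvL r).aemeasurable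
      (Eventually.of_forall fun τ => (hfin τ).lt_top)
  rw [Measure.real, ← h1, ENNReal.toReal_add (hfin t), ENNReal.toReal_mul,
    ENNReal.toReal_ofReal hr.le, hfint, expConv]
  intro htop
  rw [htop] at h1
  exact hU t (by rw [← h1, add_top])

/-- A measure on the positive half-line is determined by its distribution function. -/
theorem eq_withDensity_of_real_Iic (hU0 : U (Set.Iic 0) = 0) (hU : ∀ t, U (Set.Iic t) ≠ ∞)
    {u : ℝ → ℝ} (hu0 : ∀ s, 0 < s → 0 ≤ u s)
    (hui : ∀ t, 0 ≤ t → IntervalIntegrable u volume 0 t)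
    (h : ∀ t, 0 ≤ t → U.real (Set.Iic t) = ∫ τ in (0 : ℝ)..t, u τ) :
    U = (volume.restrict (Set.Ioi 0)).withDensity fun s => ENNReal.ofReal (u s) := by
  set V := (volume.restrict (Set.Ioi (0 : ℝ))).withDensity fun s => ENNReal.ofReal (u s) with hV
  have hIic : ∀ t, U (Set.Iic t) = V (Set.Iic t) := by
    intro t
    rw [hV, withDensity_apply _ measurableSet_Iic, Measure.restrict_restrict measurableSet_Iic]
    rcases le_or_gt t 0 with ht | ht
    · rw [measure_mono_null (Set.Iic_subset_Iic.2 ht) hU0]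
      have : Set.Iic t ∩ Set.Ioi 0 = ∅ := by
        ext x; simp only [Set.mem_inter_iff, Set.mem_Iic, Set.mem_Ioi, Set.mem_empty_iff_false,
          iff_false, not_and, not_lt]
        intro hx; linarith
      rw [this, Measure.restrict_empty, lintegral_zero_measure]
    · have hset : Set.Iic t ∩ Set.Ioi 0 = Set.Ioc 0 t := by
        rw [Set.inter_comm, Set.Ioi_inter_Iic]
      rw [hset, ← ofReal_integral_eq_lintegral_ofReal
        ((intervalIntegrable_iff_integrableOn_Ioc_of_le ht.le).1 (hui t ht.le)),
        ← intervalIntegral.integral_of_le ht.le, ← h t ht.le, ofReal_measureReal (hU t)]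
      filter_upwards [ae_restrict_mem measurableSet_Ioc] with s hs using hu0 s hs.1
  have hlf : IsLocallyFiniteMeasure U := by
    refine ⟨fun x => ⟨Set.Iic (x + 1), Iic_mem_nhds (by linarith), (hU _).lt_top⟩⟩
  refine Measure.ext_of_Ioc U V fun x y hxy => ?_
  have hset : Set.Ioc x y = Set.Iic y \ Set.Iic x := by
    ext z; simp [and_comm]
  rw [hset, measure_sdiff (Set.Iic_subset_Iic.2 hxy.le) measurableSet_Iic.nullMeasurableSet (hU x),
    measure_sdiff (Set.Iic_subset_Iic.2 hxy.le) measurableSet_Iic.nullMeasurableSet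
      (by rw [← hIic]; exact hU x), hIic, hIic]

end expConv

theorem expMeasure_Ioi {r : ℝ} (hr : 0 < r) {t : ℝ} (ht : 0 ≤ t) :
    expMeasure r (Set.Ioi t) = ENNReal.ofReal (Real.exp (-(r * t))) := by
  have : IsProbabilityMeasure (expMeasure r) := isProbabilityMeasure_expMeasure hr
  rw [← ofReal_measureReal, ← Set.compl_Iic, probReal_compl_eq_one_sub measurableSet_Iic,
    ← cdf_eq_real, cdf_expMeasure_eq hr, if_pos ht]
  congr 1; ring

/-! ### The renewal measure of the starts of the cycles. -/

namespace CycleModel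

variable {Ω 𝒲 : Type*} [mΩ : MeasurableSpace Ω] [m𝒲 : MeasurableSpace 𝒲] (c : CycleModel 𝒲)
  {P : Measure Ω} [IsProbabilityMeasure P] {κ : Measure 𝒲} [IsProbabilityMeasure κ]
  {ℱ : ℕ → MeasurableSpace Ω} {s₀ : Ω → ℝ} {W : ℕ → Ω → 𝒲}

/-- The expected number of cycles that start in a given set. -/
noncomputable def renewalMeasure (P : Measure Ω) (s₀ : Ω → ℝ) (W : ℕ → Ω → 𝒲) : Measure ℝ :=
  Measure.sum fun m => P.map fun ω => c.start (s₀ ω) (fun n => W n ω) m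

theorem lintegral_renewalMeasure (h : IsCycleInput P κ ℱ s₀ W) {k : ℝ → ℝ≥0∞} (hk : Measurable k)
    (t : ℝ) : ∫⁻ s, k (t - s) ∂c.renewalMeasure P s₀ W
      = c.renewalSum P s₀ W (fun _ _ => 1) k t := by
  rw [renewalMeasure, lintegral_sum_measure, renewalSum]
  refine tsum_congr fun m => ?_
  rw [lintegral_map (by fun_prop) ((c.measurable_start h m).mono (h.le m) le_rfl)]
  simp

theorem ae_start_pos (hpos : ∀ᵐ ω ∂P, 0 < s₀ ω) (m : ℕ) :
    ∀ᵐ ω ∂P, 0 < c.start (s₀ ω) (fun n => W n ω) m := by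
  filter_upwards [hpos] with ω hω
  exact hω.trans_le (c.start_mono (s₀ ω) _ (Nat.zero_le m))

theorem renewalMeasure_Iic_zero (h : IsCycleInput P κ ℱ s₀ W) (hpos : ∀ᵐ ω ∂P, 0 < s₀ ω) :
    c.renewalMeasure P s₀ W (Set.Iic 0) = 0 := by
  rw [renewalMeasure, Measure.sum_apply _ measurableSet_Iic, ENNReal.tsum_eq_zero]
  intro m
  rw [Measure.map_apply ((c.measurable_start h m).mono (h.le m) le_rfl) measurableSet_Iic,
    measure_eq_zero_iff_ae_notMem]
  filter_upwards [c.ae_start_pos hpos m] with ω hω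
  simpa using hω

theorem tsum_running {s : ℝ} {w : ℕ → 𝒲} (h : Tendsto (c.start s w) atTop atTop) (t : ℝ) :
    (Set.Ioi t).indicator (fun _ => (1 : ℝ≥0∞)) s
      + ∑' m, c.running.indicator (fun _ => 1) (t - c.start s w m, w m) = 1 := by
  rcases lt_or_ge t s with h1 | h1
  · rw [Set.indicator_of_mem (Set.mem_Ioi.2 h1)]
    have : ∀ m, c.running.indicator (fun _ => (1 : ℝ≥0∞)) (t - c.start s w m, w m) = 0 := by
      intro m
      refine Set.indicator_of_notMem (fun hm => ?_) _
      have h2 := c.start_mono s w (Nat.zero_le m)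
      have h3 : 0 ≤ t - c.start s w m := hm.1
      simp only [start] at h2
      linarith
    simp [this]
  · rw [Set.indicator_of_notMem (by simpa using h1), zero_add]
    obtain ⟨m, hm1, hm2⟩ := c.exists_cycle h h1
    rw [tsum_eq_single m]
    · refine Set.indicator_of_mem ?_ _
      rw [start] at hm2
      exact ⟨sub_nonneg.2 hm1, by simp only; linarith⟩
    · intro m' hm'
      refine Set.indicator_of_notMem (fun hr => ?_) _
      have e1 : 0 ≤ t - c.start s w m' := hr.1
      have e2 : t - c.start s w m' < c.len (w m') := hr.2
      have e3 : t < c.start s w (m' + 1) := by rw [start]; linarith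
      rcases lt_or_gt_of_ne hm' with hlt | hlt
      · have := c.start_mono s w (show m' + 1 ≤ m by omega)
        linarith
      · have := c.start_mono s w (show m + 1 ≤ m' by omega)
        linarith

/-- At each time, either no cycle has started, or exactly one cycle is running. -/
theorem renewal_partition (h : IsCycleInput P κ ℱ s₀ W)
    (hstart : ∀ᵐ ω ∂P, Tendsto (c.start (s₀ ω) fun n => W n ω) atTop atTop) (t : ℝ) :
    P.map s₀ (Set.Ioi t) + ∫⁻ s in Set.Iic t, κ {w | t - s < c.len w} ∂c.renewalMeasure P s₀ W
      = 1 := by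
  have hs₀ : Measurable s₀ := h.measurable_s₀.mono (h.le 0) le_rfl
  have hrun : Measurable (c.running.indicator fun _ => (1 : ℝ≥0∞)) :=
    measurable_const.indicator c.measurableSet_running
  have hsm : ∀ m, Measurable fun ω => c.start (s₀ ω) (fun n => W n ω) m := fun m =>
    (c.measurable_start h m).mono (h.le m) le_rfl
  have h1 : ∫⁻ s in Set.Iic t, κ {w | t - s < c.len w} ∂c.renewalMeasure P s₀ W
      = ∫⁻ s, averaged κ (c.running.indicator fun _ => 1) (t - s) ∂c.renewalMeasure P s₀ W := by
    rw [← lintegral_indicator measurableSet_Iic]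
    refine lintegral_congr fun s => ?_
    by_cases hs : s ≤ t
    · rw [Set.indicator_of_mem (Set.mem_Iic.2 hs), averaged]
      have : ∀ w, c.running.indicator (fun _ => (1 : ℝ≥0∞)) (t - s, w)
          = {w | t - s < c.len w}.indicator 1 w := by
        intro w
        by_cases hw : t - s < c.len w
        · rw [Set.indicator_of_mem (by exact ⟨sub_nonneg.2 hs, hw⟩), Set.indicator_of_mem (by exact hw)]
          rfl
        · rw [Set.indicator_of_notMem (fun hh => hw hh.2), Set.indicator_of_notMem (by exact hw)]
      simp_rw [this]
      rw [lintegral_indicator_one (measurableSet_lt measurable_const c.measurable_len)]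
    · rw [Set.indicator_of_notMem (by simpa using hs),
        c.averaged_indicator_of_neg subset_rfl _ _ (by linarith)]
  rw [h1, c.lintegral_renewalMeasure h (measurable_averaged hrun),
    ← c.renewalSum_averaged h (fun m => measurable_const) hrun, Measure.map_apply hs₀ measurableSet_Ioi,
    ← lintegral_indicator_one (hs₀ measurableSet_Ioi), ← lintegral_tsum, ← lintegral_add_left]
  · refine (lintegral_congr_ae (g := fun _ => (1 : ℝ≥0∞)) ?_).trans (by simp)
    filter_upwards [hstart] with ω hω
    have := c.tsum_running hω t
    simp only [ENNReal.ofReal_one, one_mul]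
    exact this
  · exact measurable_const.indicator (hs₀ measurableSet_Ioi)
  · intro m
    refine AEMeasurable.mul (by fun_prop) ?_
    exact (hrun.comp ((measurable_const.sub (hsm m)).prodMk (h.measurable m))).aemeasurable

/-- If cycles outlive an exponential clock of rate `r`, then the renewal measure is locally
finite. -/
theorem renewalMeasure_Iic_ne_top (h : IsCycleInput P κ ℱ s₀ W)
    (hstart : ∀ᵐ ω ∂P, Tendsto (c.start (s₀ ω) fun n => W n ω) atTop atTop)
    (hpos : ∀ᵐ ω ∂P, 0 < s₀ ω) {r : ℝ} (hr : 0 < r)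
    (hsurv : ∀ v, 0 ≤ v → ENNReal.ofReal (Real.exp (-(r * v))) ≤ κ {w | v < c.len w}) (t : ℝ) :
    c.renewalMeasure P s₀ W (Set.Iic t) ≠ ∞ := by
  have h0 := c.renewalMeasure_Iic_zero h hpos
  set U := c.renewalMeasure P s₀ W with hU
  have h1 : ENNReal.ofReal (Real.exp (-(r * t))) * U (Set.Iic t) ≤ 1 := by
    rw [← setLIntegral_const]
    refine le_trans ?_ (le_of_le_of_eq le_add_self (c.renewal_partition h hstart t))
    rw [← hU]
    refine lintegral_mono_ae ?_
    filter_upwards [ae_restrict_mem measurableSet_Iic,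
      ae_restrict_of_ae (measure_eq_zero_iff_ae_notMem.1 h0)] with s hs hs0
    have hs' : s ≤ t := hs
    have hs0' : 0 < s := not_le.1 hs0
    refine le_trans (ENNReal.ofReal_le_ofReal (Real.exp_le_exp.2 ?_)) (hsurv _ (sub_nonneg.2 hs'))
    nlinarith
  intro htop
  rw [htop, ENNReal.mul_top (by simp [Real.exp_pos])] at h1
  exact absurd h1 (by simp)

theorem hasRenewalDensity_of_real_Iic (h : IsCycleInput P κ ℱ s₀ W) {r : ℝ} (hr : 0 < r)
    (hs₀ : P.map s₀ = expMeasure r) (hU0 : c.renewalMeasure P s₀ W (Set.Iic 0) = 0)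
    (hU : ∀ t, c.renewalMeasure P s₀ W (Set.Iic t) ≠ ∞)
    {u : ℝ → ℝ} {M : ℝ} (hum : Measurable u) (hu0 : ∀ s, 0 < s → 0 ≤ u s)
    (huM : ∀ s, 0 < s → u s ≤ M) (hut : Tendsto u atTop (𝓝 (1 / ∫ w, c.len w ∂κ)))
    (hui : ∀ t, 0 ≤ t → IntervalIntegrable u volume 0 t)
    (hN : ∀ t, 0 ≤ t → (c.renewalMeasure P s₀ W).real (Set.Iic t) = ∫ τ in (0 : ℝ)..t, u τ) :
    HasRenewalDensity c P κ s₀ W r u M where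
  rate_pos := hr
  map_s₀ := hs₀
  measurable := hum
  le := huM
  tendsto := hut
  renewalSum_eq := by
    intro k hk t
    rw [← c.lintegral_renewalMeasure h hk, eq_withDensity_of_real_Iic hU0 hU hu0 hui hN,
      lintegral_withDensity_eq_lintegral_mul _ (by fun_prop) (by fun_prop)]
    simp_rw [Pi.mul_apply, mul_comm]

theorem ae_pos_of_map_eq_expMeasure (h : IsCycleInput P κ ℱ s₀ W) {r : ℝ} (hr : 0 < r)
    (hs₀ : P.map s₀ = expMeasure r) : ∀ᵐ ω ∂P, 0 < s₀ ω := by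
  have hm : Measurable s₀ := h.measurable_s₀.mono (h.le 0) le_rfl
  have : IsProbabilityMeasure (expMeasure r) := isProbabilityMeasure_expMeasure hr
  have h1 := expMeasure_Ioi hr le_rfl
  rw [← hs₀, Measure.map_apply hm measurableSet_Ioi] at h1
  exact (mem_ae_iff_prob_eq_one (hm measurableSet_Ioi)).2 (by simpa using h1)

/-- The renewal density for exponential cycles. -/
theorem hasRenewalDensity_exp (h : IsCycleInput P κ ℱ s₀ W)
    (hstart : ∀ᵐ ω ∂P, Tendsto (c.start (s₀ ω) fun n => W n ω) atTop atTop)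
    {r : ℝ} (hr : 0 < r) (hs₀ : P.map s₀ = expMeasure r)
    (hsurv : ∀ v, 0 ≤ v → κ {w | v < c.len w} = ENNReal.ofReal (Real.exp (-(r * v))))
    (hmean : ∫ w, c.len w ∂κ = 1 / r) :
    HasRenewalDensity c P κ s₀ W r (fun _ => r) r := by
  have hpos := ae_pos_of_map_eq_expMeasure h hr hs₀
  have hU0 := c.renewalMeasure_Iic_zero h hpos
  have hU := c.renewalMeasure_Iic_ne_top h hstart hpos hr (fun v hv => (hsurv v hv).ge)
  have hSF : SFinite (c.renewalMeasure P s₀ W) := by unfold renewalMeasure; infer_instance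
  -- With exponential cycles the running probability is the exponential convolution itself, so the
  -- partition identity gives it in closed form.
  have hX : ∀ t, 0 ≤ t → expConv (c.renewalMeasure P s₀ W) r t = 1 - Real.exp (-(r * t)) := by
    intro t ht
    have h1 := c.renewal_partition h hstart t
    have h2 : ∫⁻ s in Set.Iic t, κ {w | t - s < c.len w} ∂c.renewalMeasure P s₀ W
        = expConvL (c.renewalMeasure P s₀ W) r t := by
      refine setLIntegral_congr_fun measurableSet_Iic fun s hs => ?_
      exact hsurv _ (sub_nonneg.2 hs)
    rw [h2, hs₀, expMeasure_Ioi hr ht] at h1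
    have h3 := congrArg ENNReal.toReal h1
    rw [ENNReal.toReal_add ENNReal.ofReal_ne_top
      (ne_top_of_le_ne_top (hU t) (expConvL_le r hr.le t)),
      ENNReal.toReal_ofReal (Real.exp_pos _).le, ENNReal.toReal_one] at h3
    rw [expConv]; linarith
  refine c.hasRenewalDensity_of_real_Iic h hr hs₀ hU0 hU measurable_const (fun _ _ => hr.le)
    (fun _ _ => le_rfl) ?_ (fun t _ => by simp) ?_
  · rw [hmean, one_div_one_div]; exact tendsto_const_nhds
  · intro t ht
    rw [← expConv_add_integral hU0 hU hr ht, hX t ht]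
    have h1 : ∫ τ in (0 : ℝ)..t, expConv (c.renewalMeasure P s₀ W) r τ
        = ∫ τ in (0 : ℝ)..t, (1 - Real.exp (-(r * τ))) := by
      refine intervalIntegral.integral_congr fun τ hτ => ?_
      rw [Set.uIcc_of_le ht] at hτ
      exact hX τ hτ.1
    have h2 : ∫ τ in (0 : ℝ)..t, (1 - Real.exp (-(r * τ)))
        = (t + Real.exp (-(r * t)) / r) - (0 + Real.exp (-(r * 0)) / r) := by
      refine intervalIntegral.integral_eq_sub_of_hasDerivAt
        (f := fun τ => τ + Real.exp (-(r * τ)) / r) (fun x _ => ?_)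
        (Continuous.intervalIntegrable (by fun_prop) _ _)
      have := (hasDerivAt_id x).add ((((hasDerivAt_id x).const_mul r).neg.exp).div_const r)
      exact this.congr_deriv (by simp; field_simp; ring)
    rw [h1, h2]
    simp
    field_simp
    ring

/-- The renewal density for cycles distributed as the maximum of two independent exponential
variables. -/
theorem exists_hasRenewalDensity_max (h : IsCycleInput P κ ℱ s₀ W)
    (hstart : ∀ᵐ ω ∂P, Tendsto (c.start (s₀ ω) fun n => W n ω) atTop atTop)
    {l m : ℝ} (hl : 0 < l) (hm : 0 < m) (hs₀ : P.map s₀ = expMeasure l)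
    (hsurv : ∀ v, 0 ≤ v → κ {w | v < c.len w} = ENNReal.ofReal
      (Real.exp (-(m * v)) + Real.exp (-(l * v)) - Real.exp (-((l + m) * v))))
    (hmean : ∫ w, c.len w ∂κ = 1 / m + 1 / l - 1 / (l + m)) :
    ∃ u M, HasRenewalDensity c P κ s₀ W l u M := by
  have hlm : 0 < l + m := add_pos hl hm
  have hpos := ae_pos_of_map_eq_expMeasure h hl hs₀
  have hU0 := c.renewalMeasure_Iic_zero h hpos
  have hexp : ∀ v, 0 ≤ v → Real.exp (-((l + m) * v)) ≤ Real.exp (-(l * v)) := fun v hv =>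
    Real.exp_le_exp.2 (by nlinarith)
  have hU := c.renewalMeasure_Iic_ne_top h hstart hpos hm (fun v hv => by
    rw [hsurv v hv]
    exact ENNReal.ofReal_le_ofReal (by linarith [hexp v hv]))
  have hSF : SFinite (c.renewalMeasure P s₀ W) := by unfold renewalMeasure; infer_instance
  set U := c.renewalMeasure P s₀ W with hUdef
  have hfin : ∀ r, 0 < r → ∀ t, expConvL U r t ≠ ∞ := fun r hr t =>
    ne_top_of_le_ne_top (hU t) (expConvL_le r hr.le t)
  set x₁ := expConv U m with hx₁
  set x₃ := expConv U (l + m) with hx₃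
  -- The summand is the probability that no cycle has started. It acts like an additional unit mass
  -- of U at time 0, which is why z starts at 1.
  set z : ℝ → ℝ := fun t => Real.exp (-(l * t)) + expConv U l t with hz
  -- The survival function of the maximum is a signed sum of three exponentials, so the partition
  -- identity becomes one linear relation among three convolutions; it eliminates x₃.
  have hpart : ∀ t, 0 ≤ t → x₃ t = z t + x₁ t - 1 := by
    intro t ht
    have h1 := c.renewal_partition h hstart t
    have h2 : (∫⁻ s in Set.Iic t, κ {w | t - s < c.len w} ∂U) + expConvL U (l + m) t
        = expConvL U m t + expConvL U l t := by
      rw [expConvL, expConvL, expConvL, ← lintegral_add_right _ (by fun_prop),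
        ← lintegral_add_right _ (by fun_prop)]
      refine setLIntegral_congr_fun measurableSet_Iic fun s hs => ?_
      have hs' : 0 ≤ t - s := sub_nonneg.2 hs
      have h3 := hexp _ hs'
      rw [hsurv _ hs', ← ENNReal.ofReal_add (by linarith [Real.exp_pos (-(m * (t - s)))]) (Real.exp_pos _).le,
        ← ENNReal.ofReal_add (Real.exp_pos _).le (Real.exp_pos _).le, sub_add_cancel]
    have h4 : ENNReal.ofReal (Real.exp (-(l * t))) + (expConvL U m t + expConvL U l t)
        = 1 + expConvL U (l + m) t := by
      rw [← h2, ← add_assoc, ← expMeasure_Ioi hl ht, ← hs₀, h1]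
    have h5 := congrArg ENNReal.toReal h4
    rw [ENNReal.toReal_add ENNReal.ofReal_ne_top
      (ENNReal.add_ne_top.2 ⟨hfin m hm t, hfin l hl t⟩),
      ENNReal.toReal_add (hfin m hm t) (hfin l hl t),
      ENNReal.toReal_add ENNReal.one_ne_top (hfin _ hlm t),
      ENNReal.toReal_ofReal (Real.exp_pos _).le, ENNReal.toReal_one] at h5
    simp only [hx₁, hx₃, hz, expConv]
    linarith
  have hi₁ : ∀ t, 0 ≤ t → IntervalIntegrable x₁ volume 0 t := fun t ht =>
    intervalIntegrable_expConv hU hm.le ht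
  have hiz : ∀ t, 0 ≤ t → IntervalIntegrable z volume 0 t := fun t ht =>
    (Continuous.intervalIntegrable (by fun_prop) _ _).add (intervalIntegrable_expConv hU hl.le ht)
  have hz0 : z 0 = 1 := by simp [hz, expConv_zero hU0]
  have hx0 : x₁ 0 = 0 := expConv_zero hU0 m
  have hN₁ : ∀ t, 0 ≤ t → U.real (Set.Iic t) = x₁ t + m * ∫ τ in (0 : ℝ)..t, x₁ τ := fun t ht =>
    (expConv_add_integral hU0 hU hm ht).symm
  have hN₃ : ∀ t, 0 ≤ t → U.real (Set.Iic t) = z t + x₁ t - 1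
      + (l + m) * ((∫ τ in (0 : ℝ)..t, z τ) + (∫ τ in (0 : ℝ)..t, x₁ τ) - t) := by
    intro t ht
    have e : ∫ τ in (0 : ℝ)..t, x₃ τ
        = (∫ τ in (0 : ℝ)..t, z τ) + (∫ τ in (0 : ℝ)..t, x₁ τ) - ∫ τ in (0 : ℝ)..t, (1 : ℝ) := by
      rw [← intervalIntegral.integral_add (hiz t ht) (hi₁ t ht),
        ← intervalIntegral.integral_sub ((hiz t ht).add (hi₁ t ht)) (by simp)]
      refine intervalIntegral.integral_congr fun τ hτ => ?_
      rw [Set.uIcc_of_le ht] at hτ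
      exact hpart τ hτ.1
    have e2 : x₃ t + (l + m) * ∫ τ in (0 : ℝ)..t, x₃ τ = U.real (Set.Iic t) :=
      expConv_add_integral hU0 hU hlm ht
    rw [← e2, e, hpart t ht]
    simp
  have hN₂ : ∀ t, 0 ≤ t → U.real (Set.Iic t) = z t - 1 + l * ∫ τ in (0 : ℝ)..t, z τ := by
    intro t ht
    have h2 : ∫ τ in (0 : ℝ)..t, Real.exp (-(l * τ))
        = -Real.exp (-(l * t)) / l - -Real.exp (-(l * 0)) / l := by
      refine intervalIntegral.integral_eq_sub_of_hasDerivAt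
        (f := fun τ => -Real.exp (-(l * τ)) / l) (fun x _ => ?_)
        (Continuous.intervalIntegrable (by fun_prop) _ _)
      have := ((((hasDerivAt_id x).const_mul l).neg.exp).neg.div_const l)
      exact this.congr_deriv (by simp; field_simp)
    rw [← expConv_add_integral hU0 hU hl ht, hz, intervalIntegral.integral_add
      (Continuous.intervalIntegrable (by fun_prop) _ _) (intervalIntegrable_expConv hU hl.le ht), h2]
    simp
    field_simp
    ring
  -- Eliminating x₁ t and z t from `hN₁`, `hN₂` and `hN₃` expresses the distribution function of U
  -- as the integral of this function.
  set u : ℝ → ℝ := fun t => (l + m) - l * x₁ t - m * z t with hu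
  have hui : ∀ t, 0 ≤ t → IntervalIntegrable u volume 0 t := fun t ht =>
    ((by simp : IntervalIntegrable (fun _ => l + m) volume 0 t).sub ((hi₁ t ht).const_mul l)).sub
      ((hiz t ht).const_mul m)
  have huint : ∀ t, 0 ≤ t → ∫ τ in (0 : ℝ)..t, u τ
      = (l + m) * t - l * (∫ τ in (0 : ℝ)..t, x₁ τ) - m * ∫ τ in (0 : ℝ)..t, z τ := by
    intro t ht
    rw [hu, intervalIntegral.integral_sub (by
      exact (by simp : IntervalIntegrable (fun _ => l + m) volume 0 t).sub ((hi₁ t ht).const_mul l))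
      ((hiz t ht).const_mul m), intervalIntegral.integral_sub (by simp) ((hi₁ t ht).const_mul l)]
    simp
    ring
  set d := l ^ 2 + l * m + m ^ 2 with hd
  have hd0 : 0 < d := by positivity
  have hl2 : √l * √l = l := Real.mul_self_sqrt hl.le
  have hm2 : √m * √m = m := Real.mul_self_sqrt hm.le
  have hsl : 0 < √l := Real.sqrt_pos.2 hl
  have hsm : 0 < √m := Real.sqrt_pos.2 hm
  set xi := l * (l + m) / d with hxi
  set zi := m * (l + m) / d with hzi
  have hxi' : (l + m) * (1 - xi) = m * zi := by
    rw [hxi, hzi]; field_simp; rw [hd]; ring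
  have hzi' : (l + m) * (1 - zi) = l * xi := by
    rw [hxi, hzi]; field_simp; rw [hd]; ring
  -- The pair (x₁, z) solves a linear system with matrix rows (l + m, m) and (l, l + m) and fixed
  -- point (xi, zi). Its left eigenvectors are (√l, ± √m), with eigenvalues l + m ± √(l m), both
  -- positive; so each of these combinations of the deviations obeys a scalar equation and decays
  -- exponentially.
  have hdecay : ∀ σ : ℝ, σ ^ 2 = 1 →
      Tendsto (fun t => √l * (x₁ t - xi) + σ * √m * (z t - zi)) atTop (𝓝 0) := by
    intro σ hσ
    have hfint : ∀ t, 0 ≤ t →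
        IntervalIntegrable (fun t => √l * (x₁ t - xi) + σ * √m * (z t - zi)) volume 0 t := fun t ht =>
      (((hi₁ t ht).sub (by simp)).const_mul _).add (((hiz t ht).sub (by simp)).const_mul _)
    refine tendsto_zero_of_eq_sub_integral (r := l + m + σ * √l * √m) ?_ hfint ?_
    · have : |σ| = 1 := by rw [← sq_eq_sq₀ (abs_nonneg _) zero_le_one]; simpa using hσ
      have h1 : -1 ≤ σ := by rw [← this]; exact neg_abs_le σ
      nlinarith [sq_nonneg (√l - √m), mul_pos hsl hsm]
    · intro t ht
      have e1 : ∫ τ in (0 : ℝ)..t, (√l * (x₁ τ - xi) + σ * √m * (z τ - zi))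
          = √l * ((∫ τ in (0 : ℝ)..t, x₁ τ) - xi * t)
            + σ * √m * ((∫ τ in (0 : ℝ)..t, z τ) - zi * t) := by
        rw [intervalIntegral.integral_add (((hi₁ t ht).sub (by simp)).const_mul _)
          (((hiz t ht).sub (by simp)).const_mul _), intervalIntegral.integral_const_mul,
          intervalIntegral.integral_const_mul, intervalIntegral.integral_sub (hi₁ t ht) (by simp),
          intervalIntegral.integral_sub (hiz t ht) (by simp)]
        simp [mul_comm]
      have q1 := hN₁ t ht
      have q2 := hN₂ t ht
      have q3 := hN₃ t ht
      rw [e1, hz0, hx0]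
      generalize (∫ τ in (0 : ℝ)..t, x₁ τ) = X at *
      generalize (∫ τ in (0 : ℝ)..t, z τ) = Z at *
      have qx : x₁ t = (l + m) * t - (l + m) * X - m * Z := by linarith
      have qz : z t = 1 + (l + m) * t - (l + m) * Z - l * X := by linarith
      rw [qx, qz]
      linear_combination (√l * t) * hxi' + (σ * √m * t) * hzi'
        + (σ * √m * X - σ * √m * xi * t) * hl2 + (σ ^ 2 * √l * (Z - zi * t)) * hm2 + (m * √l * (Z - zi * t)) * hσ
  have hxt : Tendsto x₁ atTop (𝓝 xi) := by
    have := ((hdecay 1 (by norm_num)).add (hdecay (-1) (by norm_num))).const_mul (1 / (2 * √l))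
    have h2 := this.add_const xi
    simp only [add_zero, mul_zero, zero_add] at h2
    refine h2.congr fun t => ?_
    field_simp
    ring
  have hzt : Tendsto z atTop (𝓝 zi) := by
    have := ((hdecay 1 (by norm_num)).sub (hdecay (-1) (by norm_num))).const_mul (1 / (2 * √m))
    have h2 := this.add_const zi
    simp only [sub_zero, mul_zero, zero_add] at h2
    refine h2.congr fun t => ?_
    field_simp
    ring
  have hznn : ∀ t, 0 ≤ z t := fun t => add_nonneg (Real.exp_pos _).le (expConv_nonneg l t)
  refine ⟨u, l + m, c.hasRenewalDensity_of_real_Iic h hl hs₀ hU0 hU ?_ ?_ ?_ ?_ hui ?_⟩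
  · have e1 : Measurable x₁ := (measurable_expConvL m).ennreal_toReal
    have e2 : Measurable (expConv U l) := (measurable_expConvL l).ennreal_toReal
    fun_prop
  · intro s hs
    -- A convolution decreases when its rate grows, so x₃ ≤ x₁ and x₃ ≤ z. With x₃ = z + x₁ - 1
    -- these say z ≤ 1 and x₁ ≤ 1, hence u ≥ 0.
    have e1 := hpart s hs.le
    have e2 : x₃ s ≤ x₁ s := expConv_anti hU hm.le (by linarith) s
    have e3 : x₃ s ≤ expConv U l s := expConv_anti hU hl.le (by linarith) s
    have e4 : x₃ s ≤ z s := e3.trans (by simp only [hz]; linarith [Real.exp_pos (-(l * s))])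
    simp only [hu]
    nlinarith [mul_nonneg hm.le (sub_nonneg.2 e2), mul_nonneg hl.le (sub_nonneg.2 e4)]
  · intro s hs
    have := mul_nonneg hl.le (expConv_nonneg (U := U) m s)
    have := mul_nonneg hm.le (hznn s)
    simp only [hu]; linarith
  · have h1 := ((tendsto_const_nhds (x := l + m)).sub (hxt.const_mul l)).sub (hzt.const_mul m)
    have e : l + m - l * xi - m * zi = 1 / ∫ w, c.len w ∂κ := by
      rw [hmean, hxi, hzi]
      have : 1 / m + 1 / l - 1 / (l + m) = d / (l * m * (l + m)) := by
        rw [hd]; field_simp; ring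
      rw [this]
      field_simp
      rw [hd]; ring
    rw [← e]
    exact h1
  · intro t ht
    rw [huint t ht]
    linarith [hN₁ t ht, hN₂ t ht, hN₃ t ht]

end CycleModel

/-! ### Sequences of independent variables with a common law -/

section Sequences

variable {α : Type*} [MeasurableSpace α] (ν : Measure α) [IsProbabilityMeasure ν]

/-- The law of a sequence of independent variables with law `ν`. -/
noncomputable def iidMeasure : Measure (ℕ → α) := Measure.infinitePi fun _ => ν

instance : IsProbabilityMeasure (iidMeasure ν) := by unfold iidMeasure; infer_instance

/-- The sequence `x, τ 0, τ 1, …`. -/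
def scons {α : Type*} (x : α) (τ : ℕ → α) : ℕ → α
  | 0 => x
  | n + 1 => τ n

theorem measurable_scons : Measurable fun p : α × (ℕ → α) => scons p.1 p.2 := by
  refine measurable_pi_iff.2 fun n => ?_
  cases n with
  | zero => exact measurable_fst
  | succ n => exact (measurable_pi_apply n).comp measurable_snd

theorem measurable_comp_scons {F : (ℕ → α) → ℝ≥0∞} (hF : Measurable F) :
    Measurable fun p : α × (ℕ → α) => F (scons p.1 p.2) := hF.comp measurable_scons

/-- Checked on cylinders. The finite index set is first enlarged to an initial segment, with trivial
conditions on the added indices, so that removing the first term merely shifts the segment. -/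
theorem map_scons : (ν.prod (iidMeasure ν)).map (fun p => scons p.1 p.2) = iidMeasure ν := by
  classical
  refine Measure.eq_infinitePi _ fun s t ht => ?_
  obtain ⟨n, hn⟩ := s.exists_nat_subset_range
  set t' : ℕ → Set α := fun i => if i ∈ s then t i else Set.univ with ht'
  have hmt' : ∀ i, MeasurableSet (t' i) := fun i => by
    simp only [ht']; split_ifs; exacts [ht i, MeasurableSet.univ]
  have hsub : s ⊆ Finset.range (n + 1) := hn.trans (Finset.range_subset_range.2 (Nat.le_succ n))
  have h1 : (s : Set ℕ).pi t = ((Finset.range (n + 1) : Finset ℕ) : Set ℕ).pi t' := by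
    ext x
    simp only [Set.mem_pi, Finset.mem_coe, ht']
    constructor
    · intro h i _
      split_ifs with hi
      exacts [h i hi, Set.mem_univ _]
    · intro h i hi
      have := h i (hsub hi)
      rwa [if_pos hi] at this
  have h2 : ∏ i ∈ s, ν (t i) = ∏ i ∈ Finset.range (n + 1), ν (t' i) := by
    rw [← Finset.prod_subset hsub (f := fun i => ν (t' i))]
    · exact Finset.prod_congr rfl fun i hi => by simp [ht', hi]
    · intro i _ hi
      simp [ht', hi]
  rw [h1, h2, Measure.map_apply measurable_scons
    (MeasurableSet.pi (Finset.countable_toSet _) fun i _ => hmt' i)]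
  have h3 : (fun p : α × (ℕ → α) => scons p.1 p.2) ⁻¹'
        ((Finset.range (n + 1) : Finset ℕ) : Set ℕ).pi t'
      = t' 0 ×ˢ ((Finset.range n : Finset ℕ) : Set ℕ).pi fun i => t' (i + 1) := by
    ext ⟨x, τ⟩
    simp only [Set.mem_preimage, Set.mem_pi, Finset.coe_range, Set.mem_Iio, Set.mem_prod]
    constructor
    · intro h
      exact ⟨h 0 (by omega), fun i hi => h (i + 1) (by omega)⟩
    · rintro ⟨h0, h⟩ i hi
      cases i with
      | zero => exact h0
      | succ i => exact h i (by omega)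
  rw [h3, Measure.prod_prod, iidMeasure, Measure.infinitePi_pi _ fun i _ => hmt' (i + 1),
    Finset.prod_range_succ', mul_comm]

theorem lintegral_iidMeasure_scons {F : (ℕ → α) → ℝ≥0∞} (hF : Measurable F) :
    ∫⁻ τ, F τ ∂iidMeasure ν = ∫⁻ x, ∫⁻ τ, F (scons x τ) ∂iidMeasure ν ∂ν := by
  conv_lhs => rw [← map_scons ν]
  rw [lintegral_map hF measurable_scons,
    lintegral_prod _ (measurable_comp_scons hF).aemeasurable]

theorem map_shift_iidMeasure (j : ℕ) :
    (iidMeasure ν).map (fun τ n => τ (n + j)) = iidMeasure ν :=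
  Measure.map_infinitePi_infinitePi_of_inj (P := fun _ : ℕ => ν) (add_left_injective j)

/-- The first term is independent of the terms of index at least `j + 1`. -/
theorem lintegral_iidMeasure_head_mul {F : α → ℝ≥0∞} (hF : Measurable F) {G : (ℕ → α) → ℝ≥0∞}
    (hG : Measurable G) (j : ℕ) :
    ∫⁻ τ, F (τ 0) * G (fun n => τ (n + (j + 1))) ∂iidMeasure ν
      = (∫⁻ x, F x ∂ν) * ∫⁻ τ, G τ ∂iidMeasure ν := by
  rw [lintegral_iidMeasure_scons ν (by fun_prop)]
  have h1 : ∀ x (τ : ℕ → α), F (scons x τ 0) * G (fun n => scons x τ (n + (j + 1)))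
      = F x * G (fun n => τ (n + j)) := fun x τ => rfl
  have hGj : Measurable fun τ : ℕ → α => G fun n => τ (n + j) := by fun_prop
  have h2 : ∫⁻ τ : ℕ → α, G (fun n => τ (n + j)) ∂iidMeasure ν = ∫⁻ τ, G τ ∂iidMeasure ν := by
    conv_rhs => rw [← map_shift_iidMeasure ν j, lintegral_map hG (by fun_prop)]
  simp_rw [h1, lintegral_const_mul _ hGj, h2]
  rw [lintegral_mul_const _ hF]

theorem map_eval_iidMeasure (n : ℕ) : (iidMeasure ν).map (fun τ => τ n) = ν :=
  Measure.infinitePi_map_eval (fun _ : ℕ => ν) n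

theorem ae_iidMeasure {p : α → Prop} (h : ∀ᵐ x ∂ν, p x) : ∀ᵐ τ ∂iidMeasure ν, ∀ n, p (τ n) := by
  refine ae_all_iff.2 fun n => ?_
  have : ∀ᵐ x ∂(iidMeasure ν).map (fun τ => τ n), p x := by rwa [map_eval_iidMeasure]
  exact ae_of_ae_map (measurable_pi_apply n).aemeasurable this

end Sequences

/-! ### Memorylessness and the splitting of a Poisson process -/

theorem lintegral_expMeasure_sub {r : ℝ} {v : ℝ} (hv : 0 ≤ v) {H : ℝ → ℝ≥0∞}
    (hH : Measurable H) :
    ∫⁻ x, (Set.Ioi v).indicator (fun x => H (x - v)) x ∂expMeasure r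
      = ENNReal.ofReal (Real.exp (-(r * v))) * ∫⁻ x, H x ∂expMeasure r := by
  rw [lintegral_expMeasure ((by fun_prop : Measurable fun x => H (x - v)).indicator
    measurableSet_Ioi), lintegral_expMeasure hH, ← lintegral_indicator measurableSet_Ioi,
    ← lintegral_indicator measurableSet_Ioi, ← lintegral_const_mul _ (Measurable.indicator (by fun_prop) measurableSet_Ioi)]
  rw [← lintegral_sub_right_eq_self (fun x => ENNReal.ofReal (Real.exp (-(r * v))) * _) v]
  refine lintegral_congr fun x => ?_
  by_cases hx : v < x
  · rw [Set.indicator_of_mem (Set.mem_Ioi.2 (hv.trans_lt hx)), Set.indicator_of_mem (Set.mem_Ioi.2 hx),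
      Set.indicator_of_mem (Set.mem_Ioi.2 (sub_pos.2 hx)), mul_left_comm,
      ← ENNReal.ofReal_mul (Real.exp_pos _).le]
    congr 2
    rw [mul_left_comm, ← Real.exp_add]
    congr 2; ring
  · rw [Set.indicator_of_notMem (s := Set.Ioi 0) (a := x - v) (by simpa using hx), mul_zero]
    by_cases hx0 : 0 < x
    · rw [Set.indicator_of_mem (Set.mem_Ioi.2 hx0), Set.indicator_of_notMem (by simpa using hx), zero_mul]
    · rw [Set.indicator_of_notMem (by simpa using hx0)]

theorem expMeasure_Iic_zero {r : ℝ} (hr : 0 < r) : expMeasure r (Set.Iic 0) = 0 := by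
  have : IsProbabilityMeasure (expMeasure r) := isProbabilityMeasure_expMeasure hr
  rw [← Set.compl_Ioi, prob_compl_eq_zero_iff measurableSet_Ioi, expMeasure_Ioi hr le_rfl]
  simp

theorem ae_expMeasure_pos {r : ℝ} (hr : 0 < r) : ∀ᵐ x ∂expMeasure r, 0 < x := by
  filter_upwards [measure_eq_zero_iff_ae_notMem.1 (expMeasure_Iic_zero hr)] with x hx
  simpa using hx

/-- The partial sums of a sequence. -/
def psum (τ : ℕ → ℝ) (k : ℕ) : ℝ := ∑ j ∈ Finset.range k, τ j

@[simp] theorem psum_zero (τ : ℕ → ℝ) : psum τ 0 = 0 := rfl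

theorem psum_succ (τ : ℕ → ℝ) (k : ℕ) : psum τ (k + 1) = psum τ k + τ k := Finset.sum_range_succ _ _

theorem psum_scons (x : ℝ) (τ : ℕ → ℝ) (k : ℕ) : psum (scons x τ) (k + 1) = x + psum τ k := by
  rw [psum, Finset.sum_range_succ', add_comm]; rfl

@[fun_prop]
theorem measurable_psum (k : ℕ) : Measurable fun τ => psum τ k := by unfold psum; fun_prop

theorem psum_nonneg {τ : ℕ → ℝ} (h : ∀ n, 0 < τ n) (k : ℕ) : 0 ≤ psum τ k :=
  Finset.sum_nonneg fun j _ => (h j).le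

theorem psum_strictMono {τ : ℕ → ℝ} (h : ∀ n, 0 < τ n) : StrictMono (psum τ) :=
  strictMono_nat_of_lt_succ fun n => by rw [psum_succ]; linarith [h n]

/-- The gaps that remain after time `v` if exactly `k` points have occurred by then. -/
def residual (k : ℕ) (v : ℝ) (τ : ℕ → ℝ) : ℕ → ℝ :=
  scons (psum τ (k + 1) - v) fun n => τ (n + (k + 1))

theorem psum_residual (k : ℕ) (v : ℝ) (τ : ℕ → ℝ) (n : ℕ) :
    psum (residual k v τ) (n + 1) = psum τ (n + (k + 1)) - v := by
  rw [residual, psum_scons]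
  induction n with
  | zero => simp
  | succ n ih =>
    rw [psum_succ _ n, show n + 1 + (k + 1) = n + (k + 1) + 1 by ring, psum_succ _ (n + (k + 1))]
    linarith

theorem residual_scons (k : ℕ) (v x : ℝ) (τ : ℕ → ℝ) :
    residual (k + 1) v (scons x τ) = residual k (v - x) τ := by
  funext n
  cases n with
  | zero => simp only [residual, scons, psum_scons]; ring
  | succ n => rfl

@[fun_prop]
theorem measurable_residual (k : ℕ) : Measurable fun p : ℝ × (ℕ → ℝ) => residual k p.1 p.2 := by
  unfold residual
  exact measurable_scons.comp (by fun_prop : Measurable fun p : ℝ × (ℕ → ℝ) =>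
    (psum p.2 (k + 1) - p.1, fun n => p.2 (n + (k + 1))))

/-- The sequences of gaps with exactly `k` points up to time `v`. -/
def exactly (k : ℕ) (v : ℝ) : Set (ℕ → ℝ) := {τ | psum τ k ≤ v ∧ v < psum τ (k + 1)}

theorem measurableSet_exactly (k : ℕ) (v : ℝ) : MeasurableSet (exactly k v) :=
  (measurableSet_le (measurable_psum k) measurable_const).inter
    (measurableSet_lt measurable_const (measurable_psum (k + 1)))

theorem scons_mem_exactly {k : ℕ} {v x : ℝ} {τ : ℕ → ℝ} :
    scons x τ ∈ exactly (k + 1) v ↔ τ ∈ exactly k (v - x) := by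
  simp only [exactly, Set.mem_ofPred_eq, psum_scons]
  constructor <;> rintro ⟨h1, h2⟩ <;> constructor <;> linarith

/-- Given that `k` points have occurred by time `v`, the gaps from then on are distributed as
initially, and independent of the time of the `k`-th point. -/
theorem lintegral_exactly_residual {r : ℝ} (hr : 0 < r) [IsProbabilityMeasure (expMeasure r)]
    {φ : (ℕ → ℝ) → ℝ≥0∞} (hφ : Measurable φ) (k : ℕ) :
    ∀ {g : ℝ → ℝ≥0∞}, Measurable g → ∀ v,
    ∫⁻ τ, (exactly k v).indicator (fun τ => g (psum τ k) * φ (residual k v τ)) τ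
        ∂iidMeasure (expMeasure r)
      = (∫⁻ τ, (exactly k v).indicator (fun τ => g (psum τ k)) τ ∂iidMeasure (expMeasure r))
        * ∫⁻ τ, φ τ ∂iidMeasure (expMeasure r) := by
  have hres : ∀ k v, Measurable (residual k v) := fun k v =>
    (measurable_residual k).comp measurable_prodMk_left
  have hm1 : ∀ (k : ℕ) {g : ℝ → ℝ≥0∞} (_ : Measurable g) (v : ℝ), Measurable
      ((exactly k v).indicator (fun τ => g (psum τ k) * φ (residual k v τ))) := fun k g hg v =>
    Measurable.indicator ((hg.comp (measurable_psum k)).mul (hφ.comp (hres k v)))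
      (measurableSet_exactly k v)
  have hm2 : ∀ (k : ℕ) {g : ℝ → ℝ≥0∞} (_ : Measurable g) (v : ℝ), Measurable
      ((exactly k v).indicator (fun τ => g (psum τ k))) := fun k g hg v =>
    Measurable.indicator (hg.comp (measurable_psum k)) (measurableSet_exactly k v)
  induction k with
  | zero =>
    intro g hg v
    rcases lt_or_ge v 0 with hv | hv
    · have : exactly 0 v = ∅ := by
        ext τ; simp [exactly, not_le.2 hv]
      simp [this]
    · have hφs : Measurable fun p : ℝ × (ℕ → ℝ) => φ (scons p.1 p.2) := measurable_comp_scons hφ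
      rw [lintegral_iidMeasure_scons _ (hm1 0 hg v), lintegral_iidMeasure_scons _ (hm2 0 hg v)]
      have e1 : ∀ x τ, (exactly 0 v).indicator (fun τ => g (psum τ 0) * φ (residual 0 v τ))
          (scons x τ) = (Set.Ioi v).indicator (fun x => g 0 * φ (scons (x - v) τ)) x := by
        intro x τ
        by_cases hx : v < x
        · rw [Set.indicator_of_mem (Set.mem_Ioi.2 hx), Set.indicator_of_mem
            (by simp [exactly, psum_scons, hv, hx])]
          simp [residual, psum_scons, scons]
        · rw [Set.indicator_of_notMem (s := Set.Ioi v) (by simpa using hx),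
            Set.indicator_of_notMem (by simp [exactly, psum_scons, hx])]
      have e2 : ∀ x τ, (exactly 0 v).indicator (fun τ => g (psum τ 0)) (scons x τ)
          = (Set.Ioi v).indicator (fun _ => g 0) x := by
        intro x τ
        by_cases hx : v < x
        · rw [Set.indicator_of_mem (Set.mem_Ioi.2 hx), Set.indicator_of_mem
            (by simp [exactly, psum_scons, hv, hx])]
          simp
        · rw [Set.indicator_of_notMem (s := Set.Ioi v) (by simpa using hx),
            Set.indicator_of_notMem (by simp [exactly, psum_scons, hx])]
      simp_rw [e1, e2]
      have e3 : ∀ x, ∫⁻ τ, (Set.Ioi v).indicator (fun x => g 0 * φ (scons (x - v) τ)) x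
            ∂iidMeasure (expMeasure r)
          = (Set.Ioi v).indicator (fun x => (fun y => g 0 * ∫⁻ τ, φ (scons y τ)
            ∂iidMeasure (expMeasure r)) (x - v)) x := by
        intro x
        by_cases hx : x ∈ Set.Ioi v
        · simp only [Set.indicator_of_mem hx]
          exact lintegral_const_mul _ (hφs.comp measurable_prodMk_left)
        · simp [Set.indicator_of_notMem hx]
      simp_rw [e3]
      -- With no point by time v, only the first gap is affected, and it loses v by memorylessness.
      have hmy : Measurable fun y => ∫⁻ τ, φ (scons y τ) ∂iidMeasure (expMeasure r) :=
        hφs.lintegral_prod_right'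
      rw [lintegral_expMeasure_sub hv (hmy.const_mul _), lintegral_const_mul _ hmy,
        ← lintegral_iidMeasure_scons _ hφ]
      simp only [lintegral_const, measure_univ, mul_one]
      rw [lintegral_indicator measurableSet_Ioi, setLIntegral_const, expMeasure_Ioi hr hv]
      ring
  | succ k ih =>
    intro g hg v
    rw [lintegral_iidMeasure_scons _ (hm1 _ hg v), lintegral_iidMeasure_scons _ (hm2 _ hg v),
      ← lintegral_mul_const _ (measurable_comp_scons (hm2 (k + 1) hg v)).lintegral_prod_right']
    -- Given the first gap x, having k + 1 points by v means k points of the remaining sequence by v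
    -- - x. Both g and v change, hence the induction is uniform in them.
    refine lintegral_congr fun x => ?_
    have hgx : Measurable fun y => g (x + y) := by fun_prop
    convert ih hgx (v - x) using 2
    · funext τ
      by_cases h : scons x τ ∈ exactly (k + 1) v
      · rw [Set.indicator_of_mem h, Set.indicator_of_mem (scons_mem_exactly.1 h), psum_scons,
          residual_scons]
      · rw [Set.indicator_of_notMem h, Set.indicator_of_notMem (mt scons_mem_exactly.2 h)]
    · refine lintegral_congr fun τ => ?_
      by_cases h : scons x τ ∈ exactly (k + 1) v
      · rw [Set.indicator_of_mem h, Set.indicator_of_mem (scons_mem_exactly.1 h), psum_scons]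
      · rw [Set.indicator_of_notMem h, Set.indicator_of_notMem (mt scons_mem_exactly.2 h)]

/-! ### Regenerative sequences -/

/-- The intersections A ∩ B form a π-system generating the join, and P(A ∩ B ∩ C) = P(A) P(B ∩ C) =
P(A) P(B) P(C) = P(A ∩ B) P(C). It serves to append a new mark to the past while keeping
independence from the future. -/
theorem indep_sup_left {Ω : Type*} {mΩ : MeasurableSpace Ω} {P : Measure Ω}
    [IsProbabilityMeasure P] {m₁ m₂ m₃ m : MeasurableSpace Ω} (h₁ : m₁ ≤ mΩ) (hm : m ≤ mΩ)
    (h₂ : m₂ ≤ m) (h₃ : m₃ ≤ m) (h : Indep m₁ m P) (h' : Indep m₂ m₃ P) :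
    Indep (m₁ ⊔ m₂) m₃ P := by
  set p : Set (Set Ω) := {s | ∃ A B, MeasurableSet[m₁] A ∧ MeasurableSet[m₂] B ∧ s = A ∩ B} with hp
  have hgen : m₁ ⊔ m₂ = MeasurableSpace.generateFrom p := by
    refine le_antisymm (sup_le ?_ ?_) (MeasurableSpace.generateFrom_le ?_)
    · intro A hA
      exact MeasurableSpace.measurableSet_generateFrom
        ⟨A, Set.univ, hA, MeasurableSet.univ, (Set.inter_univ A).symm⟩
    · intro B hB
      exact MeasurableSpace.measurableSet_generateFrom
        ⟨Set.univ, B, MeasurableSet.univ, hB, (Set.univ_inter B).symm⟩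
    · rintro _ ⟨A, B, hA, hB, rfl⟩
      have hA' : MeasurableSet[m₁ ⊔ m₂] A := (le_sup_left : m₁ ≤ m₁ ⊔ m₂) A hA
      have hB' : MeasurableSet[m₁ ⊔ m₂] B := (le_sup_right : m₂ ≤ m₁ ⊔ m₂) B hB
      exact hA'.inter hB'
  refine IndepSets.indep (p1 := p) (p2 := {s | MeasurableSet[m₃] s}) (sup_le h₁ (h₂.trans hm))
    (h₃.trans hm) ?_ (@MeasurableSpace.isPiSystem_measurableSet Ω m₃) hgen
    (@MeasurableSpace.generateFrom_measurableSet Ω m₃).symm ?_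
  · rintro _ ⟨A, B, hA, hB, rfl⟩ _ ⟨A', B', hA', hB', rfl⟩ _
    exact ⟨A ∩ A', B ∩ B', hA.inter hA', hB.inter hB', Set.inter_inter_inter_comm _ _ _ _⟩
  · rw [IndepSets_iff]
    rintro _ C ⟨A, B, hA, hB, rfl⟩ hC
    have hC' : MeasurableSet[m₃] C := hC
    rw [Indep_iff] at h h'
    have hBC : MeasurableSet[m] (B ∩ C) := (h₂ B hB).inter (h₃ C hC')
    rw [Set.inter_assoc, h A (B ∩ C) hA hBC, h' B C hB hC', h A B hA (h₂ B hB), mul_assoc]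

section Regenerative

variable {Ω 𝒲 E : Type*} [mΩ : MeasurableSpace Ω] [m𝒲 : MeasurableSpace 𝒲] [mE : MeasurableSpace E]
  {P : Measure Ω} [IsProbabilityMeasure P] {κ : Measure 𝒲} [IsProbabilityMeasure κ]
  {Q : Measure E} [IsProbabilityMeasure Q] {w : E → 𝒲} {T : E → E}

/-- The past of a sequence of variables. -/
@[reducible] def pastAlgebra (s₀ : Ω → ℝ) (W : ℕ → Ω → 𝒲) : ℕ → MeasurableSpace Ω
  | 0 => MeasurableSpace.comap s₀ inferInstance
  | m + 1 => pastAlgebra s₀ W m ⊔ MeasurableSpace.comap (W m) m𝒲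

/-- The state after m steps has law Q and is independent of the past. Applying `hsplit` to this
state separates its mark from the next state, which again has law Q, and the mark joins the past. -/
theorem indep_pastAlgebra (hw : Measurable w) (hT : Measurable T)
    (hsplit : Q.map (fun x => (w x, T x)) = κ.prod Q) {X : Ω → E} (hX : Measurable X)
    (hXQ : P.map X = Q) {s₀ : Ω → ℝ} (hs₀ : Measurable s₀) (hind : IndepFun s₀ X P) (m : ℕ) :
    pastAlgebra s₀ (fun n ω => w (T^[n] (X ω))) m ≤ mΩ ∧
    Indep (pastAlgebra s₀ (fun n ω => w (T^[n] (X ω))) m)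
      (MeasurableSpace.comap (fun ω => T^[m] (X ω)) mE) P ∧
    P.map (fun ω => T^[m] (X ω)) = Q := by
  induction m with
  | zero =>
    refine ⟨hs₀.comap_le, ?_, hXQ⟩
    exact (IndepFun_iff_Indep _ _ _).1 hind
  | succ m ih =>
    obtain ⟨ih0, ih1, ih2⟩ := ih
    have hTm : Measurable fun ω => T^[m] (X ω) := (hT.iterate m).comp hX
    have hWm : Measurable fun ω => w (T^[m] (X ω)) := hw.comp hTm
    have hstep : ∀ ω, T^[m + 1] (X ω) = T (T^[m] (X ω)) := fun ω =>
      Function.iterate_succ_apply' T m (X ω)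
    simp_rw [hstep]
    have hTT : Measurable fun ω => T (T^[m] (X ω)) := hT.comp hTm
    have hjoint : P.map (fun ω => (w (T^[m] (X ω)), T (T^[m] (X ω)))) = κ.prod Q := by
      rw [← hsplit, ← ih2, Measure.map_map (hw.prodMk hT) hTm]
      rfl
    have hl1 : P.map (fun ω => w (T^[m] (X ω))) = κ := by
      have := congrArg (Measure.map Prod.fst) hjoint
      rw [Measure.map_map measurable_fst (hWm.prodMk hTT)] at this
      simpa [Function.comp_def, Measure.map_fst_prod] using this
    have hl2 : P.map (fun ω => T (T^[m] (X ω))) = Q := by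
      have := congrArg (Measure.map Prod.snd) hjoint
      rw [Measure.map_map measurable_snd (hWm.prodMk hTT)] at this
      simpa [Function.comp_def, Measure.map_snd_prod] using this
    have hi : IndepFun (fun ω => w (T^[m] (X ω))) (fun ω => T (T^[m] (X ω))) P := by
      rw [indepFun_iff_map_prod_eq_prod_map_map hWm.aemeasurable hTT.aemeasurable, hjoint, hl1, hl2]
    refine ⟨sup_le ih0 hWm.comap_le, ?_, hl2⟩
    refine indep_sup_left ih0 hTm.comap_le ?_ ?_ ih1 ((IndepFun_iff_Indep _ _ _).1 hi)
    · exact (hw.comp (comap_measurable fun ω => T^[m] (X ω))).comap_le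
    · exact (hT.comp (comap_measurable fun ω => T^[m] (X ω))).comap_le

theorem map_regenerative (hw : Measurable w)
    (hT : Measurable T) (hsplit : Q.map (fun x => (w x, T x)) = κ.prod Q) : Q.map w = κ := by
  have := congrArg (Measure.map Prod.fst) hsplit
  rw [Measure.map_map measurable_fst (hw.prodMk hT)] at this
  simpa [Function.comp_def, Measure.map_fst_prod] using this

theorem isCycleInput_regenerative (hw : Measurable w) (hT : Measurable T)
    (hsplit : Q.map (fun x => (w x, T x)) = κ.prod Q) {X : Ω → E} (hX : Measurable X)
    (hXQ : P.map X = Q) {s₀ : Ω → ℝ} (hs₀ : Measurable s₀) (hind : IndepFun s₀ X P) :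
    IsCycleInput P κ (pastAlgebra s₀ (fun n ω => w (T^[n] (X ω)))) s₀
      (fun n ω => w (T^[n] (X ω))) where
  le m := (indep_pastAlgebra hw hT hsplit hX hXQ hs₀ hind m).1
  mono m := le_sup_left
  measurable_s₀ := comap_measurable s₀
  measurable_W m := (comap_measurable _).mono le_sup_right le_rfl
  indep m := by
    refine indep_of_indep_of_le_right (indep_pastAlgebra hw hT hsplit hX hXQ hs₀ hind m).2.1 ?_
    exact (hw.comp (comap_measurable fun ω => T^[m] (X ω))).comap_le
  map_eq m := by
    rw [← map_regenerative hw hT hsplit,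
      ← (indep_pastAlgebra hw hT hsplit hX hXQ hs₀ hind m).2.2,
      Measure.map_map hw (by exact (hT.iterate m).comp hX)]
    rfl

/-- The observations along the orbit of a regenerative map are independent. -/
theorem map_orbit_regenerative (hw : Measurable w) (hT : Measurable T)
    (hsplit : Q.map (fun x => (w x, T x)) = κ.prod Q) :
    Q.map (fun x n => w (T^[n] x)) = iidMeasure κ := by
  have hmeas : Measurable fun x n => w (T^[n] x) :=
    measurable_pi_iff.2 fun n => hw.comp (hT.iterate n)
  refine Measure.eq_infinitePi _ fun s t ht => ?_
  classical
  have hpi : ∀ (n : ℕ) (t : ℕ → Set 𝒲), (∀ i, MeasurableSet (t i)) →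
      Q {x | ∀ i < n, w (T^[i] x) ∈ t i} = ∏ i ∈ Finset.range n, κ (t i) := by
    intro n
    induction n with
    | zero => intro t _; simp
    | succ n ih =>
      intro t ht
      have hset : {x | ∀ i < n + 1, w (T^[i] x) ∈ t i}
          = (fun x => (w x, T x)) ⁻¹' (t 0 ×ˢ {x | ∀ i < n, w (T^[i] x) ∈ t (i + 1)}) := by
        ext x
        simp only [Set.mem_ofPred_eq, Set.mem_preimage, Set.mem_prod]
        constructor
        · intro h
          exact ⟨h 0 (by omega), fun i hi => by
            have := h (i + 1) (by omega); rwa [Function.iterate_succ_apply] at this⟩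
        · rintro ⟨h0, h⟩ i hi
          cases i with
          | zero => exact h0
          | succ i => rw [Function.iterate_succ_apply]; exact h i (by omega)
      have hms : MeasurableSet {x | ∀ i < n, w (T^[i] x) ∈ t (i + 1)} := by
        have : {x | ∀ i < n, w (T^[i] x) ∈ t (i + 1)}
            = ⋂ i ∈ Finset.range n, (fun x => w (T^[i] x)) ⁻¹' t (i + 1) := by
          ext x; simp
        rw [this]
        exact Finset.measurableSet_biInter _ fun i _ => (hw.comp (hT.iterate i)) (ht (i + 1))
      rw [hset, ← Measure.map_apply (hw.prodMk hT) ((ht 0).prod hms), hsplit, Measure.prod_prod,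
        ih _ fun i => ht (i + 1), Finset.prod_range_succ', mul_comm]
  obtain ⟨n, hn⟩ := s.exists_nat_subset_range
  rw [Measure.map_apply hmeas (MeasurableSet.pi (Finset.countable_toSet _) fun i _ => ht i)]
  have h1 := hpi n (fun i => if i ∈ s then t i else Set.univ) fun i => by
    split_ifs; exacts [ht i, MeasurableSet.univ]
  have h2 : (fun x n => w (T^[n] x)) ⁻¹' (s : Set ℕ).pi t
      = {x | ∀ i < n, w (T^[i] x) ∈ if i ∈ s then t i else Set.univ} := by
    ext x
    simp only [Set.mem_preimage, Set.mem_pi, Finset.mem_coe, Set.mem_ofPred_eq]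
    constructor
    · intro h i _
      split_ifs with hi
      exacts [h i hi, Set.mem_univ _]
    · intro h i hi
      have := h i (Finset.mem_range.1 (hn hi))
      rwa [if_pos hi] at this
  rw [h2, h1, ← Finset.prod_subset hn]
  · exact Finset.prod_congr rfl fun i hi => by simp [hi]
  · intro i _ hi
    simp [hi]

end Regenerative

/-! ### Counting points -/

section Counting

theorem measurable_nat_sInf {α : Type*} [MeasurableSpace α] {p : ℕ → α → Prop}
    (hp : ∀ k, MeasurableSet {x | p k x}) : Measurable fun x => sInf {k | p k x} := by
  have hle : ∀ n, MeasurableSet {x | sInf {k | p k x} ≤ n} := by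
    intro n
    -- The infimum of the empty set of naturals is 0, so the points where no `p k` holds belong to
    -- every such set.
    have : {x | sInf {k | p k x} ≤ n} = (⋃ k ∈ Finset.range (n + 1), {x | p k x}) ∪
        ⋂ k, {x | p k x}ᶜ := by
      ext x
      simp only [Set.mem_ofPred_eq, Set.mem_union, Set.mem_iUnion, Finset.mem_range, Set.mem_iInter,
        Set.mem_compl_iff, exists_prop]
      constructor
      · intro h
        by_cases hne : ∃ k, p k x
        · exact Or.inl ⟨_, Nat.lt_succ_of_le h, Nat.sInf_mem (s := {k | p k x}) hne⟩
        · exact Or.inr fun k hk => hne ⟨k, hk⟩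
      · rintro (⟨k, hk, hpk⟩ | h)
        · exact (Nat.sInf_le (s := {k | p k x}) hpk).trans (Nat.lt_succ_iff.1 hk)
        · have : {k | p k x} = ∅ := by ext k; simp [h k]
          simp [this]
    rw [this]
    exact (Finset.measurableSet_biUnion _ fun k _ => hp k).union
      (MeasurableSet.iInter fun k => (hp k).compl)
  exact measurable_of_Iic fun n => hle n

/-- The number of points up to time `v`. -/
noncomputable def npts (v : ℝ) (τ : ℕ → ℝ) : ℕ := sInf {k | v < psum τ (k + 1)}

theorem measurable_npts : Measurable fun p : ℝ × (ℕ → ℝ) => npts p.1 p.2 :=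
  measurable_nat_sInf fun k => measurableSet_lt measurable_fst ((measurable_psum (k + 1)).comp measurable_snd)

/-- Sequences of gaps with finitely many points in bounded time. -/
def IsProper (τ : ℕ → ℝ) : Prop := (∀ n, 0 < τ n) ∧ Tendsto (psum τ) atTop atTop

theorem IsProper.npts_eq_iff {τ : ℕ → ℝ} (h : IsProper τ) {v : ℝ} (hv : 0 ≤ v) {k : ℕ} :
    npts v τ = k ↔ τ ∈ exactly k v := by
  have hmono := (psum_strictMono h.1).monotone
  have hne : {k | v < psum τ (k + 1)}.Nonempty := by
    obtain ⟨k, hk⟩ := ((h.2.comp (tendsto_add_atTop_nat 1)).eventually_gt_atTop v).exists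
    exact ⟨k, hk⟩
  have hmem : τ ∈ exactly (npts v τ) v := by
    refine ⟨?_, Nat.sInf_mem hne⟩
    by_contra hcon
    rcases Nat.eq_zero_or_pos (npts v τ) with h0 | h0
    · rw [h0, psum_zero] at hcon; exact hcon hv
    · obtain ⟨m, hm⟩ := Nat.exists_eq_succ_of_ne_zero h0.ne'
      have : npts v τ ≤ m := Nat.sInf_le (by
        rw [hm] at hcon
        exact not_le.1 hcon)
      omega
  constructor
  · rintro rfl; exact hmem
  · intro hk
    by_contra hne'
    rcases lt_or_gt_of_ne hne' with hlt | hlt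
    · have := hmono (show npts v τ + 1 ≤ k by omega)
      exact absurd (hmem.2.trans_le this) (not_lt.2 hk.1)
    · have := hmono (show k + 1 ≤ npts v τ by omega)
      exact absurd (hk.2.trans_le this) (not_lt.2 hmem.1)

theorem IsProper.mem_exactly {τ : ℕ → ℝ} (h : IsProper τ) {v : ℝ} (hv : 0 ≤ v) :
    τ ∈ exactly (npts v τ) v := (h.npts_eq_iff hv).1 rfl

theorem lintegral_pow_expMeasure {r : ℝ} (hr : 0 < r) (n : ℕ) :
    ∫⁻ x, ENNReal.ofReal (x ^ n) ∂expMeasure r = ENNReal.ofReal (n.factorial / r ^ n) := by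
  rw [lintegral_expMeasure (by fun_prop)]
  have h0 := Real.integral_rpow_mul_exp_neg_mul_Ioi (a := n + 1) (r := r) (by positivity) hr
  have h1 : ∫ t in Set.Ioi (0 : ℝ), t ^ n * (r * Real.exp (-(r * t))) = n.factorial / r ^ n := by
    have : ∀ t : ℝ, t ^ n * (r * Real.exp (-(r * t)))
        = r * (t ^ ((n : ℝ) + 1 - 1) * Real.exp (-(r * t))) := by
      intro t
      rw [add_sub_cancel_right, Real.rpow_natCast]; ring
    simp_rw [this]
    rw [integral_const_mul, h0, Real.Gamma_nat_eq_factorial,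
      show ((n : ℝ) + 1) = ((n + 1 : ℕ) : ℝ) by push_cast; ring, Real.rpow_natCast,
      one_div, inv_pow, pow_succ]
    field_simp
  -- The integral of a function that is not integrable is 0 by convention, so the nonzero value just
  -- computed certifies integrability.
  have h2 : IntegrableOn (fun t : ℝ => t ^ n * (r * Real.exp (-(r * t)))) (Set.Ioi 0) := by
    refine Integrable.of_integral_ne_zero ?_
    rw [h1]; positivity
  rw [← h1, ofReal_integral_eq_lintegral_ofReal h2]
  · refine setLIntegral_congr_fun measurableSet_Ioi fun x hx => ?_
    have hx' : (0 : ℝ) < x := hx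
    exact (ENNReal.ofReal_mul (by positivity)).symm
  · filter_upwards [ae_restrict_mem measurableSet_Ioi] with x hx
    have hx' : (0 : ℝ) < x := hx
    exact mul_nonneg (by positivity) (by positivity)

theorem integrable_pow_expMeasure {r : ℝ} (hr : 0 < r) (n : ℕ) :
    Integrable (fun x : ℝ => x ^ n) (expMeasure r) := by
  refine ⟨by fun_prop, ?_⟩
  rw [hasFiniteIntegral_iff_ofReal, lintegral_pow_expMeasure hr]
  · exact ENNReal.ofReal_lt_top
  · filter_upwards [ae_expMeasure_pos hr] with x hx
    exact pow_nonneg hx.le n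

theorem integral_pow_expMeasure {r : ℝ} (hr : 0 < r) (n : ℕ) :
    ∫ x, x ^ n ∂expMeasure r = n.factorial / r ^ n := by
  rw [integral_eq_lintegral_of_nonneg_ae _ (by fun_prop), lintegral_pow_expMeasure hr,
    ENNReal.toReal_ofReal (by positivity)]
  filter_upwards [ae_expMeasure_pos hr] with x hx
  exact pow_nonneg hx.le n

theorem ae_isProper {r : ℝ} (hr : 0 < r) [IsProbabilityMeasure (expMeasure r)] :
    ∀ᵐ τ ∂iidMeasure (expMeasure r), IsProper τ := by
  have hind : iIndepFun (fun (n : ℕ) (τ : ℕ → ℝ) => τ n) (iidMeasure (expMeasure r)) :=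
    iIndepFun_infinitePi (P := fun _ : ℕ => expMeasure r) (X := fun _ x => x) fun _ => measurable_id
  have hi : Integrable (fun x : ℝ => x) (expMeasure r) := by
    simpa using integrable_pow_expMeasure hr 1
  have hpos : 0 < ∫ x, x ∂expMeasure r := by
    have := integral_pow_expMeasure hr 1
    simp only [pow_one, Nat.factorial_one, Nat.cast_one] at this
    rw [this]; positivity
  have heval : ∀ n, AEMeasurable (fun τ : ℕ → ℝ => τ n) (iidMeasure (expMeasure r)) := fun n =>
    (measurable_pi_apply n).aemeasurable
  have hmap : ∀ n, (iidMeasure (expMeasure r)).map (fun τ => τ n) = expMeasure r :=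
    map_eval_iidMeasure _
  have hfint : Integrable (fun τ : ℕ → ℝ => τ 0) (iidMeasure (expMeasure r)) := by
    rw [← hmap 0] at hi
    exact (integrable_map_measure (by fun_prop) (heval 0)).1 hi
  have hmean : ∫ τ : ℕ → ℝ, τ 0 ∂iidMeasure (expMeasure r) = ∫ x, x ∂expMeasure r := by
    conv_rhs => rw [← hmap 0]
    rw [integral_map (heval 0) (by fun_prop)]
  have hlln := strong_law_ae_real (μ := iidMeasure (expMeasure r)) (fun n τ => τ n) hfint
    (fun i j hij => hind.indepFun hij)
    (fun i => ⟨heval i, heval 0, by rw [hmap, hmap]⟩)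
  filter_upwards [hlln, ae_iidMeasure _ (ae_expMeasure_pos hr)] with τ h1 h2
  refine ⟨h2, ?_⟩
  rw [hmean] at h1
  have h3 := h1.pos_mul_atTop hpos (tendsto_natCast_atTop_atTop (R := ℝ))
  refine h3.congr' ?_
  filter_upwards [eventually_gt_atTop 0] with n hn
  have : (n : ℝ) ≠ 0 := by exact_mod_cast hn.ne'
  rw [psum]
  field_simp

end Counting

theorem iidMeasure_exactly_of_neg {r : ℝ} (hr : 0 < r) [IsProbabilityMeasure (expMeasure r)] (k : ℕ)
    {v : ℝ} (hv : v < 0) : iidMeasure (expMeasure r) (exactly k v) = 0 := by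
  rw [measure_eq_zero_iff_ae_notMem]
  filter_upwards [ae_iidMeasure _ (ae_expMeasure_pos hr)] with τ hτ h
  exact absurd (h.1.trans_lt hv) (not_lt.2 (psum_nonneg hτ k))

theorem lintegral_sub_pow {v : ℝ} (hv : 0 ≤ v) (k : ℕ) :
    ∫⁻ x in Set.Ioc 0 v, ENNReal.ofReal ((v - x) ^ k) = ENNReal.ofReal (v ^ (k + 1) / (k + 1)) := by
  rw [← ofReal_integral_eq_lintegral_ofReal (Continuous.integrableOn_Ioc (by fun_prop)),
    ← intervalIntegral.integral_of_le hv]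
  · congr 1
    rw [intervalIntegral.integral_comp_sub_left (fun x => x ^ k) v]
    simp
  · filter_upwards [ae_restrict_mem measurableSet_Ioc] with x hx
    exact pow_nonneg (sub_nonneg.2 hx.2) k

/-- The number of points up to time `v` has a Poisson distribution. -/
theorem iidMeasure_exactly {r : ℝ} (hr : 0 < r) [IsProbabilityMeasure (expMeasure r)] (k : ℕ) :
    ∀ v, 0 ≤ v → iidMeasure (expMeasure r) (exactly k v)
      = ENNReal.ofReal (Real.exp (-(r * v)) * ((r * v) ^ k / k.factorial)) := by
  have hcons : ∀ k v, iidMeasure (expMeasure r) (exactly (k + 1) v)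
      = ∫⁻ x, iidMeasure (expMeasure r) (exactly k (v - x)) ∂expMeasure r := by
    intro k v
    rw [← lintegral_indicator_one (measurableSet_exactly (k + 1) v), lintegral_iidMeasure_scons _
      (measurable_one.indicator (measurableSet_exactly _ _))]
    refine lintegral_congr fun x => ?_
    rw [← lintegral_indicator_one (measurableSet_exactly k _)]
    refine lintegral_congr fun τ => ?_
    by_cases h : scons x τ ∈ exactly (k + 1) v
    · rw [Set.indicator_of_mem h, Set.indicator_of_mem (scons_mem_exactly.1 h)]; rfl
    · rw [Set.indicator_of_notMem h, Set.indicator_of_notMem (mt scons_mem_exactly.2 h)]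
  induction k with
  | zero =>
    intro v hv
    rw [← lintegral_indicator_one (measurableSet_exactly 0 v), lintegral_iidMeasure_scons _
      (measurable_one.indicator (measurableSet_exactly _ _))]
    have : ∀ x τ, (exactly 0 v).indicator 1 (scons x τ) = (Set.Ioi v).indicator (1 : ℝ → ℝ≥0∞) x := by
      intro x τ
      by_cases hx : v < x
      · rw [Set.indicator_of_mem (Set.mem_Ioi.2 hx), Set.indicator_of_mem
          (by simp [exactly, psum_scons, hv, hx])]
        rfl
      · rw [Set.indicator_of_notMem (s := Set.Ioi v) (by simpa using hx),
          Set.indicator_of_notMem (by simp [exactly, psum_scons, hx])]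
    simp_rw [this]
    simp only [lintegral_const, measure_univ, mul_one]
    rw [lintegral_indicator_one measurableSet_Ioi, expMeasure_Ioi hr hv]
    simp
  | succ k ih =>
    intro v hv
    have hmeas : Measurable fun x => iidMeasure (expMeasure r) (exactly k (v - x)) := by
      have : MeasurableSet {p : ℝ × (ℕ → ℝ) | psum p.2 k ≤ v - p.1 ∧ v - p.1 < psum p.2 (k + 1)} :=
        (measurableSet_le ((measurable_psum k).comp measurable_snd)
          (measurable_const.sub measurable_fst)).inter
          (measurableSet_lt (measurable_const.sub measurable_fst)
            ((measurable_psum (k + 1)).comp measurable_snd))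
      exact measurable_measure_prodMk_left this
    rw [hcons, lintegral_expMeasure hmeas]
    have h1 : ∫⁻ x in Set.Ioi 0, iidMeasure (expMeasure r) (exactly k (v - x))
          * ENNReal.ofReal (r * Real.exp (-(r * x)))
        = ∫⁻ x in Set.Ioc 0 v, ENNReal.ofReal (Real.exp (-(r * v)) * (r ^ (k + 1) / k.factorial))
          * ENNReal.ofReal ((v - x) ^ k) := by
      rw [← lintegral_indicator measurableSet_Ioi, ← lintegral_indicator measurableSet_Ioc]
      refine lintegral_congr fun x => ?_
      by_cases hx0 : 0 < x
      · rw [Set.indicator_of_mem (Set.mem_Ioi.2 hx0)]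
        by_cases hxv : x ≤ v
        · rw [Set.indicator_of_mem (Set.mem_Ioc.2 ⟨hx0, hxv⟩), ih _ (sub_nonneg.2 hxv),
            ← ENNReal.ofReal_mul (by positivity), ← ENNReal.ofReal_mul]
          · congr 1
            have : Real.exp (-(r * v)) = Real.exp (-(r * (v - x))) * Real.exp (-(r * x)) := by
              rw [← Real.exp_add]; congr 1; ring
            rw [this, mul_pow, pow_succ]; ring
          · have := sub_nonneg.2 hxv
            positivity
        · rw [Set.indicator_of_notMem (fun h => hxv h.2),
            iidMeasure_exactly_of_neg hr k (by linarith), zero_mul]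
      · rw [Set.indicator_of_notMem (by simpa using hx0), Set.indicator_of_notMem fun h => hx0 h.1]
    rw [h1, lintegral_const_mul _ (by fun_prop), lintegral_sub_pow hv,
      ← ENNReal.ofReal_mul (by positivity)]
    congr 1
    rw [mul_pow, Nat.factorial_succ]
    push_cast
    field_simp

/-! ### Multinomial counts of i.i.d. sources. -/

section Sources

variable {N : ℕ}

/-- The number of terms of value `i` among the first `k` terms of `σ`. -/
def tally (k : ℕ) (σ : ℕ → Fin N) (i : Fin N) : ℕ := ((Finset.range k).filter fun n => σ n = i).card

theorem tally_scons (k : ℕ) (i : Fin N) (σ : ℕ → Fin N) :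
    tally (k + 1) (scons i σ) = tally k σ + Pi.single i 1 := by
  funext j
  simp only [tally, Pi.add_apply, Finset.card_filter]
  rw [Finset.sum_range_succ']
  congr 1
  simp only [scons, Pi.single_apply]
  exact if_congr eq_comm rfl rfl

theorem measurable_tally (k : ℕ) : Measurable fun σ : ℕ → Fin N => tally k σ := by
  refine measurable_pi_iff.2 fun i => ?_
  simp only [tally, Finset.card_filter]
  refine Finset.measurable_sum _ fun n _ => ?_
  exact Measurable.ite (measurableSet_eq_fun (measurable_pi_apply n) measurable_const)
    measurable_const
    measurable_const

/-- The product of the `p i ^ n i / (n i)!`. -/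
noncomputable def multiWeight (p : Fin N → ℝ) (n : Fin N → ℕ) : ℝ :=
  ∏ i, p i ^ n i / (n i).factorial

/-- This is the effect of conditioning on the first source being i. Summed over i the factors n i
add up to the number of draws, which gives the recursion of the multinomial weights. -/
theorem multiWeight_update (p : Fin N → ℝ) (n : Fin N → ℕ) (i : Fin N) (h : 0 < n i) :
    p i * multiWeight p (Function.update n i (n i - 1)) = n i * multiWeight p n := by
  rw [multiWeight, multiWeight, ← Finset.mul_prod_erase Finset.univ _ (Finset.mem_univ i),
    ← Finset.mul_prod_erase Finset.univ (fun i => p i ^ n i / (n i).factorial) (Finset.mem_univ i)]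
  have : ∏ x ∈ Finset.univ.erase i, p x ^ Function.update n i (n i - 1) x
        / (Function.update n i (n i - 1) x).factorial
      = ∏ x ∈ Finset.univ.erase i, p x ^ n x / (n x).factorial := by
    refine Finset.prod_congr rfl fun j hj => ?_
    rw [Function.update_of_ne (Finset.ne_of_mem_erase hj)]
  rw [this, Function.update_self]
  obtain ⟨m, hm⟩ := Nat.exists_eq_succ_of_ne_zero h.ne'
  rw [hm, Nat.succ_eq_add_one, Nat.add_sub_cancel, Nat.factorial_succ]
  push_cast
  field_simp
  ring

/-- The law of the sources: source `i` with probability `p i`. -/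
noncomputable def srcMeasure (p : Fin N → ℝ) : Measure (Fin N) :=
  ∑ i, ENNReal.ofReal (p i) • Measure.dirac i

theorem isProbabilityMeasure_srcMeasure {p : Fin N → ℝ} (hp : ∀ i, 0 ≤ p i) (h1 : ∑ i, p i = 1) :
    IsProbabilityMeasure (srcMeasure p) := by
  refine ⟨?_⟩
  rw [srcMeasure, Measure.finsetSum_apply]
  simp [← ENNReal.ofReal_sum_of_nonneg fun i _ => hp i, h1]

theorem lintegral_srcMeasure (p : Fin N → ℝ) (f : Fin N → ℝ≥0∞) :
    ∫⁻ i, f i ∂srcMeasure p = ∑ i, ENNReal.ofReal (p i) * f i := by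
  rw [srcMeasure, lintegral_finsetSum_measure]
  simp

/-- The tally of the first `k` sources has a multinomial distribution, and is independent of the
later sources. -/
theorem lintegral_tally {p : Fin N → ℝ} (hp : ∀ i, 0 ≤ p i) [IsProbabilityMeasure (srcMeasure p)]
    {φ : (ℕ → Fin N) → ℝ≥0∞} (hφ : Measurable φ) (k : ℕ) :
    ∀ n : Fin N → ℕ, ∫⁻ σ, {σ | tally k σ = n}.indicator (fun σ => φ fun j => σ (j + k)) σ
        ∂iidMeasure (srcMeasure p)
      = ENNReal.ofReal (if ∑ i, n i = k then k.factorial * multiWeight p n else 0)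
        * ∫⁻ σ, φ σ ∂iidMeasure (srcMeasure p) := by
  have hw : ∀ n, 0 ≤ multiWeight p n := fun n =>
    Finset.prod_nonneg fun i _ => div_nonneg (pow_nonneg (hp i) _) (by positivity)
  induction k with
  | zero =>
    intro n
    have h0 : ∀ σ : ℕ → Fin N, tally 0 σ = 0 := fun σ => by funext i; simp [tally]
    by_cases hn : n = 0
    · subst hn
      simp [h0, multiWeight]
    · have h1 : ∑ i, n i ≠ 0 := fun h => hn (funext fun i => by
        simpa using Finset.sum_eq_zero_iff.1 h i (Finset.mem_univ i))
      simp [h0, h1, Ne.symm hn]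
  | succ k ih =>
    intro n
    have hms : MeasurableSet {σ : ℕ → Fin N | tally (k + 1) σ = n} :=
      measurable_tally (k + 1) (measurableSet_singleton n)
    rw [lintegral_iidMeasure_scons _ (Measurable.indicator (by fun_prop) hms), lintegral_srcMeasure]
    -- If the first source is i, the remaining k sources must have tally n lowered by one at i. The
    -- guard 0 < n i excludes the truncated subtraction.
    have h1 : ∀ i, ∫⁻ σ, {σ | tally (k + 1) σ = n}.indicator (fun σ => φ fun j => σ (j + (k + 1)))
          (scons i σ) ∂iidMeasure (srcMeasure p)
        = ENNReal.ofReal (if 0 < n i ∧ ∑ j, n j = k + 1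
            then k.factorial * multiWeight p (Function.update n i (n i - 1)) else 0)
          * ∫⁻ σ, φ σ ∂iidMeasure (srcMeasure p) := by
      intro i
      by_cases hi : 0 < n i
      · have hsum : ∑ j, Function.update n i (n i - 1) j + 1 = ∑ j, n j := by
          rw [← Finset.add_sum_erase Finset.univ _ (Finset.mem_univ i),
            ← Finset.add_sum_erase Finset.univ n (Finset.mem_univ i), Function.update_self,
            Finset.sum_congr rfl fun j hj => Function.update_of_ne (Finset.ne_of_mem_erase hj) _ _]
          omega
        have hiff : (∑ j, Function.update n i (n i - 1) j = k) ↔ (0 < n i ∧ ∑ j, n j = k + 1) := by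
          constructor
          · intro h; exact ⟨hi, by omega⟩
          · rintro ⟨_, h⟩; omega
        rw [← if_congr hiff rfl rfl, ← ih]
        refine lintegral_congr fun σ => ?_
        have hmem : scons i σ ∈ {σ | tally (k + 1) σ = n}
            ↔ σ ∈ {σ | tally k σ = Function.update n i (n i - 1)} := by
          simp only [Set.mem_ofPred_eq, tally_scons]
          constructor
          · rintro rfl
            funext j
            by_cases hj : j = i
            · subst hj; simp
            · simp [hj]
          · intro h
            rw [h]
            funext j
            by_cases hj : j = i
            · subst hj; simp; omega
            · simp [hj]
        by_cases h : scons i σ ∈ {σ | tally (k + 1) σ = n}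
        · rw [Set.indicator_of_mem h, Set.indicator_of_mem (hmem.1 h)]
          rfl
        · rw [Set.indicator_of_notMem h, Set.indicator_of_notMem (mt hmem.2 h)]
      · have : ∀ σ, scons i σ ∉ {σ | tally (k + 1) σ = n} := by
          intro σ hσ
          simp only [Set.mem_ofPred_eq, tally_scons] at hσ
          apply hi
          rw [← hσ]
          simp
        simp [hi, this]
    simp_rw [h1, ← mul_assoc]
    rw [← Finset.sum_mul]
    congr 1
    simp_rw [← fun i => ENNReal.ofReal_mul (q := if 0 < n i ∧ ∑ j, n j = k + 1
      then k.factorial * multiWeight p (Function.update n i (n i - 1)) else 0) (hp i)]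
    rw [← ENNReal.ofReal_sum_of_nonneg]
    · congr 1
      by_cases hs : ∑ j, n j = k + 1
      · have : ∀ i, p i * (if 0 < n i ∧ ∑ j, n j = k + 1
            then k.factorial * multiWeight p (Function.update n i (n i - 1)) else 0)
            = n i * (k.factorial * multiWeight p n) := by
          intro i
          by_cases hi : 0 < n i
          · rw [if_pos ⟨hi, hs⟩, mul_left_comm, multiWeight_update p n i hi]; ring
          · rw [if_neg fun h => hi h.1]
            have : n i = 0 := by omega
            simp [this]
        simp_rw [this]
        rw [← Finset.sum_mul, ← Nat.cast_sum, hs, if_pos rfl, Nat.factorial_succ]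
        push_cast; ring
      · simp [hs]
    · intro i _
      refine mul_nonneg (hp i) ?_
      split_ifs
      · exact mul_nonneg (by positivity) (hw _)
      · exact le_rfl

end Sources

theorem measurable_nat_index {α β : Type*} [MeasurableSpace α] [MeasurableSpace β] {f : ℕ → α → β}
    (hf : ∀ k, Measurable (f k)) {n : α → ℕ} (hn : Measurable n) : Measurable fun x => f (n x) x :=
  (measurable_from_prod_countable_right (f := fun p : ℕ × α => f p.1 p.2) hf).comp
    (hn.prodMk measurable_id)

/-! ### Splitting: counts of all sources in a time interval, and the input after it. -/

section Cells

variable {N : ℕ}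

/-- The numbers of arrivals from the sources up to time `h`. -/
noncomputable def cell (h : ℝ) (x : (ℕ → ℝ) × (ℕ → Fin N)) : Fin N → ℕ := tally (npts h x.1) x.2

/-- The gaps and the sources after time `h`. -/
noncomputable def advance (h : ℝ) (x : (ℕ → ℝ) × (ℕ → Fin N)) : (ℕ → ℝ) × (ℕ → Fin N) :=
  (residual (npts h x.1) h x.1, fun n => x.2 (n + npts h x.1))

theorem measurable_npts_left (h : ℝ) : Measurable (npts h) :=
  measurable_npts.comp measurable_prodMk_left

theorem measurable_residual_left (k : ℕ) (h : ℝ) : Measurable (residual k h) :=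
  (measurable_residual k).comp measurable_prodMk_left

theorem measurable_cell (h : ℝ) : Measurable (cell h : (ℕ → ℝ) × (ℕ → Fin N) → _) :=
  measurable_nat_index (f := fun k (x : (ℕ → ℝ) × (ℕ → Fin N)) => tally k x.2)
    (fun k => (measurable_tally k).comp measurable_snd)
    ((measurable_npts_left h).comp measurable_fst)

theorem measurable_shift {α : Type*} [MeasurableSpace α] (k : ℕ) :
    Measurable fun (σ : ℕ → α) n => σ (n + k) := by fun_prop

theorem measurable_advance (h : ℝ) : Measurable (advance h : (ℕ → ℝ) × (ℕ → Fin N) → _) :=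
  measurable_nat_index (f := fun k (x : (ℕ → ℝ) × (ℕ → Fin N)) =>
      (residual k h x.1, fun n => x.2 (n + k)))
    (fun k => ((measurable_residual_left k h).comp measurable_fst).prodMk
      ((measurable_shift k).comp measurable_snd))
    ((measurable_npts_left h).comp measurable_fst)

/-- The law of the gaps and the sources of the arrivals. -/
noncomputable def arrivalLaw (r : ℝ) (p : Fin N → ℝ) [IsProbabilityMeasure (expMeasure r)]
    [IsProbabilityMeasure (srcMeasure p)] : Measure ((ℕ → ℝ) × (ℕ → Fin N)) :=
  (iidMeasure (expMeasure r)).prod (iidMeasure (srcMeasure p))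

instance (r : ℝ) (p : Fin N → ℝ) [IsProbabilityMeasure (expMeasure r)]
    [IsProbabilityMeasure (srcMeasure p)] : IsProbabilityMeasure (arrivalLaw r p) := by
  unfold arrivalLaw; infer_instance

/-- The law of the numbers of arrivals during a time interval of length `h`. -/
noncomputable def cellLaw (lam : Fin N → ℝ) (h : ℝ≥0) : Measure (Fin N → ℕ) :=
  Measure.infinitePi fun i => poissonMeasure ((lam i).toNNReal * h)

instance (lam : Fin N → ℝ) (h : ℝ≥0) : IsProbabilityMeasure (cellLaw lam h) := by
  unfold cellLaw; infer_instance

variable {lam : Fin N → ℝ} {r : ℝ}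

/-- A product of Poisson weights with means lam i * h factors into a Poisson weight of mean r h for
the total count and a multinomial weight with probabilities lam i / r. This is the form in which the
counts arise from i.i.d. gaps and sources. -/
theorem cellLaw_singleton (hlam : ∀ i, 0 < lam i) (hr : r = ∑ i, lam i) (hr0 : 0 < r) (h : ℝ≥0)
    (n : Fin N → ℕ) :
    cellLaw lam h {n} = ENNReal.ofReal (Real.exp (-(r * h)) * ((r * h) ^ (∑ i, n i)
      / (∑ i, n i).factorial)) * ENNReal.ofReal ((∑ i, n i).factorial
        * multiWeight (fun i => lam i / r) n) := by
  rw [cellLaw, Measure.infinitePi_singleton_of_fintype]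
  simp_rw [poissonMeasure_singleton]
  rw [← ENNReal.ofReal_prod_of_nonneg fun i _ => by positivity,
    ← ENNReal.ofReal_mul (by positivity)]
  congr 1
  have h1 : Real.exp (-(r * h)) = ∏ i, Real.exp (-(lam i * h)) := by
    rw [← Real.exp_sum, Finset.sum_neg_distrib, ← Finset.sum_mul, hr]
  have h2 : (r * h : ℝ) ^ (∑ i, n i) = ∏ i, (r * h : ℝ) ^ n i := (Finset.prod_pow_eq_pow_sum _ _ _).symm
  rw [h1, h2, multiWeight]
  have h3 : (∏ i, Real.exp (-(lam i * h))) * ((∏ i, (r * h : ℝ) ^ n i) / (∑ i, n i).factorial)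
      * ((∑ i, n i).factorial * ∏ i, (lam i / r) ^ n i / (n i).factorial)
      = (∏ i, Real.exp (-(lam i * h))) * ((∏ i, (r * h : ℝ) ^ n i)
        * ∏ i, (lam i / r) ^ n i / (n i).factorial) := by
    generalize (∏ i, Real.exp (-(lam i * h))) = a
    generalize (∏ i, (r * h : ℝ) ^ n i) = b
    generalize (∏ i, (lam i / r) ^ n i / ((n i).factorial : ℝ)) = c
    field_simp
  rw [h3, ← Finset.prod_mul_distrib, ← Finset.prod_mul_distrib]
  refine Finset.prod_congr rfl fun i _ => ?_
  have h4 : (((lam i).toNNReal * h : ℝ≥0) : ℝ) = lam i * h := by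
    rw [NNReal.coe_mul, Real.coe_toNNReal _ (hlam i).le]
  rw [h4, mul_div_assoc, ← mul_div_assoc ((r * h : ℝ) ^ n i), ← mul_pow]
  have h5 : r * h * (lam i / r) = lam i * h := by field_simp
  rw [h5]

theorem ae_arrivalLaw_isProper (hr0 : 0 < r) [IsProbabilityMeasure (expMeasure r)] {p : Fin N → ℝ}
    [IsProbabilityMeasure (srcMeasure p)] : ∀ᵐ x ∂arrivalLaw r p, IsProper x.1 :=
  Measure.quasiMeasurePreserving_fst.ae (ae_isProper hr0)

/-- The numbers of arrivals up to time `h` are independent of what comes later. -/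
theorem map_cell_advance (hlam : ∀ i, 0 < lam i) (hr : r = ∑ i, lam i) (hr0 : 0 < r)
    [IsProbabilityMeasure (expMeasure r)] [IsProbabilityMeasure (srcMeasure fun i => lam i / r)]
    (h : ℝ≥0) :
    (arrivalLaw r fun i => lam i / r).map (fun x => (cell h x, advance h x))
      = (cellLaw lam h).prod (arrivalLaw r fun i => lam i / r) := by
  set Q := arrivalLaw r fun i => lam i / r with hQ
  have hp : ∀ i, 0 ≤ lam i / r := fun i => (div_pos (hlam i) hr0).le
  symm
  refine Measure.prod_eq fun A B hA hB => ?_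
  rw [Measure.map_apply ((measurable_cell _).prodMk (measurable_advance _)) (hA.prod hB)]
  -- The space of count vectors is countable, so with B fixed it is enough to compare masses of
  -- points.
  suffices hmeas : (Q.restrict (advance h ⁻¹' B)).map (cell h) = Q B • cellLaw lam h by
    have h1 := congrArg (fun μ => μ A) hmeas
    simp only [Measure.smul_apply, smul_eq_mul] at h1
    rw [Measure.map_apply (measurable_cell _) hA,
      Measure.restrict_apply (measurable_cell _ hA)] at h1
    rw [mul_comm, ← h1]
    rfl
  refine Measure.ext_iff_singleton.2 fun n => ?_
  have hn : MeasurableSet {n} := measurableSet_singleton n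
  rw [Measure.map_apply (measurable_cell _) hn, Measure.restrict_apply (measurable_cell _ hn),
    Measure.smul_apply, smul_eq_mul, cellLaw_singleton hlam hr hr0]
  set S := cell (h : ℝ) ⁻¹' {n} ∩ advance (h : ℝ) ⁻¹' B with hS
  have hSm : MeasurableSet S := (measurable_cell _ hn).inter (measurable_advance _ hB)
  -- `G k` restricts to exactly k arrivals by time h. There the random index in `cell` and `advance`
  -- is the constant k, and gaps and sources can be integrated separately.
  set G : ℕ → (ℕ → ℝ) × (ℕ → Fin N) → ℝ≥0∞ := fun k x =>
    {σ : ℕ → Fin N | tally k σ = n}.indicator (fun _ => (exactly k h).indicator (fun τ =>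
      B.indicator 1 (residual k h τ, fun j => x.2 (j + k))) x.1) x.2 with hG
  have hGm : ∀ k, Measurable (G k) := by
    intro k
    have e1 : MeasurableSet {x : (ℕ → ℝ) × (ℕ → Fin N) | tally k x.2 = n} :=
      ((measurable_tally k).comp measurable_snd) hn
    have e2 : MeasurableSet {x : (ℕ → ℝ) × (ℕ → Fin N) | x.1 ∈ exactly k h} :=
      measurable_fst (measurableSet_exactly k h)
    have e3 : Measurable fun x : (ℕ → ℝ) × (ℕ → Fin N) =>
        B.indicator (1 : (ℕ → ℝ) × (ℕ → Fin N) → ℝ≥0∞) (residual k h x.1, fun j => x.2 (j + k)) :=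
      (measurable_one.indicator hB).comp (((measurable_residual_left k h).comp measurable_fst).prodMk
        ((measurable_shift k).comp measurable_snd))
    exact (e3.indicator e2).indicator e1
  have hsum : ∀ᵐ x ∂Q, S.indicator 1 x = ∑' k, G k x := by
    filter_upwards [ae_arrivalLaw_isProper hr0] with x hx
    rw [tsum_eq_single (npts h x.1)]
    · by_cases h1 : tally (npts h x.1) x.2 = n
      · have h1' : x.2 ∈ {σ : ℕ → Fin N | tally (npts h x.1) σ = n} := h1
        simp only [hG, Set.indicator_of_mem h1', Set.indicator_of_mem (hx.mem_exactly h.coe_nonneg)]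
        by_cases h2 : advance h x ∈ B
        · rw [Set.indicator_of_mem (show x ∈ S from ⟨h1, h2⟩), Set.indicator_of_mem (by exact h2)]
          rfl
        · rw [Set.indicator_of_notMem (fun hh => h2 hh.2), Set.indicator_of_notMem (by exact h2)]
      · rw [Set.indicator_of_notMem (fun hh => h1 hh.1)]
        simp [hG, h1]
    · intro k hk
      have : x.1 ∉ exactly k h := fun hh => hk ((hx.npts_eq_iff h.coe_nonneg).2 hh).symm
      simp [hG, this]
  have hk : ∀ k, ∫⁻ x, G k x ∂Q = iidMeasure (expMeasure r) (exactly k h)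
      * (ENNReal.ofReal (if ∑ i, n i = k then k.factorial * multiWeight (fun i => lam i / r) n else 0)
        * Q B) := by
    intro k
    have hB1 : Measurable (B.indicator (1 : (ℕ → ℝ) × (ℕ → Fin N) → ℝ≥0∞)) := measurable_one.indicator hB
    have e1 : ∀ σ : ℕ → Fin N, ∫⁻ τ, (exactly k h).indicator (fun τ =>
          B.indicator (1 : (ℕ → ℝ) × (ℕ → Fin N) → ℝ≥0∞) (residual k h τ, fun j => σ (j + k))) τ ∂iidMeasure (expMeasure r)
        = iidMeasure (expMeasure r) (exactly k h)
          * ∫⁻ τ, B.indicator 1 (τ, fun j => σ (j + k)) ∂iidMeasure (expMeasure r) := by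
      intro σ
      have := lintegral_exactly_residual hr0 (φ := fun τ => B.indicator 1 (τ, fun j => σ (j + k)))
        (hB1.comp measurable_prodMk_right) k (g := fun _ => 1) measurable_const h
      simp only [one_mul] at this
      rw [this, lintegral_indicator (measurableSet_exactly k h), setLIntegral_const, one_mul]
    have hΦ : Measurable fun σ : ℕ → Fin N =>
        ∫⁻ τ, B.indicator (1 : (ℕ → ℝ) × (ℕ → Fin N) → ℝ≥0∞) (τ, σ) ∂iidMeasure (expMeasure r) :=
      hB1.lintegral_prod_left'
    have hQB : Q B = ∫⁻ σ, ∫⁻ τ, B.indicator 1 (τ, σ) ∂iidMeasure (expMeasure r)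
        ∂iidMeasure (srcMeasure fun i => lam i / r) := by
      rw [← lintegral_indicator_one hB, hQ, arrivalLaw, lintegral_prod_symm' _ hB1]
    rw [hQB, hQ, arrivalLaw, lintegral_prod_symm' _ (hGm k), ← lintegral_tally hp hΦ k n,
      ← lintegral_const_mul]
    · refine lintegral_congr fun σ => ?_
      by_cases h1 : tally k σ = n
      · have h1' : σ ∈ {σ | tally k σ = n} := h1
        simp only [hG, Set.indicator_of_mem h1']
        exact e1 σ
      · have h1' : σ ∉ {σ | tally k σ = n} := h1
        simp [hG, Set.indicator_of_notMem h1']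
    · exact (hΦ.comp (measurable_shift k)).indicator (measurable_tally k hn)
  rw [← lintegral_indicator_one hSm, lintegral_congr_ae hsum,
    lintegral_tsum fun k => (hGm k).aemeasurable]
  simp_rw [hk]
  -- The total number of arrivals is fixed by the count vector.
  rw [tsum_eq_single (∑ i, n i)]
  · rw [if_pos rfl, iidMeasure_exactly hr0 _ _ h.coe_nonneg]
    ring
  · intro k hk'
    simp [Ne.symm hk']

end Cells

/-! ### Recovering the arrivals from the counts -/

theorem IsProper.psum_le_iff {τ : ℕ → ℝ} (h : IsProper τ) {v : ℝ} (hv : 0 ≤ v) {n : ℕ} :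
    psum τ (n + 1) ≤ v ↔ n < npts v τ := by
  have hmono := (psum_strictMono h.1).monotone
  have hmem := h.mem_exactly hv
  constructor
  · intro hn
    by_contra hcon
    have := hmono (show npts v τ + 1 ≤ n + 1 by omega)
    linarith [hmem.2]
  · intro hn
    exact (hmono (show n + 1 ≤ npts v τ by omega)).trans hmem.1

theorem IsProper.residual {τ : ℕ → ℝ} (h : IsProper τ) {v : ℝ} (hv : 0 ≤ v) :
    IsProper (residual (npts v τ) v τ) := by
  refine ⟨fun n => ?_, ?_⟩
  · cases n with
    | zero => exact sub_pos.2 (h.mem_exactly hv).2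
    | succ n => exact h.1 _
  · rw [← tendsto_add_atTop_iff_nat 1]
    simp_rw [psum_residual]
    refine tendsto_atTop_add_const_right _ _ ?_
    exact h.2.comp (tendsto_add_atTop_nat _)

theorem IsProper.npts_add {τ : ℕ → ℝ} (h : IsProper τ) {v t : ℝ} (hv : 0 ≤ v) (ht : 0 ≤ t) :
    npts (v + t) τ = npts v τ + npts t (StatusAge.residual (npts v τ) v τ) := by
  rw [h.npts_eq_iff (add_nonneg hv ht)]
  have h1 := (h.residual hv).mem_exactly ht
  set k := npts v τ
  set m := npts t (StatusAge.residual k v τ)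
  have h2 := h.mem_exactly hv
  have h1a := h1.1
  have h1b := h1.2
  rw [psum_residual] at h1b
  refine ⟨?_, ?_⟩
  · rcases Nat.eq_zero_or_pos m with h0 | h0
    · rw [h0]; exact h2.1.trans (by linarith)
    · obtain ⟨j, hj⟩ := Nat.exists_eq_succ_of_ne_zero h0.ne'
      rw [hj, Nat.succ_eq_add_one, psum_residual] at h1a
      rw [hj, show k + j.succ = j + (k + 1) by omega]
      linarith
  · rw [show k + m + 1 = m + (k + 1) by ring]
    linarith

section

variable {N : ℕ}

theorem tally_add (k m : ℕ) (σ : ℕ → Fin N) :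
    tally (k + m) σ = tally k σ + tally m (fun n => σ (n + k)) := by
  funext i
  simp only [tally, Pi.add_apply, Finset.card_filter]
  rw [Finset.sum_range_add]
  simp_rw [add_comm k]

theorem tally_succ (k : ℕ) (σ : ℕ → Fin N) : tally (k + 1) σ = tally k σ + Pi.single (σ k) 1 := by
  funext i
  simp only [tally, Pi.add_apply, Finset.card_filter]
  rw [Finset.sum_range_succ]
  congr 1
  simp only [Pi.single_apply]
  exact if_congr eq_comm rfl rfl

theorem sum_tally (k : ℕ) (σ : ℕ → Fin N) : ∑ i, tally k σ i = k := by
  simp only [tally]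
  rw [← Finset.card_eq_sum_card_fiberwise (f := σ) fun x _ => Finset.mem_coe.2 (Finset.mem_univ _),
    Finset.card_range]

theorem cell_add {x : (ℕ → ℝ) × (ℕ → Fin N)} (hx : IsProper x.1) {v t : ℝ} (hv : 0 ≤ v)
    (ht : 0 ≤ t) : cell (v + t) x = cell v x + cell t (advance v x) := by
  rw [cell, hx.npts_add hv ht, tally_add]
  rfl

theorem IsProper.advance {x : (ℕ → ℝ) × (ℕ → Fin N)} (hx : IsProper x.1) {v : ℝ} (hv : 0 ≤ v) :
    IsProper (advance v x).1 := hx.residual hv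

theorem IsProper.npts_zero {τ : ℕ → ℝ} (h : IsProper τ) : npts 0 τ = 0 := by
  rw [h.npts_eq_iff le_rfl]
  exact ⟨by simp, by rw [psum_succ, psum_zero, zero_add]; exact h.1 0⟩

theorem cell_zero {x : (ℕ → ℝ) × (ℕ → Fin N)} (hx : IsProper x.1) : cell 0 x = 0 := by
  funext i
  simp [cell, hx.npts_zero, tally]

/-- The numbers of arrivals in the successive time intervals of length `h`. -/
noncomputable def cells (h : ℝ) (x : (ℕ → ℝ) × (ℕ → Fin N)) (k : ℕ) : Fin N → ℕ :=
  cell h ((advance h)^[k] x)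

theorem measurable_cells (h : ℝ) : Measurable (cells h : (ℕ → ℝ) × (ℕ → Fin N) → _) :=
  measurable_pi_iff.2 fun k => (measurable_cell h).comp ((measurable_advance h).iterate k)

theorem cell_eq_sum_cells {h : ℝ} (hh : 0 ≤ h) (k : ℕ) : ∀ {x : (ℕ → ℝ) × (ℕ → Fin N)},
    IsProper x.1 → cell (k * h) x = ∑ j ∈ Finset.range k, cells h x j := by
  induction k with
  | zero => intro x hx; simp [cell_zero hx]
  | succ k ih =>
    intro x hx
    rw [show ((k + 1 : ℕ) : ℝ) * h = h + k * h by push_cast; ring,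
      cell_add hx hh (by positivity), ih (hx.advance hh), Finset.sum_range_succ', add_comm]
    rfl

theorem cells_eq_sub {h : ℝ} (hh : 0 ≤ h) (k : ℕ) {x : (ℕ → ℝ) × (ℕ → Fin N)} (hx : IsProper x.1) :
    cells h x k = cell ((k + 1 : ℕ) * h) x - cell (k * h) x := by
  rw [cell_eq_sum_cells hh _ hx, cell_eq_sum_cells hh _ hx, Finset.sum_range_succ,
    add_tsub_cancel_left]

/-- The index of the interval that contains arrival `n`, given the numbers of arrivals. -/
noncomputable def cellIndex (z : ℕ → Fin N → ℕ) (n : ℕ) : ℕ :=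
  sInf {k | n < ∑ j ∈ Finset.range (k + 1), ∑ i, z j i}

theorem measurable_cellIndex (n : ℕ) : Measurable fun z : ℕ → Fin N → ℕ => cellIndex z n :=
  measurable_nat_sInf fun k => measurableSet_lt measurable_const (by fun_prop)

/-- An approximation of the gaps and the sources, given the numbers of arrivals. -/
noncomputable def decode [NeZero N] (h : ℝ) (z : ℕ → Fin N → ℕ) : (ℕ → ℝ) × (ℕ → Fin N) :=
  (fun n => h * cellIndex z n - n.casesOn 0 fun m => h * cellIndex z m,
    fun n => Function.invFun (fun i => (Pi.single i 1 : Fin N → ℕ)) (z (cellIndex z n)))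

theorem measurable_decode [NeZero N] (h : ℝ) :
    Measurable (decode h : (ℕ → Fin N → ℕ) → (ℕ → ℝ) × (ℕ → Fin N)) := by
  refine Measurable.prodMk (measurable_pi_iff.2 fun n => ?_) (measurable_pi_iff.2 fun n => ?_)
  · have h1 : ∀ n, Measurable fun z : ℕ → Fin N → ℕ => h * (cellIndex z n : ℝ) := fun n =>
      (measurable_from_top.comp (measurable_cellIndex n)).const_mul h
    cases n with
    | zero => exact (h1 0).sub measurable_const
    | succ m => exact (h1 (m + 1)).sub (h1 m)
  · exact (measurable_of_countable
        (Function.invFun fun i => (Pi.single i 1 : Fin N → ℕ))).comp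
      (measurable_nat_index (f := fun k (z : ℕ → Fin N → ℕ) => z k) (fun k => measurable_pi_apply k)
        (measurable_cellIndex n))

/-- Arrival n falls in the half-open interval (h k, h k + h], with k its cell index: the total count
through cell k exceeds n exactly when arrival n has occurred by its right end. Hence the
approximation error is at most h. -/
theorem cellIndex_cells {h : ℝ} (hh : 0 < h) {x : (ℕ → ℝ) × (ℕ → Fin N)} (hx : IsProper x.1) (n : ℕ) :
    h * cellIndex (cells h x) n < psum x.1 (n + 1) ∧
      psum x.1 (n + 1) ≤ h * cellIndex (cells h x) n + h := by
  have hset : {k | n < ∑ j ∈ Finset.range (k + 1), ∑ i, cells h x j i}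
      = {k : ℕ | psum x.1 (n + 1) ≤ h * k + h} := by
    ext k
    have h1 : ∑ j ∈ Finset.range (k + 1), ∑ i, cells h x j i = npts (h * k + h) x.1 := by
      rw [Finset.sum_comm]
      have := cell_eq_sum_cells hh.le (k + 1) hx
      rw [← sum_tally (npts (h * k + h) x.1) x.2]
      refine Finset.sum_congr rfl fun i _ => ?_
      rw [← Finset.sum_apply, ← this, cell]
      congr 2
      push_cast; ring
    simp only [Set.mem_ofPred_eq, h1]
    exact (hx.psum_le_iff (by positivity)).symm
  have hne : {k : ℕ | psum x.1 (n + 1) ≤ h * k + h}.Nonempty := by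
    obtain ⟨k, hk⟩ := exists_nat_ge (psum x.1 (n + 1) / h)
    refine ⟨k, ?_⟩
    rw [div_le_iff₀ hh] at hk
    simp only [Set.mem_ofPred_eq]
    linarith
  rw [cellIndex, hset]
  refine ⟨?_, Nat.sInf_mem hne⟩
  rcases Nat.eq_zero_or_pos (sInf {k : ℕ | psum x.1 (n + 1) ≤ h * k + h}) with h0 | h0
  · rw [h0]
    have := psum_strictMono hx.1 (show 0 < n + 1 by omega)
    simpa using this
  · obtain ⟨m, hm⟩ := Nat.exists_eq_succ_of_ne_zero h0.ne'
    have := Nat.notMem_of_lt_sInf (s := {k : ℕ | psum x.1 (n + 1) ≤ h * k + h}) (m := m) (by omega)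
    simp only [Set.mem_ofPred_eq, not_le] at this
    rw [hm]
    push_cast
    linarith

/-- When h is at most the gaps on either side of arrival n, that arrival is alone in its cell, and
the count vector is the unit vector of its source. -/
theorem cells_cellIndex {h : ℝ} (hh : 0 < h) {x : (ℕ → ℝ) × (ℕ → Fin N)} (hx : IsProper x.1) {n : ℕ}
    (h1 : h ≤ x.1 n) (h2 : h ≤ x.1 (n + 1)) :
    cells h x (cellIndex (cells h x) n) = Pi.single (x.2 n) 1 := by
  obtain ⟨e1, e2⟩ := cellIndex_cells hh hx n
  set k := cellIndex (cells h x) n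
  have hn : psum x.1 (n + 1) = psum x.1 n + x.1 n := psum_succ _ _
  have hn' : psum x.1 (n + 1 + 1) = psum x.1 (n + 1) + x.1 (n + 1) := psum_succ _ _
  have m1 : npts (k * h) x.1 = n := by
    rw [hx.npts_eq_iff (by positivity)]
    constructor <;> linarith
  have m2 : npts ((k + 1 : ℕ) * h) x.1 = n + 1 := by
    rw [hx.npts_eq_iff (by positivity)]
    push_cast
    constructor <;> linarith
  rw [cells_eq_sub hh.le _ hx, cell, cell, m1, m2, tally_succ, add_tsub_cancel_left]

theorem tendsto_decode [NeZero N] {h : ℕ → ℝ} (hh : ∀ j, 0 < h j) (hlim : Tendsto h atTop (𝓝 0))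
    {x : (ℕ → ℝ) × (ℕ → Fin N)} (hx : IsProper x.1) :
    Tendsto (fun j => decode (h j) (cells (h j) x)) atTop (𝓝 x) := by
  have harr : ∀ n, Tendsto (fun j => h j * (cellIndex (cells (h j) x) n : ℝ)) atTop
      (𝓝 (psum x.1 (n + 1))) := by
    intro n
    have : Tendsto (fun j => psum x.1 (n + 1) - h j) atTop (𝓝 (psum x.1 (n + 1) - 0)) :=
      tendsto_const_nhds.sub hlim
    rw [sub_zero] at this
    refine tendsto_of_tendsto_of_tendsto_of_le_of_le this tendsto_const_nhds (fun j => ?_)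
      (fun j => (cellIndex_cells (hh j) hx n).1.le)
    have := (cellIndex_cells (hh j) hx n).2
    simp only
    linarith
  refine Tendsto.prodMk_nhds (tendsto_pi_nhds.2 fun n => ?_) (tendsto_pi_nhds.2 fun n => ?_)
  · cases n with
    | zero =>
      have := (harr 0).sub (tendsto_const_nhds (x := (0 : ℝ)))
      rwa [psum_succ, psum_zero, zero_add, sub_zero] at this
    | succ m =>
      have := (harr (m + 1)).sub (harr m)
      rwa [psum_succ, add_sub_cancel_left] at this
  · refine tendsto_const_nhds.congr' ?_
    filter_upwards [hlim.eventually_lt_const (hx.1 n), hlim.eventually_lt_const (hx.1 (n + 1))]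
      with j h1 h2
    have hinj : Function.Injective fun i => (Pi.single i 1 : Fin N → ℕ) := fun i j hij => by
      have := congrFun hij i
      by_contra hne
      simp [hne] at this
    have e := congrArg (Function.invFun fun i => (Pi.single i 1 : Fin N → ℕ))
      (cells_cellIndex (hh j) hx h1.le h2.le)
    exact (e.trans (Function.leftInverse_invFun hinj _)).symm

/-- A law of gaps and sources is determined by the laws of the numbers of arrivals in intervals. -/
theorem eq_of_map_cells [NeZero N] {μ₁ μ₂ : Measure ((ℕ → ℝ) × (ℕ → Fin N))}
    [IsProbabilityMeasure μ₁] [IsProbabilityMeasure μ₂] (h₁ : ∀ᵐ x ∂μ₁, IsProper x.1)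
    (h₂ : ∀ᵐ x ∂μ₂, IsProper x.1)
    (heq : ∀ h : ℝ≥0, μ₁.map (cells h) = μ₂.map (cells h)) : μ₁ = μ₂ := by
  set h : ℕ → ℝ≥0 := fun j => 1 / (j + 1) with hdef
  have hh : ∀ j, (0 : ℝ) < h j := fun j => by simp only [hdef]; positivity
  have hlim : Tendsto (fun j => (h j : ℝ)) atTop (𝓝 0) := by
    have := tendsto_one_div_add_atTop_nhds_zero_nat (𝕜 := ℝ)
    simpa [hdef] using this
  refine ext_of_forall_integral_eq_of_IsFiniteMeasure fun f => ?_
  -- `decode` is used only as a measurable map. Its values converge pointwise to x, so bounded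
  -- continuous test functions pass to the limit.
  have hmeas : ∀ j, Measurable fun z : ℕ → Fin N → ℕ => f (decode (h j : ℝ) z) := fun j =>
    f.continuous.measurable.comp (measurable_decode _)
  have key : ∀ μ : Measure ((ℕ → ℝ) × (ℕ → Fin N)), IsProbabilityMeasure μ →
      (∀ᵐ x ∂μ, IsProper x.1) →
      Tendsto (fun j => ∫ z, f (decode (h j : ℝ) z) ∂μ.map (cells (h j : ℝ))) atTop
        (𝓝 (∫ x, f x ∂μ)) := by
    intro μ _ hμ
    have e : ∀ j, ∫ z, f (decode (h j : ℝ) z) ∂μ.map (cells (h j : ℝ))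
        = ∫ x, f (decode (h j : ℝ) (cells (h j : ℝ) x)) ∂μ := fun j =>
      integral_map (measurable_cells _).aemeasurable (hmeas j).aestronglyMeasurable
    simp_rw [e]
    refine tendsto_integral_of_dominated_convergence (fun _ => ‖f‖)
      (fun j => ((hmeas j).comp (measurable_cells _)).aestronglyMeasurable) (by simp)
      (fun j => Eventually.of_forall fun x => f.norm_coe_le_norm _) ?_
    filter_upwards [hμ] with x hx
    exact (f.continuous.tendsto x).comp (tendsto_decode hh hlim hx)
  have k1 := key μ₁ inferInstance h₁
  simp_rw [heq] at k1
  exact tendsto_nhds_unique k1 (key μ₂ inferInstance h₂)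

end

/-! ### The law of the input -/

/-- The gaps between the terms of a sequence. -/
def gaps (arr : ℕ → ℝ) : ℕ → ℝ
  | 0 => arr 0
  | n + 1 => arr (n + 1) - arr n

theorem psum_gaps (arr : ℕ → ℝ) (n : ℕ) : psum (gaps arr) (n + 1) = arr n := by
  induction n with
  | zero => simp [psum_succ, gaps]
  | succ n ih => rw [psum_succ, ih, gaps]; ring

theorem isProper_gaps {arr : ℕ → ℝ} (h0 : 0 < arr 0) (h1 : StrictMono arr)
    (h2 : Tendsto arr atTop atTop) : IsProper (gaps arr) := by
  refine ⟨fun n => ?_, ?_⟩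
  · cases n with
    | zero => exact h0
    | succ n => exact sub_pos.2 (h1 (Nat.lt_succ_self n))
  · rw [← tendsto_add_atTop_iff_nat 1]
    simpa only [psum_gaps] using h2

theorem measurable_gaps : Measurable gaps := by
  refine measurable_pi_iff.2 fun n => ?_
  cases n with
  | zero => exact measurable_pi_apply 0
  | succ n => exact (measurable_pi_apply (n + 1)).sub (measurable_pi_apply n)

section

variable {N : ℕ}

theorem arrivalCount_eq_cell {arr : ℕ → ℝ} {src : ℕ → Fin N} (h : IsProper (gaps arr)) (i : Fin N)
    (t : ℝ≥0) : arrivalCount arr src i t = cell t (gaps arr, src) i := by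
  have hpos : ∀ n, 0 < arr n := fun n => by
    rw [← psum_gaps arr n]
    exact psum_strictMono h.1 (show 0 < n + 1 by omega)
  have : {n | src n = i ∧ 0 < arr n ∧ arr n ≤ t}
      = ((Finset.range (npts t (gaps arr))).filter fun n => src n = i : Finset ℕ) := by
    ext n
    simp only [Set.mem_ofPred_eq, Finset.coe_filter, Finset.mem_range]
    rw [← h.psum_le_iff t.coe_nonneg, psum_gaps]
    exact ⟨fun ⟨a, _, b⟩ => ⟨b, a⟩, fun ⟨b, a⟩ => ⟨a, hpos n, b⟩⟩
  rw [arrivalCount, this, Set.ncard_coe_finset]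
  rfl

theorem map_swap_infinitePi (μ : Fin N → Measure ℕ) [∀ i, IsProbabilityMeasure (μ i)] :
    (Measure.infinitePi fun i => Measure.infinitePi fun _ : ℕ => μ i).map (fun z k i => z i k)
      = Measure.infinitePi fun _ : ℕ => Measure.infinitePi fun i => μ i := by
  rw [← Measure.infinitePi_map_curry (fun i (_ : ℕ) => μ i),
    ← Measure.infinitePi_map_curry (fun (_ : ℕ) i => μ i)]
  have h1 := Measure.map_infinitePi_infinitePi_of_inj (P := fun p : Fin N × ℕ => μ p.1)
    (f := (Prod.swap : ℕ × Fin N → Fin N × ℕ)) Prod.swap_injective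
  have h2 : (fun p : ℕ × Fin N => μ p.2) = fun p => μ (Prod.swap p).1 := rfl
  rw [h2, ← h1, Measure.map_map (by fun_prop) (MeasurableEquiv.measurable _),
    Measure.map_map (MeasurableEquiv.measurable _) (by fun_prop)]
  rfl

variable {Ω : Type*} [MeasurableSpace Ω] {P : Measure Ω} [IsProbabilityMeasure P]
  {lam : Fin N → ℝ} {mu r : ℝ} {arr : ℕ → Ω → ℝ} {src : ℕ → Ω → Fin N} {svc : ℕ → Ω → ℝ}

theorem IsMM1Input.ae_isProper (h : IsMM1Input P lam mu arr src svc) :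
    ∀ᵐ ω ∂P, IsProper (gaps fun n => arr n ω) := by
  filter_upwards [h.arr_pos, h.arr_strictMono, h.arr_tendsto] with ω h1 h2 h3
  exact isProper_gaps h1 h2 h3

theorem IsMM1Input.measurable_arrivals (h : IsMM1Input P lam mu arr src svc) :
    Measurable fun ω => (gaps fun n => arr n ω, fun n => src n ω) :=
  (measurable_gaps.comp (measurable_pi_iff.2 h.measurable_arr)).prodMk
    (measurable_pi_iff.2 h.measurable_src)

/-- The law of the increments of independent Poisson processes. -/
theorem map_increments {X : Fin N → ℝ≥0 → Ω → ℕ} (hX : ∀ i, IsPoissonProcess P (lam i) (X i))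
    (hind : iIndepFun (fun i ω t => X i t ω) P) (δ : ℝ≥0) :
    P.map (fun ω k i => X i ((k + 1 : ℕ) * δ) ω - X i ((k : ℕ) * δ) ω) = iidMeasure (cellLaw lam δ) := by
  have hmono : Monotone fun k : ℕ => (k : ℝ≥0) * δ := fun a b hab => by
    have : (a : ℝ≥0) ≤ b := by exact_mod_cast hab
    exact mul_le_mul_left this δ
  have hlaw : ∀ i (k : ℕ), HasLaw (fun ω => X i ((k + 1 : ℕ) * δ) ω - X i (k * δ) ω)
      (poissonMeasure ((lam i).toNNReal * δ)) P := by
    intro i k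
    have h1 := (hX i).law (k * δ) ((k + 1 : ℕ) * δ) (hmono (Nat.le_succ k))
    have h2 : ((k + 1 : ℕ) : ℝ≥0) * δ - k * δ = δ := by
      push_cast
      rw [add_mul, one_mul, add_tsub_cancel_left]
    rwa [h2] at h1
  have hae : ∀ i, AEMeasurable (fun ω (k : ℕ) => X i ((k + 1 : ℕ) * δ) ω - X i (k * δ) ω) P := fun i =>
    aemeasurable_pi_iff.2 fun k => (hlaw i k).aemeasurable
  have hrow : ∀ i, HasLaw (fun ω (k : ℕ) => X i ((k + 1 : ℕ) * δ) ω - X i (k * δ) ω)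
      (Measure.infinitePi fun _ : ℕ => poissonMeasure ((lam i).toNNReal * δ)) P := fun i =>
    iIndepFun.hasLaw_infinitePi (hlaw i) ((hX i).indep.nat hmono) (hae i)
  have hrows : iIndepFun (fun i ω (k : ℕ) => X i ((k + 1 : ℕ) * δ) ω - X i (k * δ) ω) P :=
    hind.comp (fun _ f (k : ℕ) => f ((k + 1 : ℕ) * δ) - f (k * δ)) fun _ =>
      measurable_pi_iff.2 fun k => (measurable_pi_apply _).sub (measurable_pi_apply _)
  have hall := iIndepFun.hasLaw_infinitePi hrow hrows (aemeasurable_pi_iff.2 hae)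
  have hswap := map_swap_infinitePi fun i => poissonMeasure ((lam i).toNNReal * δ)
  have hsm : Measurable fun (z : Fin N → ℕ → ℕ) (k : ℕ) (i : Fin N) => z i k := by fun_prop
  rw [← hall.map_eq, AEMeasurable.map_map_of_aemeasurable hsm.aemeasurable hall.aemeasurable] at hswap
  exact hswap

theorem IsMM1Input.map_cells (h : IsMM1Input P lam mu arr src svc) (δ : ℝ≥0) :
    P.map (fun ω => cells δ (gaps fun n => arr n ω, fun n => src n ω)) = iidMeasure (cellLaw lam δ) := by
  rw [← map_increments h.poisson h.indep_sources δ]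
  refine Measure.map_congr ?_
  filter_upwards [h.ae_isProper] with ω hω
  funext k i
  rw [cells_eq_sub δ.coe_nonneg k hω, Pi.sub_apply, arrivalCount_eq_cell hω,
    arrivalCount_eq_cell hω, NNReal.coe_mul, NNReal.coe_mul, NNReal.coe_natCast, NNReal.coe_natCast]

/-- On every grid the counts are i.i.d. with law `cellLaw` under both laws: for the given input by
the independent Poisson increments, for the gap model because `advance` is regenerative with
observation `cell`. `eq_of_map_cells` then identifies the laws. -/
theorem IsMM1Input.map_arrivals (h : IsMM1Input P lam mu arr src svc) (hlam : ∀ i, 0 < lam i)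
    (hr : r = ∑ i, lam i) (hr0 : 0 < r) [NeZero N]
    [IsProbabilityMeasure (expMeasure r)] [IsProbabilityMeasure (srcMeasure fun i => lam i / r)] :
    P.map (fun ω => (gaps fun n => arr n ω, fun n => src n ω))
      = arrivalLaw r fun i => lam i / r := by
  have hm := h.measurable_arrivals
  have : IsProbabilityMeasure (P.map fun ω => (gaps fun n => arr n ω, fun n => src n ω)) :=
    Measure.isProbabilityMeasure_map hm.aemeasurable
  have hprop : MeasurableSet {τ : ℕ → ℝ | IsProper τ} := by
    have : {τ : ℕ → ℝ | IsProper τ}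
        = (⋂ n, {τ : ℕ → ℝ | 0 < τ n}) ∩ {τ | Tendsto (psum τ) atTop atTop} := by
      ext τ; simp [IsProper]
    rw [this]
    refine (MeasurableSet.iInter fun n =>
      measurableSet_lt measurable_const (measurable_pi_apply n)).inter ?_
    exact measurableSet_tendsto _ fun n => measurable_psum n
  refine eq_of_map_cells ?_ (ae_arrivalLaw_isProper hr0) fun δ => ?_
  · exact (ae_map_iff hm.aemeasurable (measurable_fst hprop)).2 h.ae_isProper
  · rw [Measure.map_map (measurable_cells _) hm]
    refine (h.map_cells δ).trans ?_
    exact (map_orbit_regenerative (measurable_cell _) (measurable_advance _)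
      (map_cell_advance hlam hr hr0 δ)).symm

theorem IsMM1Input.map_input (h : IsMM1Input P lam mu arr src svc) (hlam : ∀ i, 0 < lam i)
    (hr : r = ∑ i, lam i) (hr0 : 0 < r) [NeZero N] [IsProbabilityMeasure (expMeasure mu)]
    [IsProbabilityMeasure (expMeasure r)] [IsProbabilityMeasure (srcMeasure fun i => lam i / r)] :
    P.map (fun ω => (gaps fun n => arr n ω, fun n => src n ω, fun n => svc n ω))
      = (iidMeasure (expMeasure r)).prod
        ((iidMeasure (srcMeasure fun i => lam i / r)).prod (iidMeasure (expMeasure mu))) := by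
  have hm := h.measurable_arrivals
  have hsv : Measurable fun ω n => svc n ω := measurable_pi_iff.2 h.measurable_svc
  have hs := iIndepFun.hasLaw_infinitePi h.svc_law h.indep_svc hsv.aemeasurable
  have hg : Measurable fun z : ℕ → ℝ × Fin N => (gaps fun n => (z n).1, fun n => (z n).2) :=
    (measurable_gaps.comp (by fun_prop)).prodMk (by fun_prop)
  have hind : IndepFun (fun ω => (gaps fun n => arr n ω, fun n => src n ω)) (fun ω n => svc n ω) P :=
    h.indep_arr_svc.comp hg measurable_id
  have h1 := hind.map_prod_eq_prod_map_map hm.aemeasurable hsv.aemeasurable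
  rw [h.map_arrivals hlam hr hr0, hs.map_eq, arrivalLaw] at h1
  have h2 := congrArg (Measure.map MeasurableEquiv.prodAssoc) h1
  rw [Measure.map_map (MeasurableEquiv.measurable _) (hm.prodMk hsv),
    Measure.prodAssoc_prod] at h2
  exact h2

end

/-! ### The two cycle structures -/

theorem map_prod_prod_comm {α β γ δ : Type*} [MeasurableSpace α] [MeasurableSpace β]
    [MeasurableSpace γ] [MeasurableSpace δ] (a : Measure α) (b : Measure β) (c : Measure γ)
    (d : Measure δ) [IsProbabilityMeasure a] [IsProbabilityMeasure b] [IsProbabilityMeasure c]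
    [IsProbabilityMeasure d] :
    ((a.prod b).prod (c.prod d)).map (fun p => ((p.1.1, p.2.1), (p.1.2, p.2.2)))
      = (a.prod c).prod (b.prod d) := by
  refine Measure.ext_of_lintegral _ fun f hf => ?_
  rw [lintegral_map hf (by fun_prop), lintegral_prod _ (by fun_prop), lintegral_prod _ (by fun_prop),
    lintegral_prod _ (by fun_prop), lintegral_prod _ (by fun_prop)]
  refine lintegral_congr fun x => ?_
  simp_rw [fun y => lintegral_prod (μ := c) (ν := d)
      (fun q : γ × δ => f ((x, q.1), (y, q.2))) (by fun_prop),
    fun z => lintegral_prod (μ := b) (ν := d)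
      (fun q : β × δ => f ((x, z), q)) (by fun_prop)]
  rw [lintegral_lintegral_swap]
  refine (Measurable.lintegral_prod_right' (f := fun p : (β × γ) × δ =>
    f ((x, p.1.2), (p.1.1, p.2))) (by fun_prop)).aemeasurable

section iid

variable {α β : Type*} [MeasurableSpace α] [MeasurableSpace β] (ν : Measure α)
  [IsProbabilityMeasure ν] (ν' : Measure β) [IsProbabilityMeasure ν']

theorem map_head_tail : (iidMeasure ν).map (fun τ => (τ 0, fun n => τ (n + 1)))
    = ν.prod (iidMeasure ν) := by
  conv_lhs => rw [← map_scons ν]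
  rw [Measure.map_map (by fun_prop) measurable_scons]
  exact Measure.map_id

/-- The first terms of two independent sequences are independent of the other terms. -/
theorem map_head_tail_prod : ((iidMeasure ν).prod (iidMeasure ν')).map
      (fun x => ((x.1 0, x.2 0), (fun n => x.1 (n + 1), fun n => x.2 (n + 1))))
    = (ν.prod ν').prod ((iidMeasure ν).prod (iidMeasure ν')) := by
  have h : ((iidMeasure ν).prod (iidMeasure ν')).map
      (Prod.map (fun τ => (τ 0, fun n => τ (n + 1))) fun τ => (τ 0, fun n => τ (n + 1)))
      = (ν.prod (iidMeasure ν)).prod (ν'.prod (iidMeasure ν')) := by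
    rw [← Measure.map_prod_map _ _ (by fun_prop) (by fun_prop), map_head_tail, map_head_tail]
  rw [← map_prod_prod_comm, ← h, Measure.map_map (by fun_prop) (by fun_prop)]
  rfl

theorem lintegral_head_mul_tail {F : α × β → ℝ≥0∞} (hF : Measurable F)
    {G : (ℕ → α) × (ℕ → β) → ℝ≥0∞} (hG : Measurable G) :
    ∫⁻ x, F (x.1 0, x.2 0) * G (fun n => x.1 (n + 1), fun n => x.2 (n + 1))
        ∂(iidMeasure ν).prod (iidMeasure ν')
      = (∫⁻ q, F q ∂ν.prod ν') * ∫⁻ x, G x ∂(iidMeasure ν).prod (iidMeasure ν') := by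
  rw [← lintegral_prod_mul hF.aemeasurable hG.aemeasurable, ← map_head_tail_prod,
    lintegral_map (by fun_prop) (by fun_prop)]

theorem map_zip : ((iidMeasure ν).prod (iidMeasure ν')).map (fun x n => (x.1 n, x.2 n))
    = iidMeasure (ν.prod ν') := by
  have h := map_orbit_regenerative (Q := (iidMeasure ν).prod (iidMeasure ν')) (κ := ν.prod ν')
    (w := fun x => (x.1 0, x.2 0)) (T := fun x => (fun n => x.1 (n + 1), fun n => x.2 (n + 1)))
    (by fun_prop) (by fun_prop) (map_head_tail_prod ν ν')
  rw [← h]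
  congr 1
  funext x n
  have : ∀ (n : ℕ) (x : (ℕ → α) × (ℕ → β)),
      (fun x : (ℕ → α) × (ℕ → β) => (fun n => x.1 (n + 1), fun n => x.2 (n + 1)))^[n] x
        = (fun k => x.1 (k + n), fun k => x.2 (k + n)) := by
    intro n
    induction n with
    | zero => intro x; rfl
    | succ n ih =>
      intro x
      rw [Function.iterate_succ_apply, ih]
      simp only [add_assoc]
  rw [this]
  simp

end iid

/-! ### The cycles of the two disciplines and their regeneration. -/

section Cycles

variable {N : ℕ}

/-- The service cycles: source, length, service time, and lag of the next cycle. -/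
abbrev Cycle (N : ℕ) := Fin N × ℝ × ℝ × ℝ

/-- The age of source `i` as a function of the cycles. -/
noncomputable def cycleModel (i : Fin N) : CycleModel (Cycle N) where
  len w := |w.2.1|
  srv w := |w.2.2.1|
  lag w := min |w.2.2.2| |w.2.1|
  tag := {w | w.1 = i}
  measurable_len := by fun_prop
  measurable_srv := by fun_prop
  measurable_lag := by fun_prop
  measurableSet_tag := measurable_fst (measurableSet_singleton i)
  srv_nonneg w := abs_nonneg _
  lag_nonneg w := le_min (abs_nonneg _) (abs_nonneg _)
  lag_le_len w := min_le_right _ _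

/-- The gaps and the marks (source and service time) of the packets. -/
abbrev Input (N : ℕ) := (ℕ → ℝ) × (ℕ → Fin N × ℝ)

/-- The first cycle under preemption in service, if packet `0` arrives at time `0`, and the gaps
are those between the arrivals. -/
def cycleS (x : Input N) : Cycle N := ((x.2 0).1, x.1 0, (x.2 0).2, 0)

def nextS (x : Input N) : Input N := (fun n => x.1 (n + 1), fun n => x.2 (n + 1))

/-- The first cycle under preemption in waiting. -/
noncomputable def cycleW (x : Input N) : Cycle N :=
  if npts (x.2 0).2 x.1 = 0 then ((x.2 0).1, x.1 0, (x.2 0).2, 0)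
  else ((x.2 0).1, (x.2 0).2, (x.2 0).2, (x.2 0).2 - psum x.1 (npts (x.2 0).2 x.1))

/-- If K > 0 packets arrive during the service, the newest of them, packet K, enters service, and
the earlier waiting packets are dropped with their marks; the first remaining gap runs from the end
of the service. If none arrives, the next cycle starts at the next arrival and no gap is cut. -/
noncomputable def nextW (x : Input N) : Input N :=
  if npts (x.2 0).2 x.1 = 0 then nextS x
  else (residual (npts (x.2 0).2 x.1) (x.2 0).2 x.1, fun n => x.2 (n + npts (x.2 0).2 x.1))

theorem measurable_cycleS : Measurable (cycleS : Input N → _) := by unfold cycleS; fun_prop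

theorem measurable_nextS : Measurable (nextS : Input N → _) := by unfold nextS; fun_prop

theorem measurable_npts_head : Measurable fun x : Input N => npts (x.2 0).2 x.1 :=
  measurable_npts.comp (by fun_prop : Measurable fun x : Input N => ((x.2 0).2, x.1))

/-- The cycle if exactly `k` packets arrive during the service. -/
def cycleAt (k : ℕ) (x : Input N) : Cycle N :=
  if k = 0 then ((x.2 0).1, x.1 0, (x.2 0).2, 0)
  else ((x.2 0).1, (x.2 0).2, (x.2 0).2, (x.2 0).2 - psum x.1 k)

def nextAt (k : ℕ) (x : Input N) : Input N :=
  if k = 0 then nextS x else (residual k (x.2 0).2 x.1, fun n => x.2 (n + k))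

theorem measurable_cycleAt (k : ℕ) : Measurable (cycleAt k : Input N → _) := by
  unfold cycleAt
  split_ifs <;> fun_prop

theorem measurable_nextAt (k : ℕ) : Measurable (nextAt k : Input N → _) := by
  unfold nextAt
  split_ifs
  · exact measurable_nextS
  · exact ((measurable_residual k).comp (by fun_prop : Measurable fun x : Input N =>
      ((x.2 0).2, x.1))).prodMk (by fun_prop)

theorem measurable_cycleW : Measurable (cycleW : Input N → _) :=
  measurable_nat_index measurable_cycleAt measurable_npts_head

theorem measurable_nextW : Measurable (nextW : Input N → _) :=
  measurable_nat_index measurable_nextAt measurable_npts_head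

variable {r mu : ℝ} [IsProbabilityMeasure (expMeasure r)] [IsProbabilityMeasure (expMeasure mu)]
  {p : Fin N → ℝ} [IsProbabilityMeasure (srcMeasure p)]

/-- The law of the mark of a packet. -/
noncomputable abbrev markLaw (p : Fin N → ℝ) (mu : ℝ) : Measure (Fin N × ℝ) :=
  (srcMeasure p).prod (expMeasure mu)

/-- The law of the gaps and the marks. -/
noncomputable abbrev inputLaw (r : ℝ) (p : Fin N → ℝ) (mu : ℝ) [IsProbabilityMeasure (expMeasure r)]
    [IsProbabilityMeasure (expMeasure mu)] [IsProbabilityMeasure (srcMeasure p)] :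
    Measure (Input N) :=
  (iidMeasure (expMeasure r)).prod (iidMeasure (markLaw p mu))

theorem map_cycleS_nextS : (inputLaw r p mu).map (fun x => (cycleS x, nextS x))
    = ((inputLaw r p mu).map cycleS).prod (inputLaw r p mu) := by
  have h := map_head_tail_prod (expMeasure r) (markLaw p mu)
  set f : ℝ × Fin N × ℝ → Cycle N := fun q => (q.2.1, q.1, q.2.2, 0) with hf
  have hfm : Measurable f := by fun_prop
  have h1 : (inputLaw r p mu).map cycleS = ((expMeasure r).prod (markLaw p mu)).map f := by
    have := congrArg (Measure.map fun q : (ℝ × Fin N × ℝ) × Input N => f q.1) h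
    have e : (((expMeasure r).prod (markLaw p mu)).prod (inputLaw r p mu)).map (fun q => f q.1)
        = ((expMeasure r).prod (markLaw p mu)).map f := by
      rw [show (fun q : (ℝ × Fin N × ℝ) × Input N => f q.1) = f ∘ Prod.fst from rfl,
        ← Measure.map_map hfm measurable_fst, Measure.map_fst_prod]
      simp
    rw [Measure.map_map (by fun_prop) (by fun_prop), e] at this
    exact this
  have h2 := congrArg (Measure.map (Prod.map f (id : Input N → Input N))) h
  rw [Measure.map_map (by fun_prop) (by fun_prop), ← Measure.map_prod_map _ _ hfm measurable_id,
    Measure.map_id, ← h1] at h2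
  exact h2

theorem ae_inputLaw (hr : 0 < r) (hmu : 0 < mu) : ∀ᵐ x ∂inputLaw r p mu,
    IsProper x.1 ∧ ∀ n, 0 < (x.2 n).2 := by
  have h1 : ∀ᵐ x ∂inputLaw r p mu, IsProper x.1 :=
    Measure.quasiMeasurePreserving_fst.ae (ae_isProper hr)
  have h2 : ∀ᵐ m ∂markLaw p mu, 0 < m.2 :=
    Measure.quasiMeasurePreserving_snd.ae (ae_expMeasure_pos hmu)
  have h3 : ∀ᵐ x ∂inputLaw r p mu, ∀ n, 0 < (x.2 n).2 :=
    Measure.quasiMeasurePreserving_snd.ae (ae_iidMeasure _ h2)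
  filter_upwards [h1, h3] with x a b using ⟨a, b⟩

/-- The part of the state space where `k` packets arrive during the service. -/
def busyAt (N k : ℕ) : Set (Input N) := {x | x.1 ∈ exactly k (x.2 0).2}

theorem measurableSet_busyAt (k : ℕ) : MeasurableSet (busyAt N k) :=
  (measurableSet_le (by fun_prop : Measurable fun x : Input N => psum x.1 k)
    (by fun_prop : Measurable fun x : Input N => (x.2 0).2)).inter
    (measurableSet_lt (by fun_prop : Measurable fun x : Input N => (x.2 0).2)
      (by fun_prop : Measurable fun x : Input N => psum x.1 (k + 1)))

theorem tsum_busyAt {x : Input N} (hx : IsProper x.1) (hv : 0 ≤ (x.2 0).2)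
    (f : ℕ → Input N → ℝ≥0∞) :
    ∑' k, (busyAt N k).indicator (f k) x = f (npts (x.2 0).2 x.1) x := by
  rw [tsum_eq_single (npts (x.2 0).2 x.1)]
  · exact Set.indicator_of_mem (s := busyAt N _) (hx.mem_exactly hv) _
  · intro k hk
    exact Set.indicator_of_notMem (s := busyAt N k) (fun h => hk ((hx.npts_eq_iff hv).2 h).symm) _

/-- With no arrival during the service the cycle depends only on the first gap and the first mark,
and the next input only on the later terms. -/
theorem lintegral_idle {f : Cycle N → ℝ≥0∞} (hf : Measurable f)
    {g : Input N → ℝ≥0∞} (hg : Measurable g) :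
    ∫⁻ x, (busyAt N 0).indicator (fun x => f (cycleAt 0 x) * g (nextAt 0 x)) x ∂inputLaw r p mu
      = (∫⁻ q, {q : ℝ × Fin N × ℝ | 0 ≤ q.2.2 ∧ q.2.2 < q.1}.indicator
          (fun q => f (q.2.1, q.1, q.2.2, 0)) q ∂(expMeasure r).prod (markLaw p mu))
        * ∫⁻ x, g x ∂inputLaw r p mu := by
  have hS : MeasurableSet {q : ℝ × Fin N × ℝ | 0 ≤ q.2.2 ∧ q.2.2 < q.1} :=
    (measurableSet_le measurable_const (by fun_prop : Measurable fun q : ℝ × Fin N × ℝ => q.2.2)).inter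
      (measurableSet_lt (by fun_prop : Measurable fun q : ℝ × Fin N × ℝ => q.2.2) measurable_fst)
  rw [← lintegral_head_mul_tail (expMeasure r) (markLaw p mu)
    ((by fun_prop : Measurable fun q : ℝ × Fin N × ℝ => f (q.2.1, q.1, q.2.2, 0)).indicator hS) hg]
  refine lintegral_congr fun x => ?_
  have hmem : x ∈ busyAt N 0 ↔ (x.1 0, x.2 0) ∈ {q : ℝ × Fin N × ℝ | 0 ≤ q.2.2 ∧ q.2.2 < q.1} := by
    simp only [busyAt, exactly, Set.mem_ofPred_eq, psum_succ, psum_zero, zero_add]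
  by_cases h : x ∈ busyAt N 0
  · rw [Set.indicator_of_mem h, Set.indicator_of_mem (hmem.1 h)]
    simp [cycleAt, nextAt, nextS]
  · rw [Set.indicator_of_notMem h, Set.indicator_of_notMem (mt hmem.2 h), zero_mul]

/-- For fixed marks the residual gaps are fresh and independent of the last arrival time, by
`lintegral_exactly_residual`. Then the mark of packet 0 is separated from the marks of index at
least j + 1; the marks in between belong to discarded packets and are never used. -/
theorem lintegral_busy (hr : 0 < r) (j : ℕ) {f : Cycle N → ℝ≥0∞} (hf : Measurable f)
    {g : Input N → ℝ≥0∞} (hg : Measurable g) :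
    ∫⁻ x, (busyAt N (j + 1)).indicator (fun x => f (cycleAt (j + 1) x) * g (nextAt (j + 1) x)) x
        ∂inputLaw r p mu
      = (∫⁻ m, ∫⁻ τ, (exactly (j + 1) m.2).indicator
          (fun τ => f (m.1, m.2, m.2, m.2 - psum τ (j + 1))) τ ∂iidMeasure (expMeasure r)
          ∂markLaw p mu) * ∫⁻ x, g x ∂inputLaw r p mu := by
  have hS : MeasurableSet {q : (ℕ → ℝ) × Fin N × ℝ | q.1 ∈ exactly (j + 1) q.2.2} :=
    (measurableSet_le (by fun_prop : Measurable fun q : (ℕ → ℝ) × Fin N × ℝ => psum q.1 (j + 1))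
      (by fun_prop : Measurable fun q : (ℕ → ℝ) × Fin N × ℝ => q.2.2)).inter
      (measurableSet_lt (by fun_prop : Measurable fun q : (ℕ → ℝ) × Fin N × ℝ => q.2.2)
        (by fun_prop : Measurable fun q : (ℕ → ℝ) × Fin N × ℝ => psum q.1 (j + 1 + 1)))
  have hF : Measurable fun m : Fin N × ℝ => ∫⁻ τ, (exactly (j + 1) m.2).indicator
      (fun τ => f (m.1, m.2, m.2, m.2 - psum τ (j + 1))) τ ∂iidMeasure (expMeasure r) :=
    Measurable.lintegral_prod_left' (f := {q : (ℕ → ℝ) × Fin N × ℝ | q.1 ∈ exactly (j + 1) q.2.2}.indicator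
      fun q => f (q.2.1, q.2.2, q.2.2, q.2.2 - psum q.1 (j + 1)))
      (Measurable.indicator (by fun_prop) hS)
  have hΦ : Measurable fun m : ℕ → Fin N × ℝ => ∫⁻ τ, g (τ, m) ∂iidMeasure (expMeasure r) :=
    hg.lintegral_prod_left'
  have hm : Measurable ((busyAt N (j + 1)).indicator
      fun x => f (cycleAt (j + 1) x) * g (nextAt (j + 1) x)) :=
    ((hf.comp (measurable_cycleAt _)).mul (hg.comp (measurable_nextAt _))).indicator
      (measurableSet_busyAt _)
  rw [lintegral_prod_symm' _ hm, lintegral_prod_symm' _ hg, ← lintegral_iidMeasure_head_mul (markLaw p mu) hF hΦ j]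
  refine lintegral_congr fun m => ?_
  have h1 := lintegral_exactly_residual hr (φ := fun τ => g (τ, fun n => m (n + (j + 1))))
    (by fun_prop) (j + 1) (g := fun y => f ((m 0).1, (m 0).2, (m 0).2, (m 0).2 - y))
    (by fun_prop) (m 0).2
  rw [← h1]
  rfl

theorem lintegral_busyAt (hr : 0 < r) (k : ℕ) {f : Cycle N → ℝ≥0∞} (hf : Measurable f)
    {g : Input N → ℝ≥0∞} (hg : Measurable g) :
    ∫⁻ x, (busyAt N k).indicator (fun x => f (cycleAt k x) * g (nextAt k x)) x ∂inputLaw r p mu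
      = (∫⁻ x, (busyAt N k).indicator (fun x => f (cycleAt k x)) x ∂inputLaw r p mu)
        * ∫⁻ x, g x ∂inputLaw r p mu := by
  cases k with
  | zero =>
    have h1 := lintegral_idle (r := r) (mu := mu) (p := p) hf (measurable_const (a := (1 : ℝ≥0∞)))
    simp only [mul_one, lintegral_const, measure_univ] at h1
    rw [lintegral_idle hf hg, h1]
  | succ j =>
    have h1 := lintegral_busy (mu := mu) (p := p) hr j hf (measurable_const (a := (1 : ℝ≥0∞)))
    simp only [mul_one, lintegral_const, measure_univ] at h1
    rw [lintegral_busy hr j hf hg, h1]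

/-- The number of arrivals during the service decides which formula applies, so the space is
partitioned by it. On each part the contribution factors with the same second factor, the full law
of the input, and the parts can be added. -/
theorem map_cycleW_nextW (hr : 0 < r) (hmu : 0 < mu) :
    (inputLaw r p mu).map (fun x => (cycleW x, nextW x))
      = ((inputLaw r p mu).map cycleW).prod (inputLaw r p mu) := by
  symm
  refine Measure.prod_eq fun A B hA hB => ?_
  have hA1 : Measurable (A.indicator (1 : Cycle N → ℝ≥0∞)) := measurable_one.indicator hA
  have hB1 : Measurable (B.indicator (1 : Input N → ℝ≥0∞)) := measurable_one.indicator hB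
  have hm1 : ∀ k, Measurable ((busyAt N k).indicator fun x =>
      A.indicator (1 : Cycle N → ℝ≥0∞) (cycleAt k x)) := fun k =>
    (hA1.comp (measurable_cycleAt k)).indicator (measurableSet_busyAt k)
  have hm2 : ∀ k, Measurable ((busyAt N k).indicator fun x =>
      A.indicator (1 : Cycle N → ℝ≥0∞) (cycleAt k x) * B.indicator 1 (nextAt k x)) := fun k =>
    ((hA1.comp (measurable_cycleAt k)).mul (hB1.comp (measurable_nextAt k))).indicator
      (measurableSet_busyAt k)
  rw [Measure.map_apply (measurable_cycleW.prodMk measurable_nextW) (hA.prod hB),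
    Measure.map_apply measurable_cycleW hA, ← lintegral_indicator_one (measurable_cycleW hA),
    ← lintegral_indicator_one ((measurable_cycleW.prodMk measurable_nextW) (hA.prod hB)),
    ← lintegral_indicator_one hB]
  have e1 : ∫⁻ x, (cycleW ⁻¹' A).indicator 1 x ∂inputLaw r p mu
      = ∑' k, ∫⁻ x, (busyAt N k).indicator (fun x => A.indicator 1 (cycleAt k x)) x
        ∂inputLaw r p mu := by
    rw [← lintegral_tsum fun k => (hm1 k).aemeasurable]
    refine lintegral_congr_ae ?_
    filter_upwards [ae_inputLaw hr hmu] with x hx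
    rw [tsum_busyAt hx.1 (hx.2 0).le fun k x => A.indicator 1 (cycleAt k x)]
    rfl
  have e2 : ∫⁻ x, ((fun x => (cycleW x, nextW x)) ⁻¹' A ×ˢ B).indicator 1 x ∂inputLaw r p mu
      = ∑' k, ∫⁻ x, (busyAt N k).indicator
        (fun x => A.indicator 1 (cycleAt k x) * B.indicator 1 (nextAt k x)) x ∂inputLaw r p mu := by
    rw [← lintegral_tsum fun k => (hm2 k).aemeasurable]
    refine lintegral_congr_ae ?_
    filter_upwards [ae_inputLaw hr hmu] with x hx
    rw [tsum_busyAt hx.1 (hx.2 0).le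
      fun k x => A.indicator 1 (cycleAt k x) * B.indicator 1 (nextAt k x)]
    have : A.indicator (1 : Cycle N → ℝ≥0∞) (cycleW x) * B.indicator (1 : Input N → ℝ≥0∞) (nextW x)
        = ((fun x => (cycleW x, nextW x)) ⁻¹' A ×ˢ B).indicator 1 x := by
      by_cases h1 : cycleW x ∈ A
      · by_cases h2 : nextW x ∈ B
        · rw [Set.indicator_of_mem h1, Set.indicator_of_mem h2,
            Set.indicator_of_mem (by exact ⟨h1, h2⟩)]
          simp
        · rw [Set.indicator_of_notMem h2, Set.indicator_of_notMem
            (s := (fun x => (cycleW x, nextW x)) ⁻¹' A ×ˢ B) (fun h => h2 h.2), mul_zero]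
      · rw [Set.indicator_of_notMem h1, Set.indicator_of_notMem
          (s := (fun x => (cycleW x, nextW x)) ⁻¹' A ×ˢ B) (fun h => h1 h.1), zero_mul]
    rw [← this]
    rfl
  rw [e1, e2, ← ENNReal.tsum_mul_right]
  exact tsum_congr fun k => lintegral_busyAt hr k hA1 hB1

end Cycles

/-! ### Two independent exponential variables -/

/-- Tilting an exponential density of rate b by exp(-a x) gives that of rate a + b, up to the
probability b / (a + b) that the clock of rate b rings first. -/
theorem lintegral_exp_mul_expMeasure {a b : ℝ} (ha : 0 ≤ a) (hb : 0 < b) {H : ℝ → ℝ≥0∞}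
    (hH : Measurable H) :
    ∫⁻ x, ENNReal.ofReal (Real.exp (-(a * x))) * H x ∂expMeasure b
      = ENNReal.ofReal (b / (a + b)) * ∫⁻ x, H x ∂expMeasure (a + b) := by
  have hab : 0 < a + b := by positivity
  rw [lintegral_expMeasure (by fun_prop), lintegral_expMeasure hH, ← lintegral_const_mul _ (by fun_prop)]
  refine lintegral_congr fun x => ?_
  rw [mul_right_comm, mul_comm (H x), ← mul_assoc, ← ENNReal.ofReal_mul (Real.exp_pos _).le,
    ← ENNReal.ofReal_mul (by positivity)]
  congr 2
  rw [show -((a + b) * x) = -(a * x) + -(b * x) by ring, Real.exp_add]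
  field_simp

theorem expMeasure_Ioi_of_neg {r : ℝ} (hr : 0 < r) {t : ℝ} (ht : t < 0) :
    expMeasure r (Set.Ioi t) = 1 := by
  have : IsProbabilityMeasure (expMeasure r) := isProbabilityMeasure_expMeasure hr
  refine le_antisymm prob_le_one ?_
  have h := expMeasure_Ioi hr le_rfl
  rw [mul_zero, neg_zero, Real.exp_zero, ENNReal.ofReal_one] at h
  rw [← h]
  exact measure_mono (Set.Ioi_subset_Ioi ht.le)

section Pair

variable {r mu : ℝ} [IsProbabilityMeasure (expMeasure r)] [IsProbabilityMeasure (expMeasure mu)]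

theorem map_min_expMeasure (hr : 0 < r) (hmu : 0 < mu) :
    ((expMeasure r).prod (expMeasure mu)).map (fun q => min q.1 q.2) = expMeasure (r + mu) := by
  have h1 : IsProbabilityMeasure (expMeasure (r + mu)) := isProbabilityMeasure_expMeasure (by positivity)
  have hm : Measurable fun q : ℝ × ℝ => min q.1 q.2 := by fun_prop
  have h2 : IsProbabilityMeasure (((expMeasure r).prod (expMeasure mu)).map fun q => min q.1 q.2) :=
    Measure.isProbabilityMeasure_map hm.aemeasurable
  refine Measure.ext_of_Iic _ _ fun t => ?_
  have key : ((expMeasure r).prod (expMeasure mu)).map (fun q => min q.1 q.2) (Set.Ioi t)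
      = expMeasure (r + mu) (Set.Ioi t) := by
    rw [Measure.map_apply hm measurableSet_Ioi]
    have : (fun q : ℝ × ℝ => min q.1 q.2) ⁻¹' Set.Ioi t = Set.Ioi t ×ˢ Set.Ioi t := by
      ext q; simp
    rw [this, Measure.prod_prod]
    rcases lt_or_ge t 0 with ht | ht
    · rw [expMeasure_Ioi_of_neg hr ht, expMeasure_Ioi_of_neg hmu ht,
        expMeasure_Ioi_of_neg (by positivity) ht, one_mul]
    · rw [expMeasure_Ioi hr ht, expMeasure_Ioi hmu ht, expMeasure_Ioi (by positivity) ht,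
        ← ENNReal.ofReal_mul (Real.exp_pos _).le, ← Real.exp_add]
      congr 2; ring
  rw [← Set.compl_Ioi, prob_compl_eq_one_sub measurableSet_Ioi,
    prob_compl_eq_one_sub measurableSet_Ioi, key]

theorem integrable_fst_pow (hr : 0 < r) (n : ℕ) :
    Integrable (fun q : ℝ × ℝ => q.1 ^ n) ((expMeasure r).prod (expMeasure mu)) :=
  (integrable_pow_expMeasure hr n).comp_fst _

theorem integrable_snd_pow (hmu : 0 < mu) (n : ℕ) :
    Integrable (fun q : ℝ × ℝ => q.2 ^ n) ((expMeasure r).prod (expMeasure mu)) :=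
  (integrable_pow_expMeasure hmu n).comp_snd _

theorem integrable_min_pow (hr : 0 < r) (hmu : 0 < mu) (n : ℕ) :
    Integrable (fun q : ℝ × ℝ => min q.1 q.2 ^ n) ((expMeasure r).prod (expMeasure mu)) := by
  have h := integrable_pow_expMeasure (r := r + mu) (by positivity) n
  rw [← map_min_expMeasure hr hmu, integrable_map_measure (by fun_prop) (by fun_prop)] at h
  exact h

theorem integral_fst_pow (hr : 0 < r) (n : ℕ) :
    ∫ q : ℝ × ℝ, q.1 ^ n ∂(expMeasure r).prod (expMeasure mu) = n.factorial / r ^ n := by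
  rw [integral_fun_fst (f := fun x : ℝ => x ^ n), integral_pow_expMeasure hr]
  simp

theorem integral_snd_pow (hmu : 0 < mu) (n : ℕ) :
    ∫ q : ℝ × ℝ, q.2 ^ n ∂(expMeasure r).prod (expMeasure mu) = n.factorial / mu ^ n := by
  rw [integral_fun_snd (f := fun x : ℝ => x ^ n), integral_pow_expMeasure hmu]
  simp

theorem integral_min_pow (hr : 0 < r) (hmu : 0 < mu) (n : ℕ) :
    ∫ q : ℝ × ℝ, min q.1 q.2 ^ n ∂(expMeasure r).prod (expMeasure mu)
      = n.factorial / (r + mu) ^ n := by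
  rw [← integral_pow_expMeasure (r := r + mu) (by positivity) n, ← map_min_expMeasure hr hmu,
    integral_map (by fun_prop) (by fun_prop)]

theorem max_pow_eq (a b : ℝ) (n : ℕ) : max a b ^ n = a ^ n + b ^ n - min a b ^ n := by
  rcases le_total a b with h | h
  · rw [max_eq_right h, min_eq_left h]; ring
  · rw [max_eq_left h, min_eq_right h]; ring

theorem integrable_max_pow (hr : 0 < r) (hmu : 0 < mu) (n : ℕ) :
    Integrable (fun q : ℝ × ℝ => max q.1 q.2 ^ n) ((expMeasure r).prod (expMeasure mu)) := by
  simp_rw [max_pow_eq]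
  exact ((integrable_fst_pow hr n).add (integrable_snd_pow hmu n)).sub (integrable_min_pow hr hmu n)

theorem integral_max_pow (hr : 0 < r) (hmu : 0 < mu) (n : ℕ) :
    ∫ q : ℝ × ℝ, max q.1 q.2 ^ n ∂(expMeasure r).prod (expMeasure mu)
      = n.factorial / r ^ n + n.factorial / mu ^ n - n.factorial / (r + mu) ^ n := by
  simp_rw [max_pow_eq]
  rw [integral_sub (by exact (integrable_fst_pow hr n).add (integrable_snd_pow hmu n))
    (integrable_min_pow hr hmu n), integral_add (integrable_fst_pow hr n) (integrable_snd_pow hmu n),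
    integral_fst_pow hr, integral_snd_pow hmu, integral_min_pow hr hmu]

theorem integral_max_sub (hr : 0 < r) (hmu : 0 < mu) :
    ∫ q : ℝ × ℝ, max (q.1 - q.2) 0 ∂(expMeasure r).prod (expMeasure mu) = 1 / r - 1 / (r + mu) := by
  have h : ∀ q : ℝ × ℝ, max (q.1 - q.2) 0 = q.1 ^ 1 - min q.1 q.2 ^ 1 := by
    intro q
    rcases le_total q.1 q.2 with h | h
    · rw [max_eq_right (by linarith), min_eq_left h]; ring
    · rw [max_eq_left (by linarith), min_eq_right h]; ring
  simp_rw [h]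
  rw [integral_sub (integrable_fst_pow hr 1) (integrable_min_pow hr hmu 1), integral_fst_pow hr,
    integral_min_pow hr hmu]
  simp

theorem prod_expMeasure_lt_max (hr : 0 < r) (hmu : 0 < mu) {v : ℝ} (hv : 0 ≤ v) :
    ((expMeasure r).prod (expMeasure mu)) {q | v < max q.1 q.2}
      = ENNReal.ofReal (Real.exp (-(mu * v)) + Real.exp (-(r * v)) - Real.exp (-((r + mu) * v))) := by
  have h1 : {q : ℝ × ℝ | v < max q.1 q.2} = (Set.Iic v ×ˢ Set.Iic v)ᶜ := by
    ext q
    simp only [Set.mem_ofPred_eq, lt_max_iff, Set.mem_compl_iff, Set.mem_prod, Set.mem_Iic,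
      not_and_or, not_le]
  have h2 : ∀ {b : ℝ}, 0 < b → ∀ [IsProbabilityMeasure (expMeasure b)],
      expMeasure b (Set.Iic v) = ENNReal.ofReal (1 - Real.exp (-(b * v))) := by
    intro b hb _
    rw [← Set.compl_Ioi, prob_compl_eq_one_sub measurableSet_Ioi, expMeasure_Ioi hb hv,
      ENNReal.ofReal_sub _ (Real.exp_pos _).le, ENNReal.ofReal_one]
  have h3 : ∀ {b : ℝ}, 0 < b → 0 ≤ 1 - Real.exp (-(b * v)) := fun hb =>
    sub_nonneg.2 (Real.exp_le_one_iff.2 (by simp; positivity))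
  rw [h1, prob_compl_eq_one_sub (measurableSet_Iic.prod measurableSet_Iic), Measure.prod_prod,
    h2 hr, h2 hmu, ← ENNReal.ofReal_mul (h3 hr), ← ENNReal.ofReal_one, ← ENNReal.ofReal_sub _
      (mul_nonneg (h3 hr) (h3 hmu))]
  congr 1
  rw [show -((r + mu) * v) = -(r * v) + -(mu * v) by ring, Real.exp_add]
  ring

theorem prod_expMeasure_le (hr : 0 < r) (hmu : 0 < mu) :
    ((expMeasure r).prod (expMeasure mu)) {q | q.2 ≤ q.1} = ENNReal.ofReal (mu / (r + mu)) := by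
  have : IsProbabilityMeasure (expMeasure (r + mu)) := isProbabilityMeasure_expMeasure (by positivity)
  rw [Measure.prod_apply_symm (measurableSet_le measurable_snd measurable_fst)]
  have h1 : ∀ᵐ v ∂expMeasure mu, expMeasure r ((fun x => (x, v)) ⁻¹' {q : ℝ × ℝ | q.2 ≤ q.1})
      = ENNReal.ofReal (Real.exp (-(r * v))) * 1 := by
    filter_upwards [ae_expMeasure_pos hmu] with v hv
    have e : (fun x => (x, v)) ⁻¹' {q : ℝ × ℝ | q.2 ≤ q.1} = Set.Ici v := by ext x; simp
    rw [e, mul_one, ← expMeasure_Ioi hr hv.le]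
    have hac : expMeasure r ≪ volume := withDensity_absolutelyContinuous _ _
    exact (measure_congr (hac.ae_eq Ioi_ae_eq_Ici)).symm
  rw [lintegral_congr_ae h1, lintegral_exp_mul_expMeasure hr.le hmu measurable_const]
  simp

/-- The expected time since the last arrival at the end of a service during which `k` packets have
arrived. -/
theorem lintegral_exactly_sub (hr : 0 < r) (hmu : 0 < mu) (k : ℕ) :
    ∫⁻ v, ∫⁻ τ, (exactly k v).indicator (fun τ => ENNReal.ofReal (v - psum τ k)) τ
        ∂iidMeasure (expMeasure r) ∂expMeasure mu
      = ENNReal.ofReal ((r / (r + mu)) ^ k * (mu / (r + mu) ^ 2)) := by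
  have hmeas : ∀ k, Measurable fun v => ∫⁻ τ, (exactly k v).indicator
      (fun τ => ENNReal.ofReal (v - psum τ k)) τ ∂iidMeasure (expMeasure r) := by
    intro k
    have hS : MeasurableSet {q : ℝ × (ℕ → ℝ) | q.2 ∈ exactly k q.1} :=
      (measurableSet_le (by fun_prop : Measurable fun q : ℝ × (ℕ → ℝ) => psum q.2 k)
        measurable_fst).inter
        (measurableSet_lt measurable_fst
          (by fun_prop : Measurable fun q : ℝ × (ℕ → ℝ) => psum q.2 (k + 1)))
    exact Measurable.lintegral_prod_right' (f := {q : ℝ × (ℕ → ℝ) | q.2 ∈ exactly k q.1}.indicator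
      fun q => ENNReal.ofReal (q.1 - psum q.2 k)) (Measurable.indicator (by fun_prop) hS)
  have hmi : ∀ k v, Measurable ((exactly k v).indicator
      (fun τ => ENNReal.ofReal (v - psum τ k))) := fun k v =>
    Measurable.indicator (by fun_prop) (measurableSet_exactly k v)
  have hsum : IsProbabilityMeasure (expMeasure (r + mu)) :=
    isProbabilityMeasure_expMeasure (by positivity)
  induction k with
  | zero =>
    have h1 : ∀ᵐ v ∂expMeasure mu, ∫⁻ τ, (exactly 0 v).indicator
        (fun τ => ENNReal.ofReal (v - psum τ 0)) τ ∂iidMeasure (expMeasure r)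
        = ENNReal.ofReal (Real.exp (-(r * v))) * ENNReal.ofReal (v ^ 1) := by
      filter_upwards [ae_expMeasure_pos hmu] with v hv
      simp only [psum_zero, sub_zero, pow_one]
      rw [lintegral_indicator (measurableSet_exactly 0 v), setLIntegral_const,
        iidMeasure_exactly hr 0 v hv.le, mul_comm]
      simp
    rw [lintegral_congr_ae h1, lintegral_exp_mul_expMeasure hr.le hmu (by fun_prop),
      lintegral_pow_expMeasure (by positivity), ← ENNReal.ofReal_mul (by positivity)]
    congr 1
    simp
    field_simp
  | succ k ih =>
    have h1 : ∀ v, ∫⁻ τ, (exactly (k + 1) v).indicator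
        (fun τ => ENNReal.ofReal (v - psum τ (k + 1))) τ ∂iidMeasure (expMeasure r)
        = ∫⁻ x, (fun y => ∫⁻ τ, (exactly k y).indicator (fun τ => ENNReal.ofReal (y - psum τ k)) τ
          ∂iidMeasure (expMeasure r)) (v - x) ∂expMeasure r := by
      intro v
      rw [lintegral_iidMeasure_scons _ (hmi (k + 1) v)]
      refine lintegral_congr fun x => lintegral_congr fun τ => ?_
      by_cases h : scons x τ ∈ exactly (k + 1) v
      · rw [Set.indicator_of_mem h, Set.indicator_of_mem (scons_mem_exactly.1 h), psum_scons]
        congr 1; ring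
      · rw [Set.indicator_of_notMem h, Set.indicator_of_notMem (mt scons_mem_exactly.2 h)]
    set I : ℝ → ℝ≥0∞ := fun y => ∫⁻ τ, (exactly k y).indicator
      (fun τ => ENNReal.ofReal (y - psum τ k)) τ ∂iidMeasure (expMeasure r) with hI
    have hneg : ∀ y, y < 0 → I y = 0 := by
      intro y hy
      rw [hI]
      simp only
      rw [lintegral_indicator (measurableSet_exactly k y),
        setLIntegral_measure_zero _ _ (iidMeasure_exactly_of_neg hr k hy)]
    simp_rw [h1]
    have hIm : Measurable (Function.uncurry fun v x => I (v - x)) :=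
      (hmeas k).comp (measurable_fst.sub measurable_snd)
    rw [lintegral_lintegral_swap hIm.aemeasurable]
    -- The service must outlast the first gap x, and by memorylessness what remains of it is again
    -- exponential. Integrating exp(-mu x) over x gives the factor r / (r + mu) per arrival. The
    -- null set v = x reconciles the strict inequality of the memoryless formula with `I 0`.
    have h2 : ∀ᵐ x ∂expMeasure r, ∫⁻ v, I (v - x) ∂expMeasure mu
        = ENNReal.ofReal (Real.exp (-(mu * x))) * ∫⁻ v, I v ∂expMeasure mu := by
      filter_upwards [ae_expMeasure_pos hr] with x hx
      rw [← lintegral_expMeasure_sub hx.le (hmeas k)]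
      refine lintegral_congr_ae ?_
      have hac : expMeasure mu ≪ volume := withDensity_absolutelyContinuous _ _
      have hx' : ∀ᵐ v ∂expMeasure mu, v ≠ x := hac.ae_le
        (Measure.ae_ne volume x)
      filter_upwards [hx'] with v hv
      rcases lt_or_gt_of_ne hv with hlt | hlt
      · rw [Set.indicator_of_notMem (by simpa using hlt.le), hneg _ (by linarith)]
      · rw [Set.indicator_of_mem (Set.mem_Ioi.2 hlt)]
    rw [lintegral_congr_ae h2, lintegral_exp_mul_expMeasure hmu.le hr measurable_const]
    rw [lintegral_const, add_comm mu r, measure_univ, mul_one, ih, ← ENNReal.ofReal_mul (by positivity)]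
    congr 1
    rw [pow_succ]; ring

end Pair

/-! ### The moments of a cycle -/

theorem srcMeasure_singleton {N : ℕ} (p : Fin N → ℝ) (i : Fin N) :
    srcMeasure p {i} = ENNReal.ofReal (p i) := by
  rw [← lintegral_indicator_one (measurableSet_singleton i), lintegral_srcMeasure,
    Finset.sum_eq_single i]
  · simp
  · intro j _ hj
    rw [Set.indicator_of_notMem (by simpa using hj), mul_zero]
  · simp

section Moments

variable {N : ℕ} {r mu : ℝ} [IsProbabilityMeasure (expMeasure r)]
  [IsProbabilityMeasure (expMeasure mu)] {p : Fin N → ℝ} [IsProbabilityMeasure (srcMeasure p)]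

theorem map_head_inputLaw :
    (inputLaw r p mu).map (fun x => ((x.2 0).1, (x.1 0, (x.2 0).2)))
      = (srcMeasure p).prod ((expMeasure r).prod (expMeasure mu)) := by
  have h := congrArg (Measure.map Prod.fst) (map_head_tail_prod (expMeasure r) (markLaw p mu))
  rw [Measure.map_map (by fun_prop) (by fun_prop), Measure.map_fst_prod, measure_univ, one_smul] at h
  have h2 := congrArg (Measure.map fun q : ℝ × Fin N × ℝ => (q.2.1, (q.1, q.2.2))) h
  rw [Measure.map_map (by fun_prop) (by fun_prop)] at h2
  refine h2.trans (Measure.ext_of_lintegral _ fun f hf => ?_)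
  rw [lintegral_map hf (by fun_prop), lintegral_prod _ (by fun_prop), lintegral_prod _ (by fun_prop)]
  simp_rw [fun x => lintegral_prod (μ := srcMeasure p) (ν := expMeasure mu)
      (fun q : Fin N × ℝ => f (q.1, (x, q.2))) (by fun_prop),
    fun z => lintegral_prod (μ := expMeasure r) (ν := expMeasure mu)
      (fun q : ℝ × ℝ => f (z, q)) (by fun_prop)]
  rw [lintegral_lintegral_swap]
  exact (Measurable.lintegral_prod_right' (f := fun p : (ℝ × Fin N) × ℝ =>
    f (p.1.2, (p.1.1, p.2))) (by fun_prop)).aemeasurable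

/-- The cycle is that of the first packet, and its length is a function of the first gap and the
first service time. -/
structure IsFirstCycle (r : ℝ) (p : Fin N → ℝ) (mu : ℝ) [IsProbabilityMeasure (expMeasure r)]
    [IsProbabilityMeasure (expMeasure mu)] [IsProbabilityMeasure (srcMeasure p)]
    (cyc : Input N → Cycle N) (L : ℝ × ℝ → ℝ) : Prop where
  measurable : Measurable cyc
  measurable_len : Measurable L
  ae_eq : ∀ᵐ x ∂inputLaw r p mu, (cyc x).1 = (x.2 0).1 ∧ |(cyc x).2.1| = L (x.1 0, (x.2 0).2) ∧
    |(cyc x).2.2.1| = (x.2 0).2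

namespace IsFirstCycle

variable {cyc : Input N → Cycle N} {L : ℝ × ℝ → ℝ}

theorem map_eq (h : IsFirstCycle r p mu cyc L) :
    ((inputLaw r p mu).map cyc).map (fun w => (w.1, |w.2.1|, |w.2.2.1|))
      = ((srcMeasure p).prod ((expMeasure r).prod (expMeasure mu))).map
          (fun y => (y.1, L y.2, y.2.2)) := by
  have hL := h.measurable_len
  rw [Measure.map_map (by fun_prop) h.measurable, ← map_head_inputLaw,
    Measure.map_map (by fun_prop) (by fun_prop)]
  refine Measure.map_congr ?_
  filter_upwards [h.ae_eq] with x hx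
  simp only [Function.comp_apply]
  rw [hx.1, hx.2.1, hx.2.2]

theorem integral_eq (h : IsFirstCycle r p mu cyc L) {F : Fin N × ℝ × ℝ → ℝ} (hF : Measurable F) :
    ∫ w, F (w.1, |w.2.1|, |w.2.2.1|) ∂(inputLaw r p mu).map cyc
      = ∫ y, F (y.1, L y.2, y.2.2) ∂(srcMeasure p).prod ((expMeasure r).prod (expMeasure mu)) := by
  have hL := h.measurable_len
  rw [← integral_map (φ := fun w : Cycle N => (w.1, |w.2.1|, |w.2.2.1|)) (f := F) (by fun_prop)
    hF.aestronglyMeasurable, h.map_eq, integral_map (by fun_prop) hF.aestronglyMeasurable]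

theorem measure_eq (h : IsFirstCycle r p mu cyc L) {A : Set (Fin N × ℝ × ℝ)} (hA : MeasurableSet A) :
    (inputLaw r p mu).map cyc {w | (w.1, |w.2.1|, |w.2.2.1|) ∈ A}
      = (srcMeasure p).prod ((expMeasure r).prod (expMeasure mu)) {y | (y.1, L y.2, y.2.2) ∈ A} := by
  have hL := h.measurable_len
  have e := DFunLike.congr_fun h.map_eq A
  rw [Measure.map_apply (by fun_prop) hA, Measure.map_apply (by fun_prop) hA] at e
  exact e

variable (i : Fin N)

theorem integral_len_pow (h : IsFirstCycle r p mu cyc L) (n : ℕ) :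
    ∫ w, (cycleModel i).len w ^ n ∂(inputLaw r p mu).map cyc
      = ∫ q, L q ^ n ∂(expMeasure r).prod (expMeasure mu) := by
  have e := h.integral_eq (F := fun y => y.2.1 ^ n) (by fun_prop)
  refine e.trans ?_
  rw [integral_fun_snd (f := fun q => L q ^ n)]
  simp

theorem measure_lt_len (h : IsFirstCycle r p mu cyc L) (v : ℝ) :
    (inputLaw r p mu).map cyc {w | v < (cycleModel i).len w}
      = ((expMeasure r).prod (expMeasure mu)) {q | v < L q} := by
  have e := h.measure_eq (A := {y | v < y.2.1}) (measurableSet_lt measurable_const (by fun_prop))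
  refine e.trans ?_
  have : {y : Fin N × ℝ × ℝ | (y.1, L y.2, y.2.2) ∈ {y : Fin N × ℝ × ℝ | v < y.2.1}}
      = Set.univ ×ˢ {q | v < L q} := by ext y; simp
  rw [this, Measure.prod_prod, measure_univ, one_mul]

theorem measureReal_hit (h : IsFirstCycle r p mu cyc L) (hp : 0 ≤ p i) :
    ((inputLaw r p mu).map cyc).real (cycleModel i).hit
      = p i * ((expMeasure r).prod (expMeasure mu)).real {q | q.2 ≤ L q} := by
  have e := h.measure_eq (A := {y | y.1 = i ∧ y.2.2 ≤ y.2.1})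
    ((measurable_fst (measurableSet_singleton i)).inter
      (measurableSet_le (f := fun y : Fin N × ℝ × ℝ => y.2.2) (g := fun y => y.2.1)
        (by fun_prop) (by fun_prop)))
  have : {y : Fin N × ℝ × ℝ | (y.1, L y.2, y.2.2) ∈ {y : Fin N × ℝ × ℝ | y.1 = i ∧ y.2.2 ≤ y.2.1}}
      = {i} ×ˢ {q | q.2 ≤ L q} := by ext y; simp
  rw [this, Measure.prod_prod, srcMeasure_singleton] at e
  rw [measureReal_def, measureReal_def, ← ENNReal.toReal_ofReal hp, ← ENNReal.toReal_mul, ← e]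
  rfl

theorem integral_tag (h : IsFirstCycle r p mu cyc L) (hp : 0 ≤ p i) :
    ∫ w, (cycleModel i).tag.indicator
        (fun v => max ((cycleModel i).len v - (cycleModel i).srv v) 0) w ∂(inputLaw r p mu).map cyc
      = p i * ∫ q, max (L q - q.2) 0 ∂(expMeasure r).prod (expMeasure mu) := by
  have e := h.integral_eq (F := fun y => ({i} : Set (Fin N)).indicator (fun _ => (1 : ℝ)) y.1
      * max (y.2.1 - y.2.2) 0)
    (((measurable_one.indicator (measurableSet_singleton i)).comp measurable_fst).mul (by fun_prop))
  rw [integral_prod_mul (f := ({i} : Set (Fin N)).indicator fun _ => (1 : ℝ))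
    (g := fun q : ℝ × ℝ => max (L q - q.2) 0), integral_indicator_const _ (measurableSet_singleton i),
    measureReal_def, srcMeasure_singleton, ENNReal.toReal_ofReal hp, smul_eq_mul, mul_one] at e
  rw [← e]
  refine integral_congr_ae (ae_of_all _ fun w => ?_)
  by_cases hw : w.1 = i
  · rw [Set.indicator_of_mem (s := (cycleModel i).tag) hw]
    simp only
    rw [Set.indicator_of_mem (by simpa using hw), one_mul]
    rfl
  · rw [Set.indicator_of_notMem (s := (cycleModel i).tag) hw]
    simp only
    rw [Set.indicator_of_notMem (by simpa using hw), zero_mul]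

theorem memLp_len (h : IsFirstCycle r p mu cyc L)
    (hL4 : Integrable (fun q => L q ^ 4) ((expMeasure r).prod (expMeasure mu))) :
    MemLp (fun w => (cycleModel i).len w ^ 2) 2 ((inputLaw r p mu).map cyc) := by
  have hL := h.measurable_len
  rw [memLp_two_iff_integrable_sq]
  · simp_rw [← pow_mul]
    have hF : Measurable fun y : Fin N × ℝ × ℝ => y.2.1 ^ 4 := by fun_prop
    have e := (integrable_map_measure (μ := (inputLaw r p mu).map cyc)
      (f := fun w => (w.1, |w.2.1|, |w.2.2.1|)) hF.aestronglyMeasurable (by fun_prop)).1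
    refine e ?_
    rw [h.map_eq, integrable_map_measure hF.aestronglyMeasurable (by fun_prop)]
    exact hL4.comp_snd (srcMeasure p)
  · exact ((cycleModel i).measurable_len.pow_const 2).aestronglyMeasurable

end IsFirstCycle

theorem isFirstCycle_cycleS (hr : 0 < r) (hmu : 0 < mu) :
    IsFirstCycle r p mu cycleS Prod.fst where
  measurable := measurable_cycleS
  measurable_len := measurable_fst
  ae_eq := by
    filter_upwards [ae_inputLaw hr hmu] with x hx
    exact ⟨rfl, abs_of_pos (hx.1.1 0), abs_of_pos (hx.2 0)⟩

/-- Without an arrival the service is shorter than the first gap, and the cycle lasts for the gap;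
otherwise the gap is at most the service, and the cycle lasts for the service. Either way its length
is their maximum. -/
theorem isFirstCycle_cycleW (hr : 0 < r) (hmu : 0 < mu) :
    IsFirstCycle r p mu cycleW fun q => max q.1 q.2 where
  measurable := measurable_cycleW
  measurable_len := by fun_prop
  ae_eq := by
    filter_upwards [ae_inputLaw hr hmu] with x hx
    have h0 := hx.1.psum_le_iff (n := 0) (hx.2 0).le
    rw [psum_succ, psum_zero, zero_add] at h0
    unfold cycleW
    split_ifs with hk
    · rw [hk] at h0
      have : (x.2 0).2 < x.1 0 := by
        by_contra hc
        exact lt_irrefl _ (h0.1 (not_lt.1 hc))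
      exact ⟨rfl, by rw [abs_of_pos (hx.1.1 0), max_eq_left this.le], abs_of_pos (hx.2 0)⟩
    · exact ⟨rfl, by rw [abs_of_pos (hx.2 0), max_eq_right (h0.2 (Nat.pos_of_ne_zero hk))],
        abs_of_pos (hx.2 0)⟩

theorem integral_lag_cycleS (i : Fin N) :
    ∫ w, (cycleModel i).lag w ∂(inputLaw r p mu).map cycleS = 0 := by
  rw [integral_map measurable_cycleS.aemeasurable
    (cycleModel i).measurable_lag.aestronglyMeasurable]
  simp [cycleModel, cycleS]

/-- An idle period leaves no lag. Summing the contributions of k ≥ 1 arrivals during the service, (r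
/ (r + mu))^k mu / (r + mu)², is a geometric series. -/
theorem integral_lag_cycleW (hr : 0 < r) (hmu : 0 < mu) (i : Fin N) :
    ∫ w, (cycleModel i).lag w ∂(inputLaw r p mu).map cycleW = r / (r + mu) ^ 2 := by
  have hlm := (cycleModel i).measurable_lag
  have hf : Measurable fun w : Cycle N => ENNReal.ofReal ((cycleModel i).lag w) := hlm.ennreal_ofReal
  have hm : ∀ k, Measurable ((busyAt N k).indicator fun x =>
      ENNReal.ofReal ((cycleModel i).lag (cycleAt k x))) := fun k =>
    (hf.comp (measurable_cycleAt k)).indicator (measurableSet_busyAt k)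
  have h1 : ∫⁻ w, ENNReal.ofReal ((cycleModel i).lag w) ∂(inputLaw r p mu).map cycleW
      = ∑' k, ∫⁻ x, (busyAt N k).indicator
          (fun x => ENNReal.ofReal ((cycleModel i).lag (cycleAt k x))) x ∂inputLaw r p mu := by
    rw [lintegral_map hf measurable_cycleW, ← lintegral_tsum fun k => (hm k).aemeasurable]
    refine lintegral_congr_ae ?_
    filter_upwards [ae_inputLaw hr hmu] with x hx
    rw [tsum_busyAt hx.1 (hx.2 0).le fun k x => ENNReal.ofReal ((cycleModel i).lag (cycleAt k x))]
    rfl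
  have h2 : ∀ k, ∫⁻ x, (busyAt N (k + 1)).indicator
      (fun x => ENNReal.ofReal ((cycleModel i).lag (cycleAt (k + 1) x))) x ∂inputLaw r p mu
      = ENNReal.ofReal ((r / (r + mu)) ^ (k + 1) * (mu / (r + mu) ^ 2)) := by
    intro k
    have e := lintegral_busy (mu := mu) (p := p) hr k hf (measurable_const (a := (1 : ℝ≥0∞)))
    simp only [mul_one, lintegral_const, measure_univ] at e
    rw [e, ← lintegral_exactly_sub hr hmu]
    set G : ℝ → ℝ≥0∞ := fun v => ∫⁻ τ, (exactly (k + 1) v).indicator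
      (fun τ => ENNReal.ofReal (min |v - psum τ (k + 1)| |v|)) τ ∂iidMeasure (expMeasure r) with hG
    have hS : MeasurableSet {q : ℝ × (ℕ → ℝ) | q.2 ∈ exactly (k + 1) q.1} :=
      (measurableSet_le (by fun_prop : Measurable fun q : ℝ × (ℕ → ℝ) => psum q.2 (k + 1))
        measurable_fst).inter
        (measurableSet_lt measurable_fst
          (by fun_prop : Measurable fun q : ℝ × (ℕ → ℝ) => psum q.2 (k + 1 + 1)))
    have hGm : Measurable G := Measurable.lintegral_prod_right'
      (f := {q : ℝ × (ℕ → ℝ) | q.2 ∈ exactly (k + 1) q.1}.indicator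
        fun q => ENNReal.ofReal (min |q.1 - psum q.2 (k + 1)| |q.1|))
      (Measurable.indicator (by fun_prop) hS)
    have e2 : ∫⁻ m, G m.2 ∂markLaw p mu = ∫⁻ v, G v ∂expMeasure mu := by
      rw [lintegral_prod _ (by fun_prop)]
      simp
    refine e2.trans (lintegral_congr fun v => lintegral_congr_ae ?_)
    filter_upwards [ae_isProper hr] with τ hτ
    by_cases hv : τ ∈ exactly (k + 1) v
    · rw [Set.indicator_of_mem hv, Set.indicator_of_mem hv]
      have hps : 0 ≤ psum τ (k + 1) := Finset.sum_nonneg fun n _ => (hτ.1 n).le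
      have := hv.1
      rw [abs_of_nonneg (by linarith), abs_of_nonneg (by linarith), min_eq_left (by linarith)]
    · rw [Set.indicator_of_notMem hv, Set.indicator_of_notMem hv]
  have h0 : ∫⁻ x, (busyAt N 0).indicator
      (fun x => ENNReal.ofReal ((cycleModel i).lag (cycleAt 0 x))) x ∂inputLaw r p mu = 0 := by
    have : (fun x : Input N => ENNReal.ofReal ((cycleModel i).lag (cycleAt 0 x))) = fun _ => 0 := by
      funext x
      simp [cycleModel, cycleAt]
    rw [this]
    simp
  have hrm : r / (r + mu) < 1 := (div_lt_one (by positivity)).2 (by linarith)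
  have hq0 : 0 ≤ r / (r + mu) := by positivity
  have hs : HasSum (fun k : ℕ => (r / (r + mu)) ^ (k + 1) * (mu / (r + mu) ^ 2)) (r / (r + mu) ^ 2) := by
    have := ((hasSum_geometric_of_lt_one hq0 hrm).mul_left (r / (r + mu))).mul_right
      (mu / (r + mu) ^ 2)
    have e : r / (r + mu) * (1 - r / (r + mu))⁻¹ * (mu / (r + mu) ^ 2) = r / (r + mu) ^ 2 := by
      rw [one_sub_div (by positivity), add_sub_cancel_left, inv_div]
      field_simp
    rw [e] at this
    simpa only [pow_succ'] using this
  rw [integral_eq_lintegral_of_nonneg_ae (ae_of_all _ (cycleModel i).lag_nonneg)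
    hlm.aestronglyMeasurable, h1, tsum_eq_zero_add' ENNReal.summable, h0, zero_add]
  simp_rw [h2]
  rw [← ENNReal.ofReal_tsum_of_nonneg (fun k => by positivity) hs.summable, hs.tsum_eq,
    ENNReal.toReal_ofReal (by positivity)]

/-- The lag is 0, the length is exponential of rate r, and a hit has probability p i * mu / (r +
mu). The half ratio of second to first moment and the final correction are both 1 / r and cancel, so
only E len / P(hit) remains. -/
theorem meanAge_cycleS (hr : 0 < r) (hmu : 0 < mu) (i : Fin N) (hp : 0 < p i) :
    (cycleModel i).meanAge ((inputLaw r p mu).map cycleS)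
      = 1 / mu * (1 + r / mu) * (1 / (r * p i / mu)) := by
  have h := isFirstCycle_cycleS (p := p) hr hmu
  have h1 := h.integral_len_pow i 1
  have h2 := h.integral_len_pow i 2
  rw [integral_fst_pow hr] at h1 h2
  simp only [pow_one] at h1
  rw [CycleModel.meanAge, integral_lag_cycleS, h1, h2, h.measureReal_hit i hp.le,
    h.integral_tag i hp.le, integral_max_sub hr hmu, measureReal_def, prod_expMeasure_le hr hmu,
    ENNReal.toReal_ofReal (by positivity)]
  norm_num [Nat.factorial]
  field_simp
  ring

/-- Every service ends in a delivery, so a hit has probability p i. The quotient E len / p i is the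
term in the reciprocal load; in the correction term p i cancels, and the remaining three terms
combine to `alphaW` divided by mu. -/
theorem meanAge_cycleW (hr : 0 < r) (hmu : 0 < mu) (i : Fin N) (hp : 0 < p i) :
    (cycleModel i).meanAge ((inputLaw r p mu).map cycleW)
      = 1 / mu * (alphaW (r / mu)
        + (1 + (r / mu) ^ 2 / (1 + r / mu)) * (1 / (r * p i / mu))) := by
  have h := isFirstCycle_cycleW (p := p) hr hmu
  have h1 := h.integral_len_pow i 1
  have h2 := h.integral_len_pow i 2
  rw [integral_max_pow hr hmu] at h1 h2
  simp only [pow_one] at h1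
  have e1 : {q : ℝ × ℝ | q.2 ≤ max q.1 q.2} = Set.univ := by ext q; simp
  have e2 : ∀ q : ℝ × ℝ, max (max q.1 q.2 - q.2) 0 = max (q.1 - q.2) 0 := by
    intro q
    rw [← max_sub_sub_right, sub_self, max_assoc, max_self]
  have hlen : 1 / r + 1 / mu - 1 / (r + mu)
      = (r ^ 2 + r * mu + mu ^ 2) / (r * mu * (r + mu)) := by field_simp; ring
  rw [CycleModel.meanAge, integral_lag_cycleW hr hmu, h1, h2, h.measureReal_hit i hp.le,
    h.integral_tag i hp.le, e1, probReal_univ]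
  simp_rw [e2]
  rw [integral_max_sub hr hmu]
  norm_num [Nat.factorial]
  simp only [one_div] at hlen
  rw [hlen, alphaW]
  have h3 : 0 < r ^ 2 + r * mu + mu ^ 2 := by positivity
  have e4 : 1 + r / mu + (r / mu) ^ 2 = (r ^ 2 + r * mu + mu ^ 2) / mu ^ 2 := by field_simp; ring
  rw [e4]
  field_simp
  ring

end Moments

/-! ### The sample paths of the two disciplines -/

section Path

variable {N : ℕ} {arr : ℕ → ℝ} {src : ℕ → Fin N} {svc : ℕ → ℝ}

/-- Service `m`, of packet `n m`, starts at time `s m`, and `w m` describes the cycle from `s m` to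
`s (m + 1)`. -/
structure IsServiceSequence (i : Fin N) (Delivered : ℕ → ℝ → Prop) (arr : ℕ → ℝ) (src : ℕ → Fin N)
    (svc : ℕ → ℝ) (n : ℕ → ℕ) (s : ℕ → ℝ) (w : ℕ → Cycle N) : Prop where
  start_zero : s 0 = arr (n 0)
  tag_iff : ∀ m, w m ∈ (cycleModel i).tag ↔ src (n m) = i
  start_succ : ∀ m, s (m + 1) = s m + (cycleModel i).len (w m)
  srv_eq : ∀ m, (cycleModel i).srv (w m) = svc (n m)
  lag_eq : ∀ m, (cycleModel i).lag (w m) = s (m + 1) - arr (n (m + 1))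
  mono : Monotone fun m => arr (n m)
  delivered_iff : ∀ k d, Delivered k d ↔
    ∃ m, n m = k ∧ d = s m + svc k ∧ svc k ≤ (cycleModel i).len (w m)

namespace IsServiceSequence

variable {i : Fin N} {Delivered : ℕ → ℝ → Prop} {n : ℕ → ℕ} {s : ℕ → ℝ} {w : ℕ → Cycle N}

theorem start_eq (h : IsServiceSequence i Delivered arr src svc n s w) (m : ℕ) :
    (cycleModel i).start (s 0) w m = s m := by
  induction m with
  | zero => rfl
  | succ m ih => rw [CycleModel.start, ih, h.start_succ]

theorem lagAt_eq (h : IsServiceSequence i Delivered arr src svc n s w) (m : ℕ) :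
    (cycleModel i).lagAt w m = s m - arr (n m) := by
  cases m with
  | zero => rw [h.start_zero, sub_self]; rfl
  | succ m => exact h.lag_eq m

/-- The generation times of the updates the monitor has seen before cycle `m`. -/
def seen (i : Fin N) (arr : ℕ → ℝ) (n : ℕ → ℕ) (w : ℕ → Cycle N) (a : ℝ) (m : ℕ) : Set ℝ :=
  insert (-a) {g | ∃ j < m, w j ∈ (cycleModel i).hit ∧ g = arr (n j)}

theorem le_of_mem_seen (h : IsServiceSequence i Delivered arr src svc n s w) {a : ℝ} (ha : 0 ≤ a)
    (h0 : 0 < s 0) {m : ℕ} {g : ℝ} (hg : g ∈ seen i arr n w a m) : g ≤ arr (n m) := by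
  rcases hg with rfl | ⟨j, hj, -, rfl⟩
  · have := h.mono (Nat.zero_le m)
    simp only [← h.start_zero] at this
    linarith
  · exact h.mono hj.le

/-- Packets are served in order of arrival, so a hit makes the packet of that cycle the freshest
update, while a miss leaves the set of updates unchanged. This is the recursion for the excess,
which therefore measures how much older the freshest update is than the packet now in service. -/
theorem isGreatest_seen (h : IsServiceSequence i Delivered arr src svc n s w) {a : ℝ} (ha : 0 ≤ a)
    (h0 : 0 < s 0) (m : ℕ) :
    IsGreatest (seen i arr n w a m) (arr (n m) - (cycleModel i).excess a (s 0) w m) := by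
  induction m with
  | zero =>
    have : seen i arr n w a 0 = {-a} := by simp [seen]
    rw [this, CycleModel.excess, h.start_zero, show arr (n 0) - (a + arr (n 0)) = -a by ring]
    exact isGreatest_singleton
  | succ m ih =>
    have e : arr (n (m + 1)) - (cycleModel i).excess a (s 0) w (m + 1)
        = arr (n m) - (cycleModel i).hitᶜ.indicator
          (fun _ => (cycleModel i).excess a (s 0) w m) (w m) := by
      rw [CycleModel.excess, h.lag_eq, h.lagAt_eq, h.start_succ]
      ring
    rw [e]
    by_cases hw : w m ∈ (cycleModel i).hit
    · rw [Set.indicator_of_notMem (by simpa using hw), sub_zero]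
      refine ⟨Or.inr ⟨m, Nat.lt_succ_self m, hw, rfl⟩, ?_⟩
      rintro g (rfl | ⟨j, hj, -, rfl⟩)
      · exact h.le_of_mem_seen ha h0 (Or.inl rfl)
      · exact h.mono (Nat.lt_succ_iff.1 hj)
    · rw [Set.indicator_of_mem (by simpa using hw)]
      have : seen i arr n w a (m + 1) = seen i arr n w a m := by
        ext g
        constructor
        · rintro (rfl | ⟨j, hj, hh, rfl⟩)
          · exact Or.inl rfl
          · refine Or.inr ⟨j, lt_of_le_of_ne (Nat.lt_succ_iff.1 hj) ?_, hh, rfl⟩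
            rintro rfl
            exact hw hh
        · rintro (rfl | ⟨j, hj, hh, rfl⟩)
          · exact Or.inl rfl
          · exact Or.inr ⟨j, hj.trans (Nat.lt_succ_self m), hh, rfl⟩
      rw [this]
      exact ih

theorem monotone_start (h : IsServiceSequence i Delivered arr src svc n s w) : Monotone s := by
  have : s = (cycleModel i).start (s 0) w := funext fun m => (h.start_eq m).symm
  rw [this]
  exact (cycleModel i).start_mono _ _

/-- By the freshest-update description only the current cycle matters: the age is measured from its
packet once that packet, if tagged, has completed service, and from the freshest earlier update
until then. -/
theorem isAgePath (h : IsServiceSequence i Delivered arr src svc n s w) {a : ℝ} (ha : 0 ≤ a)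
    (h0 : 0 < s 0) (hsvc : ∀ k, 0 < svc k) :
    (cycleModel i).IsAgePath a (s 0) w (age Delivered arr src a i) := by
  constructor
  · intro t _ ht
    have : {g | ∃ k d, src k = i ∧ Delivered k d ∧ d ≤ t ∧ g = arr k} = ∅ := by
      refine Set.eq_empty_iff_forall_notMem.2 ?_
      rintro g ⟨k, d, -, hd, hdt, -⟩
      obtain ⟨m, -, rfl, -⟩ := (h.delivered_iff k d).1 hd
      have := h.monotone_start (Nat.zero_le m)
      have := hsvc k
      linarith
    rw [age, this, insert_empty_eq, csSup_singleton]
    ring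
  · intro m t h1 h2
    rw [h.start_eq] at h1 h2
    -- Deliveries in earlier cycles have all taken place by time t, later cycles cannot contribute
    -- as service times are positive, and the current cycle contributes once its service has ended.
    have hS : insert (-a) {g | ∃ k d, src k = i ∧ Delivered k d ∧ d ≤ t ∧ g = arr k}
        = seen i arr n w a m ∪
          {g | (w m ∈ (cycleModel i).tag ∧ (cycleModel i).srv (w m) ≤ t - s m) ∧ g = arr (n m)} := by
      ext g
      constructor
      · rintro (rfl | ⟨k, d, hk, hd, hdt, rfl⟩)
        · exact Or.inl (Or.inl rfl)
        · obtain ⟨j, rfl, rfl, hj⟩ := (h.delivered_iff k d).1 hd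
          rcases lt_trichotomy j m with hjm | rfl | hjm
          · exact Or.inl (Or.inr ⟨j, hjm, ⟨(h.tag_iff j).2 hk, (h.srv_eq j).le.trans hj⟩, rfl⟩)
          · exact Or.inr ⟨⟨(h.tag_iff j).2 hk, by rw [h.srv_eq]; linarith⟩, rfl⟩
          · have := h.monotone_start (Nat.succ_le_of_lt hjm)
            have := hsvc (n j)
            simp only [Nat.succ_eq_add_one] at *
            linarith
      · rintro ((rfl | ⟨j, hj, hh, rfl⟩) | ⟨⟨hw, hs⟩, rfl⟩)
        · exact Or.inl rfl
        · have hjl : svc (n j) ≤ (cycleModel i).len (w j) := (h.srv_eq j).symm.le.trans hh.2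
          refine Or.inr ⟨n j, s j + svc (n j), (h.tag_iff j).1 hh.1,
            (h.delivered_iff _ _).2 ⟨j, rfl, rfl, hjl⟩, ?_, rfl⟩
          have e1 := h.monotone_start (Nat.succ_le_of_lt hj)
          have e2 := h.start_succ j
          simp only [Nat.succ_eq_add_one] at e1
          linarith
        · rw [h.srv_eq] at hs
          rw [h.start_succ] at h2
          exact Or.inr ⟨n m, s m + svc (n m), (h.tag_iff m).1 hw,
            (h.delivered_iff _ _).2 ⟨m, rfl, rfl, by linarith⟩, by linarith, rfl⟩
    have hG := h.isGreatest_seen ha h0 m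
    rw [age, hS, h.start_eq, h.lagAt_eq]
    by_cases hw : w m ∈ (cycleModel i).tag ∧ (cycleModel i).srv (w m) ≤ t - s m
    · rw [Set.indicator_of_notMem (by simpa using hw)]
      have : IsGreatest (seen i arr n w a m ∪
          {g | (w m ∈ (cycleModel i).tag ∧ (cycleModel i).srv (w m) ≤ t - s m) ∧ g = arr (n m)})
          (arr (n m)) := by
        refine ⟨Or.inr ⟨hw, rfl⟩, ?_⟩
        rintro g (hg | ⟨-, rfl⟩)
        · exact h.le_of_mem_seen ha h0 hg
        · exact le_rfl
      rw [this.csSup_eq]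
      ring
    · have hE : {g | (w m ∈ (cycleModel i).tag ∧ (cycleModel i).srv (w m) ≤ t - s m) ∧ g = arr (n m)}
          = ∅ := Set.eq_empty_iff_forall_notMem.2 fun g hg => hw hg.1
      rw [Set.indicator_of_mem (by simpa using hw), hE, Set.union_empty, hG.csSup_eq]
      ring

end IsServiceSequence

/-- The gaps and marks after the arrival of packet `0`. -/
def initialInput (arr : ℕ → ℝ) (src : ℕ → Fin N) (svc : ℕ → ℝ) : Input N :=
  (fun k => gaps arr (k + 1), fun k => (src k, svc k))

theorem iterate_nextS (m : ℕ) (x : Input N) :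
    nextS^[m] x = (fun k => x.1 (k + m), fun k => x.2 (k + m)) := by
  induction m generalizing x with
  | zero => rfl
  | succ m ih =>
    rw [Function.iterate_succ_apply, ih]
    simp only [nextS, add_assoc]

/-- Every packet starts a service upon arrival, so services are indexed by packets and all lags
vanish; preempted packets are those with service time exceeding the cycle. -/
theorem isServiceSequence_cycleS (i : Fin N) (h1 : StrictMono arr) (hsvc : ∀ k, 0 < svc k) :
    IsServiceSequence i (DeliveredS arr svc) arr src svc id arr
      fun m => cycleS (nextS^[m] (initialInput arr src svc)) := by
  have hw : ∀ m, cycleS (nextS^[m] (initialInput arr src svc))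
      = (src m, arr (m + 1) - arr m, svc m, 0) := by
    intro m
    rw [iterate_nextS]
    simp [cycleS, initialInput, gaps]
  have hlen : ∀ m, |arr (m + 1) - arr m| = arr (m + 1) - arr m := fun m =>
    abs_of_pos (sub_pos.2 (h1 (Nat.lt_succ_self m)))
  refine ⟨rfl, fun m => by rw [hw]; rfl, fun m => ?_, fun m => ?_, fun m => ?_, h1.monotone,
    fun k d => ?_⟩
  · simp only [hw, cycleModel, hlen]; ring
  · simp only [hw, cycleModel, id]; exact abs_of_pos (hsvc m)
  · simp [hw, cycleModel]
  · simp only [hw, cycleModel, hlen, id, DeliveredS]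
    constructor
    · rintro ⟨rfl, h⟩
      exact ⟨k, rfl, rfl, by linarith⟩
    · rintro ⟨m, rfl, rfl, h⟩
      exact ⟨rfl, by linarith⟩

/-- The gaps and marks from time `s` on, packet `n` being in service. -/
def inputFrom (arr : ℕ → ℝ) (src : ℕ → Fin N) (svc : ℕ → ℝ) (n : ℕ) (s : ℝ) : Input N :=
  (scons (arr (n + 1) - s) fun k => gaps arr (k + (n + 2)), fun k => (src (k + n), svc (k + n)))

theorem psum_inputFrom (n : ℕ) (s : ℝ) (k : ℕ) :
    psum (inputFrom arr src svc n s).1 (k + 1) = arr (n + k + 1) - s := by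
  rw [inputFrom, psum_scons]
  induction k with
  | zero => simp
  | succ k ih =>
    rw [psum_succ, ← add_assoc, ih, show k + (n + 2) = n + k + 1 + 1 by ring, gaps,
      show n + (k + 1) = n + k + 1 by ring]
    ring

theorem isProper_inputFrom (h1 : StrictMono arr) (h2 : Tendsto arr atTop atTop) {n : ℕ} {s : ℝ}
    (hs : s < arr (n + 1)) : IsProper (inputFrom arr src svc n s).1 := by
  constructor
  · intro k
    cases k with
    | zero => exact sub_pos.2 hs
    | succ k => exact sub_pos.2 (h1 (Nat.lt_succ_self _))
  · rw [← tendsto_add_atTop_iff_nat 1]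
    simp_rw [psum_inputFrom]
    refine tendsto_atTop_add_const_right _ _ (h2.comp ?_)
    have := tendsto_add_atTop_nat (n + 1)
    refine this.congr fun k => by ring

theorem npts_inputFrom (h1 : StrictMono arr) (h2 : Tendsto arr atTop atTop) {n : ℕ} {s : ℝ}
    (hs : s < arr (n + 1)) (hsvc : 0 < svc n) (k : ℕ) :
    arr (n + k + 1) ≤ s + svc n ↔ k < npts (svc n) (inputFrom arr src svc n s).1 := by
  rw [← (isProper_inputFrom h1 h2 hs).psum_le_iff hsvc.le, psum_inputFrom, sub_le_iff_le_add']

/-- The state of the server under preemption in waiting evolves by `nextW`. -/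
theorem inputFrom_serviceW (h1 : StrictMono arr) (h2 : Tendsto arr atTop atTop)
    (hsvc : ∀ k, 0 < svc k) (m : ℕ) :
    arr (serviceW arr svc m).1 ≤ (serviceW arr svc m).2 ∧
    (serviceW arr svc m).2 < arr ((serviceW arr svc m).1 + 1) ∧
    nextW^[m] (initialInput arr src svc)
      = inputFrom arr src svc (serviceW arr svc m).1 (serviceW arr svc m).2 := by
  induction m with
  | zero =>
    refine ⟨le_rfl, h1 (Nat.lt_succ_self 0), ?_⟩
    refine Prod.ext (funext fun k => ?_) rfl
    cases k <;> rfl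
  | succ m ih =>
    obtain ⟨ha, hb, hx⟩ := ih
    rw [Function.iterate_succ_apply', hx]
    set n := (serviceW arr svc m).1 with hn
    set s := (serviceW arr svc m).2 with hs
    have hK := npts_inputFrom (src := src) h1 h2 hb (hsvc n)
    have hv : ((inputFrom arr src svc n s).2 0).2 = svc n := by simp [inputFrom]
    have e : serviceW arr svc (m + 1) = open Classical in
      if arr (n + 1) ≤ s + svc n then (sSup {k | arr k ≤ s + svc n}, s + svc n)
      else (n + 1, arr (n + 1)) := rfl
    rw [e, nextW, hv]
    set K := npts (svc n) (inputFrom arr src svc n s).1 with hKdef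
    have h0 := hK 0
    rw [add_zero] at h0
    by_cases hK0 : K = 0
    · rw [if_pos hK0, if_neg (by rw [h0, hK0]; simp)]
      refine ⟨le_rfl, h1 (Nat.lt_succ_self _), ?_⟩
      refine Prod.ext (funext fun k => ?_) (funext fun k => ?_)
      · cases k with
        | zero =>
          simp only [nextS, inputFrom, scons, zero_add]
          rw [gaps]
        | succ k =>
          simp only [nextS, inputFrom, scons]
          congr 1; ring
      · simp only [nextS, inputFrom]
        rw [show k + 1 + n = k + (n + 1) by ring]
    · rw [if_neg hK0, if_pos (h0.2 (Nat.pos_of_ne_zero hK0))]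
      obtain ⟨j, hj⟩ := Nat.exists_eq_succ_of_ne_zero hK0
      have hle : arr (n + K) ≤ s + svc n := by
        have := (hK j).2 (by omega)
        rwa [show n + j + 1 = n + K by omega] at this
      have hlt : s + svc n < arr (n + K + 1) := by
        by_contra hc
        exact lt_irrefl _ ((hK K).1 (not_lt.1 hc))
      -- The counting variable K pins down the last arrival by the end of the service, so the
      -- supremum is attained and not a default value.
      have hsup : sSup {k | arr k ≤ s + svc n} = n + K := by
        refine IsGreatest.csSup_eq ⟨hle, fun k hk => ?_⟩
        by_contra hc
        have := h1.monotone (show n + K + 1 ≤ k by omega)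
        have hk' : arr k ≤ s + svc n := hk
        linarith
      rw [hsup]
      refine ⟨hle, hlt, ?_⟩
      refine Prod.ext (funext fun k => ?_) (funext fun k => ?_)
      · cases k with
        | zero =>
          simp only [residual, scons]
          rw [psum_inputFrom]
          simp only [inputFrom, scons]
          ring
        | succ k =>
          change gaps arr (k + K + (n + 2)) = gaps arr (k + (n + K + 2))
          rw [show k + K + (n + 2) = k + (n + K + 2) by ring]
      · simp only [inputFrom]
        rw [show k + K + n = k + (n + K) by ring]

theorem isServiceSequence_cycleW (i : Fin N) (h1 : StrictMono arr) (h2 : Tendsto arr atTop atTop)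
    (hsvc : ∀ k, 0 < svc k) :
    IsServiceSequence i (DeliveredW arr svc) arr src svc (fun m => (serviceW arr svc m).1)
      (fun m => (serviceW arr svc m).2) fun m => cycleW (nextW^[m] (initialInput arr src svc)) := by
  have key : ∀ m, (cycleW (nextW^[m] (initialInput arr src svc))).1 = src (serviceW arr svc m).1 ∧
      |(cycleW (nextW^[m] (initialInput arr src svc))).2.1|
        = (serviceW arr svc (m + 1)).2 - (serviceW arr svc m).2 ∧
      (cycleW (nextW^[m] (initialInput arr src svc))).2.2.1 = svc (serviceW arr svc m).1 ∧
      (cycleModel i).lag (cycleW (nextW^[m] (initialInput arr src svc)))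
        = (serviceW arr svc (m + 1)).2 - arr (serviceW arr svc (m + 1)).1 ∧
      (serviceW arr svc m).1 ≤ (serviceW arr svc (m + 1)).1 ∧
      svc (serviceW arr svc m).1 ≤ (serviceW arr svc (m + 1)).2 - (serviceW arr svc m).2 := by
    intro m
    obtain ⟨ha, hb, hx⟩ := inputFrom_serviceW (src := src) h1 h2 hsvc m
    obtain ⟨ha', hb', hx'⟩ := inputFrom_serviceW (src := src) h1 h2 hsvc (m + 1)
    rw [hx]
    set n := (serviceW arr svc m).1 with hn
    set s := (serviceW arr svc m).2 with hs
    have hK := npts_inputFrom (src := src) h1 h2 hb (hsvc n)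
    have hv : (inputFrom arr src svc n s).2 0 = (src n, svc n) := by simp [inputFrom]
    have e : serviceW arr svc (m + 1) = open Classical in
      if arr (n + 1) ≤ s + svc n then (sSup {k | arr k ≤ s + svc n}, s + svc n)
      else (n + 1, arr (n + 1)) := rfl
    rw [cycleW, hv]
    set K := npts (svc n) (inputFrom arr src svc n s).1 with hKdef
    have h0 := hK 0
    rw [add_zero] at h0
    have hvpos := hsvc n
    by_cases hK0 : K = 0
    · have hc : ¬ arr (n + 1) ≤ s + svc n := by rw [h0, hK0]; simp
      rw [if_pos hK0, e, if_neg hc]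
      have hc' := not_le.1 hc
      refine ⟨rfl, abs_of_pos (sub_pos.2 hb), rfl, ?_, Nat.le_succ n, by simp only; linarith⟩
      simp [cycleModel]
    · have hc : arr (n + 1) ≤ s + svc n := h0.2 (Nat.pos_of_ne_zero hK0)
      rw [e, if_pos hc] at ha' hb'
      rw [if_neg hK0, e, if_pos hc]
      obtain ⟨j, hj⟩ := Nat.exists_eq_succ_of_ne_zero hK0
      -- The invariants of service m + 1 place the end of service m between arrivals q and q + 1;
      -- counting places it between n + K and n + K + 1.
      have hsup : sSup {k | arr k ≤ s + svc n} = n + K := by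
        simp only at ha' hb'
        set q := sSup {k | arr k ≤ s + svc n} with hq
        have hle : arr (n + j + 1) ≤ s + svc n := (hK j).2 (by omega)
        have hlt : ¬ arr (n + K + 1) ≤ s + svc n := fun hc => lt_irrefl _ ((hK K).1 hc)
        have c1 : n + j + 1 < q + 1 := h1.lt_iff_lt.1 (hle.trans_lt hb')
        have c2 : q < n + K + 1 := h1.lt_iff_lt.1 (ha'.trans_lt (not_le.1 hlt))
        omega
      rw [hsup] at ha' ⊢
      simp only at ha' ⊢
      have hn1 : arr (n + 1) ≤ arr (n + K) := h1.monotone (by omega)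
      have hp : psum (inputFrom arr src svc n s).1 K = arr (n + K) - s := by
        rw [hj, Nat.succ_eq_add_one, psum_inputFrom, ← add_assoc]
      refine ⟨trivial, by rw [abs_of_pos hvpos]; ring, trivial, ?_, Nat.le_add_right n K, by linarith⟩
      simp only [cycleModel, hp]
      rw [abs_of_nonneg (by linarith), abs_of_pos hvpos, min_eq_left (by linarith)]
      ring
  refine ⟨rfl, fun m => ?_, fun m => ?_, fun m => ?_, fun m => (key m).2.2.2.1, ?_, fun k d => ?_⟩
  · rw [← (key m).1]; rfl
  · rw [show (cycleModel i).len (cycleW (nextW^[m] (initialInput arr src svc)))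
      = |(cycleW (nextW^[m] (initialInput arr src svc))).2.1| from rfl, (key m).2.1]
    ring
  · rw [show (cycleModel i).srv (cycleW (nextW^[m] (initialInput arr src svc)))
      = |(cycleW (nextW^[m] (initialInput arr src svc))).2.2.1| from rfl, (key m).2.2.1]
    exact abs_of_pos (hsvc _)
  · exact h1.monotone.comp (monotone_nat_of_le_succ fun m => (key m).2.2.2.2.1)
  · constructor
    · rintro ⟨m, rfl, rfl⟩
      refine ⟨m, rfl, rfl, ?_⟩
      exact (key m).2.2.2.2.2.trans (key m).2.1.symm.le
    · rintro ⟨m, rfl, rfl, -⟩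
      exact ⟨m, rfl, rfl⟩

end Path

/-! ### The average age of the two disciplines -/

section Queue

variable {Ω : Type*} [MeasurableSpace Ω] {P : Measure Ω} [IsProbabilityMeasure P]
  {N : ℕ} {lam : Fin N → ℝ} {mu r : ℝ} {arr : ℕ → Ω → ℝ} {src : ℕ → Ω → Fin N} {svc : ℕ → Ω → ℝ}

theorem measurable_initialInput (h : IsMM1Input P lam mu arr src svc) : Measurable fun ω =>
    initialInput (fun n => arr n ω) (fun n => src n ω) fun n => svc n ω := by
  have h1 : Measurable fun ω => gaps fun n => arr n ω :=
    measurable_gaps.comp (measurable_pi_iff.2 h.measurable_arr)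
  refine Measurable.prodMk (measurable_pi_iff.2 fun k => ?_) (measurable_pi_iff.2 fun k => ?_)
  · exact (measurable_pi_apply (k + 1)).comp h1
  · exact (h.measurable_src k).prodMk (h.measurable_svc k)

theorem IsMM1Input.ae_svc_pos (h : IsMM1Input P lam mu arr src svc) (hmu : 0 < mu) :
    ∀ᵐ ω ∂P, ∀ n, 0 < svc n ω :=
  ae_all_iff.2 fun n => by
    have := ae_expMeasure_pos hmu
    rw [← (h.svc_law n).map_eq] at this
    exact ae_of_ae_map (h.measurable_svc n).aemeasurable this

variable [IsProbabilityMeasure (expMeasure mu)] [IsProbabilityMeasure (expMeasure r)]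
  [IsProbabilityMeasure (srcMeasure fun i => lam i / r)]

/-- The first arrival is independent of what follows. -/
theorem IsMM1Input.map_initialInput (h : IsMM1Input P lam mu arr src svc) (hlam : ∀ i, 0 < lam i)
    (hr : r = ∑ i, lam i) (hr0 : 0 < r) [NeZero N] :
    P.map (fun ω => (arr 0 ω,
        initialInput (fun n => arr n ω) (fun n => src n ω) fun n => svc n ω))
      = (expMeasure r).prod (inputLaw r (fun i => lam i / r) mu) := by
  have h1 := h.map_input hlam hr hr0
  have hm : Measurable fun ω => (gaps fun n => arr n ω, fun n => src n ω, fun n => svc n ω) :=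
    (measurable_gaps.comp (measurable_pi_iff.2 h.measurable_arr)).prodMk
      ((measurable_pi_iff.2 h.measurable_src).prodMk (measurable_pi_iff.2 h.measurable_svc))
  have h2 := congrArg (Measure.map (Prod.map (fun τ : ℕ → ℝ => (τ 0, fun n => τ (n + 1)))
    fun y : (ℕ → Fin N) × (ℕ → ℝ) => fun n => (y.1 n, y.2 n))) h1
  rw [← Measure.map_prod_map _ _ (by fun_prop) (by fun_prop), map_head_tail, map_zip,
    Measure.map_map (by fun_prop) hm] at h2
  have h3 := congrArg (Measure.map (MeasurableEquiv.prodAssoc :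
    (ℝ × (ℕ → ℝ)) × (ℕ → Fin N × ℝ) ≃ᵐ _)) h2
  rw [Measure.prodAssoc_prod, Measure.map_map (by fun_prop) (by fun_prop)] at h3
  exact h3

variable {a : ℝ} {i : Fin N} {cyc : Input N → Cycle N} {next : Input N → Input N}
  {L : ℝ × ℝ → ℝ} {D : ℝ → Ω → ℝ}

/-- The age process of a source has the average age given by its cycles. -/
theorem IsMM1Input.hasAverageAge (h : IsMM1Input P lam mu arr src svc) (hlam : ∀ i, 0 < lam i)
    (hr : r = ∑ i, lam i) (hr0 : 0 < r) (ha : 0 ≤ a)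
    (hcyc : IsFirstCycle r (fun i => lam i / r) mu cyc L) (hnext : Measurable next)
    (hsplit : (inputLaw r (fun i => lam i / r) mu).map (fun x => (cyc x, next x))
      = ((inputLaw r (fun i => lam i / r) mu).map cyc).prod (inputLaw r (fun i => lam i / r) mu))
    (hL4 : Integrable (fun q => L q ^ 4) ((expMeasure r).prod (expMeasure mu)))
    (hL0 : 0 < ∫ q, L q ∂(expMeasure r).prod (expMeasure mu))
    (hp : 0 < ((expMeasure r).prod (expMeasure mu)).real {q | q.2 ≤ L q})
    (hren : ∀ (s₀ : Ω → ℝ) (W : ℕ → Ω → Cycle N) (ℱ : ℕ → MeasurableSpace Ω),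
      IsCycleInput P ((inputLaw r (fun i => lam i / r) mu).map cyc) ℱ s₀ W →
      (∀ᵐ ω ∂P, Tendsto ((cycleModel i).start (s₀ ω) fun n => W n ω) atTop atTop) →
      P.map s₀ = expMeasure r → ∃ u M,
        HasRenewalDensity (cycleModel i) P ((inputLaw r (fun i => lam i / r) mu).map cyc) s₀ W r u M)
    (hD : ∀ᵐ ω ∂P, (cycleModel i).IsAgePath a (arr 0 ω) (fun n => cyc (next^[n]
      (initialInput (fun n => arr n ω) (fun n => src n ω) fun n => svc n ω))) fun t => D t ω) :
    HasAverageAge P D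
      ((cycleModel i).meanAge ((inputLaw r (fun i => lam i / r) mu).map cyc)) := by
  -- The given source shows that N is positive, as decoding the sources requires.
  have hN : NeZero N := ⟨fun h0 => by subst h0; exact i.elim0⟩
  have hX := measurable_initialInput h
  have hmap := h.map_initialInput hlam hr hr0
  have hκ : IsProbabilityMeasure ((inputLaw r (fun i => lam i / r) mu).map cyc) :=
    Measure.isProbabilityMeasure_map hcyc.measurable.aemeasurable
  have h1 : P.map (arr 0) = expMeasure r := by
    have := congrArg (Measure.map Prod.fst) hmap
    rw [Measure.map_map measurable_fst ((h.measurable_arr 0).prodMk hX), Measure.map_fst_prod,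
      measure_univ, one_smul] at this
    exact this
  have h2 : P.map (fun ω => initialInput (fun n => arr n ω) (fun n => src n ω) fun n => svc n ω)
      = inputLaw r (fun i => lam i / r) mu := by
    have := congrArg (Measure.map Prod.snd) hmap
    rw [Measure.map_map measurable_snd ((h.measurable_arr 0).prodMk hX), Measure.map_snd_prod,
      measure_univ, one_smul] at this
    exact this
  have hind : IndepFun (arr 0)
      (fun ω => initialInput (fun n => arr n ω) (fun n => src n ω) fun n => svc n ω) P := by
    rw [indepFun_iff_map_prod_eq_prod_map_map (h.measurable_arr 0).aemeasurable hX.aemeasurable,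
      hmap, h1, h2]
  -- The cycle results ask for a first start that is nonnegative at every point, whereas the first
  -- arrival is positive only almost surely.
  have habs : (fun ω => |arr 0 ω|) =ᵐ[P] arr 0 := by
    filter_upwards [h.arr_pos] with ω hω using abs_of_pos hω
  have hs : P.map (fun ω => |arr 0 ω|) = expMeasure r := (Measure.map_congr habs).trans h1
  have hs2 : MemLp (fun ω => |arr 0 ω|) 2 P := by
    rw [memLp_congr_ae habs, memLp_two_iff_integrable_sq (h.measurable_arr 0).aestronglyMeasurable]
    have := integrable_pow_expMeasure hr0 2
    rw [← h1] at this
    exact this.comp_measurable (h.measurable_arr 0)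
  have hin := isCycleInput_regenerative hcyc.measurable hnext hsplit hX h2
    (h.measurable_arr 0).abs (hind.comp measurable_id.abs measurable_id)
  have hlen := hcyc.memLp_len i hL4
  have hlen0 : 0 < ∫ w, (cycleModel i).len w ∂(inputLaw r (fun i => lam i / r) mu).map cyc := by
    have := hcyc.integral_len_pow i 1
    simp only [pow_one] at this
    rwa [this]
  have hpi : 0 < lam i / r := div_pos (hlam i) hr0
  have hhit := hcyc.measureReal_hit i hpi.le
  have hhit0 : 0 < ((inputLaw r (fun i => lam i / r) mu).map cyc).real (cycleModel i).hit := by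
    rw [hhit]; exact mul_pos hpi hp
  have hstart : ∀ᵐ ω ∂P, Tendsto ((cycleModel i).start |arr 0 ω| fun n => cyc (next^[n]
      (initialInput (fun n => arr n ω) (fun n => src n ω) fun n => svc n ω))) atTop atTop := by
    filter_upwards [(cycleModel i).ae_time_average hin ha (fun ω => abs_nonneg _) hs2 hlen hlen0
      hhit0] with ω hω using hω.1
  obtain ⟨u, M, hu⟩ := hren _ _ _ hin hstart hs
  refine (cycleModel i).hasAverageAge hin hu ha (fun ω => abs_nonneg _) hs2 hlen hlen0 hhit0 ?_
  filter_upwards [hD, habs] with ω hω hω'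
  rw [hω']
  exact hω

theorem IsMM1Input.hasAverageAge_deliveredS (h : IsMM1Input P lam mu arr src svc)
    (hlam : ∀ i, 0 < lam i) (hmu : 0 < mu) (hr : r = ∑ i, lam i) (hr0 : 0 < r) (ha : 0 ≤ a)
    (i : Fin N) :
    HasAverageAge P (fun t ω => age (DeliveredS (fun n => arr n ω) (fun n => svc n ω))
        (fun n => arr n ω) (fun n => src n ω) a i t)
      (1 / mu * (1 + r / mu) * (1 / (lam i / mu))) := by
  have hp : 0 < lam i / r := div_pos (hlam i) hr0
  have hcyc := isFirstCycle_cycleS (p := fun i => lam i / r) hr0 hmu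
  have hκ : IsProbabilityMeasure ((inputLaw r (fun i => lam i / r) mu).map cycleS) :=
    Measure.isProbabilityMeasure_map measurable_cycleS.aemeasurable
  have e1 := integral_fst_pow (mu := mu) hr0 1
  simp only [pow_one, Nat.factorial_one, Nat.cast_one] at e1
  have hmean := meanAge_cycleS (p := fun i => lam i / r) hr0 hmu i hp
  rw [mul_div_cancel₀ _ hr0.ne'] at hmean
  rw [← hmean]
  refine h.hasAverageAge hlam hr hr0 ha hcyc measurable_nextS map_cycleS_nextS
    (integrable_fst_pow hr0 4) (by rw [e1]; positivity) ?_ ?_ ?_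
  · rw [measureReal_def, prod_expMeasure_le hr0 hmu, ENNReal.toReal_ofReal (by positivity)]
    positivity
  · intro s₀ W ℱ hin hstart hs
    refine ⟨_, _, (cycleModel i).hasRenewalDensity_exp hin hstart hr0 hs (fun v hv => ?_) ?_⟩
    · rw [hcyc.measure_lt_len i v, ← expMeasure_Ioi hr0 hv,
        show {q : ℝ × ℝ | v < q.1} = Set.Ioi v ×ˢ Set.univ by ext q; simp, Measure.prod_prod,
        measure_univ, mul_one]
    · have := hcyc.integral_len_pow i 1
      simp only [pow_one] at this
      rw [this, e1]
  · filter_upwards [h.arr_pos, h.arr_strictMono, h.ae_svc_pos hmu] with ω h1 h2 h3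
    exact (isServiceSequence_cycleS i h2 h3).isAgePath ha h1 h3

theorem IsMM1Input.hasAverageAge_deliveredW (h : IsMM1Input P lam mu arr src svc)
    (hlam : ∀ i, 0 < lam i) (hmu : 0 < mu) (hr : r = ∑ i, lam i) (hr0 : 0 < r) (ha : 0 ≤ a)
    (i : Fin N) :
    HasAverageAge P (fun t ω => age (DeliveredW (fun n => arr n ω) (fun n => svc n ω))
        (fun n => arr n ω) (fun n => src n ω) a i t)
      (1 / mu * (alphaW (r / mu) + (1 + (r / mu) ^ 2 / (1 + r / mu)) * (1 / (lam i / mu)))) := by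
  have hp : 0 < lam i / r := div_pos (hlam i) hr0
  have hcyc := isFirstCycle_cycleW (p := fun i => lam i / r) hr0 hmu
  have hκ : IsProbabilityMeasure ((inputLaw r (fun i => lam i / r) mu).map cycleW) :=
    Measure.isProbabilityMeasure_map measurable_cycleW.aemeasurable
  have e1 := integral_max_pow hr0 hmu 1
  simp only [pow_one, Nat.factorial_one, Nat.cast_one] at e1
  have hmean := meanAge_cycleW (p := fun i => lam i / r) hr0 hmu i hp
  rw [mul_div_cancel₀ _ hr0.ne'] at hmean
  rw [← hmean]
  refine h.hasAverageAge hlam hr hr0 ha hcyc measurable_nextW (map_cycleW_nextW hr0 hmu)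
    (integrable_max_pow hr0 hmu 4) ?_ ?_ ?_ ?_
  · rw [e1]
    have : 1 / (r + mu) < 1 / r := one_div_lt_one_div_of_lt hr0 (by linarith)
    have : 0 < 1 / mu := by positivity
    linarith
  · rw [show {q : ℝ × ℝ | q.2 ≤ max q.1 q.2} = Set.univ by ext q; simp, probReal_univ]
    exact one_pos
  · intro s₀ W ℱ hin hstart hs
    refine (cycleModel i).exists_hasRenewalDensity_max hin hstart hr0 hmu hs (fun v hv => ?_) ?_
    · rw [hcyc.measure_lt_len i v, prod_expMeasure_lt_max hr0 hmu hv]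
    · have := hcyc.integral_len_pow i 1
      simp only [pow_one] at this
      rw [this, e1]
      ring
  · filter_upwards [h.arr_pos, h.arr_strictMono, h.arr_tendsto, h.ae_svc_pos hmu] with ω h1 h2 h3 h4
    exact (isServiceSequence_cycleW i h2 h3 h4).isAgePath ha h1 h4

end Queue

end StatusAge

theorem mainTheorem2 {Ω : Type*} [MeasurableSpace Ω] (P : Measure Ω) [IsProbabilityMeasure P]
    {N : ℕ} (lam : Fin N → ℝ) (hlam : ∀ i, 0 < lam i) (mu : ℝ) (hmu : 0 < mu)
    (arr : ℕ → Ω → ℝ) (src : ℕ → Ω → Fin N) (svc : ℕ → Ω → ℝ)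
    (hinput : StatusAge.IsMM1Input P lam mu arr src svc)
    (a : Fin N → ℝ) (ha : ∀ i, 0 ≤ a i)
    (load : Fin N → ℝ) (hload : ∀ i, load i = lam i / mu)
    (total : ℝ) (htotal : total = ∑ i, load i) :
    (∀ i, StatusAge.HasAverageAge P
      (fun t ω => StatusAge.age (StatusAge.DeliveredS (fun n => arr n ω) (fun n => svc n ω))
        (fun n => arr n ω) (fun n => src n ω) (a i) i t)
      ((1 / mu) * (1 + total) * (1 / load i))) ∧
    (∀ i, StatusAge.HasAverageAge P
      (fun t ω => StatusAge.age (StatusAge.DeliveredW (fun n => arr n ω) (fun n => svc n ω))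
        (fun n => arr n ω) (fun n => src n ω) (a i) i t)
      ((1 / mu) *
        (StatusAge.alphaW total + (1 + total ^ 2 / (1 + total)) * (1 / load i)))) := by
  -- Positivity of the total rate needs at least one source; without sources both claims are
  -- vacuous, so it is stated relative to some i.
  have key : ∀ i : Fin N, 0 < ∑ j, lam j := fun i =>
    Finset.sum_pos (fun j _ => hlam j) ⟨i, Finset.mem_univ i⟩
  have htot : total = (∑ j, lam j) / mu := by
    rw [htotal, Finset.sum_div]
    exact Finset.sum_congr rfl fun j _ => hload j
  have : IsProbabilityMeasure (expMeasure mu) := isProbabilityMeasure_expMeasure hmu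
  constructor <;> intro i <;> rw [hload i, htot]
  all_goals
    have hr0 := key i
    have : IsProbabilityMeasure (expMeasure (∑ j, lam j)) := isProbabilityMeasure_expMeasure hr0
    have : IsProbabilityMeasure (StatusAge.srcMeasure fun k => lam k / ∑ j, lam j) :=
      StatusAge.isProbabilityMeasure_srcMeasure (fun k => (div_pos (hlam k) hr0).le)
        (by rw [← Finset.sum_div, div_self hr0.ne'])
  · exact hinput.hasAverageAge_deliveredS hlam hmu rfl hr0 (ha i) i
  · exact hinput.hasAverageAge_deliveredW hlam hmu rfl hr0 (ha i) i
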